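/- Let $R>0$, $\Gamma>0$, $h\in\mathbb R$. On the plane put $$\mathbf a(x,y)=\Big[\tfrac{4R^2+x^2+y^2}{4R\sqrt{x^2+y^2}}\Big]^2,\quad \mathbf l(x,y)=\tfrac{8R^2}{(4R^2+x^2+y^2)^2},\quad \mathbf b(x,y)=\tfrac{2R^2[x^2+(y-2R)^2]}{4R^2+x^2+y^2}.$$ Let $\varphi_1(r)=r e^{-1/r^2}$ for $r>0$, $\varphi_1(0)=0$, let $x=\varphi_1(r)\cos\alpha$, $y=\varphi_1(r)\sin\alpha+2R$, and regard $\mathbf a,\mathbf l,\mathbf b$ and their partial derivatives $\mathbf b_x$, etc. as functions of $(r,\alpha)$. For $r>0$ let $$\hat E(r,\alpha)=\tfrac{r^2}{\mathbf l}\big(h-\tfrac{\Gamma}{8\pi}\log \mathbf b\big),\quad z_x=\sqrt{\hat E/\mathbf a}\,\cos\psi,\quad z_y=\sqrt{\hat E}\,\sin\psi,\quad \langle \mathbf z,\mathbf s\rangle_a=\mathbf a\, z_x\cos\alpha+z_y\sin\alpha,$$ $$A_1=-re^{-1/r^2}\big[(\mathbf a\mathbf l)_x z_x^2+\mathbf l_x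 z_y^2\big]-\tfrac{\Gamma}{8\pi}r^3e^{-1/r^2}\tfrac{\mathbf b_x}{\mathbf b}+\tfrac{2r^2}{r^2+2}\,\mathbf l\,\langle \mathbf z,\mathbf s\rangle_a z_x,$$ $$A_2=-re^{-1/r^2}\big[(\mathbf a\mathbf l)_y z_x^2+\mathbf l_y z_y^2\big]-\tfrac{\Gamma}{8\pi}r^3e^{-1/r^2}\tfrac{\mathbf b_y}{\mathbf b}+\tfrac{2r^2}{r^2+2}\,\mathbf l\,\langle \mathbf z,\mathbf s\rangle_a z_y,$$ $$B=-\sqrt{\mathbf a}\,\sin\psi\,A_1+\sqrt{\mathbf a}\,\sin\psi\cos\psi\,\tfrac{d}{d\tau}\sqrt{\hat E/\mathbf a}+A_2\cos\psi-\tfrac{d}{d\tau}\sqrt{\hat E}\,\sin\psi\cos\psi,$$ where, for a function $f(r,\alpha)$, $\frac{df}{d\tau}=f_r\,\frac{2r^3}{2+r^2}\,\mathbf l\,\langle \mathbf z,\mathbf s\rangle_a+f_\alpha\,\mathbf l\,(z_y\cos\alpha-\mathbf a z_x\sin\alpha)$. Extend to $r=0$ by the limits $\hat E(0,\alpha)=2\Gamma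 R^2/\pi$, $B(0,\alpha,\psi)=0$. Consider the system in the coordinates $(r,\alpha,\psi)\in\mathbb R^3$ $$\frac{dr}{d\sigma}=\frac{2r^3\hat E}{2+r^2}\,\mathbf l\,(\sqrt{\mathbf a}\cos\psi\cos\alpha+\sin\psi\sin\alpha),\quad \frac{d\alpha}{d\sigma}=\hat E\,\mathbf l\,(\sin\psi\cos\alpha-\sqrt{\mathbf a}\cos\psi\sin\alpha),\quad \frac{d\psi}{d\sigma}=B$$ on the phase space $M=\{r\ge 0,\ \hat E(r,\alpha)>0,\ (x,y)\ne(0,0)\}$; the collision manifold is $\{r=0\}$. For $P\in M$ and a neighbourhood $U$ of $P$ let $W^s_U(P)$ (resp. $W^u_U(P)$) be the set of points of $M\cap U$ from which there is a solution on $[0,\infty)$ (resp. $(-\infty,0]$) that stays in $M\cap U$ and converges to $P$ as $\sigma\to+\infty$ (resp. $\sigma\to-\infty$), and let $W^0_U(P)$, the neutral centre part, be the set of points through which there is a solution on all of $\mathbb R$ that stays in $M\cap U$. An equilibrium is called a degenerate saddle if the linearisation of the vector field there is singular and, for every neighbourhood $U$, both $W^s_U(P)$ and $W^u_U(P)$ contain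 points other than $P$. **Proposition.** For every $\alpha\in\mathbb R$ the points $P_1=(0,\alpha,\alpha)$ and $P_2=(0,\alpha,\pi+\alpha)$ are equilibria and degenerate saddles. The vector field is differentiable at $P_1$ and $P_2$ relative to $M$, and the eigenvalues of its derivative, with algebraic multiplicity, are $0,-\frac{\Gamma}{4\pi},0$ at $P_1$ and $0,\frac{\Gamma}{4\pi},0$ at $P_2$. For each $P\in\{P_1,P_2\}$ there are linearly independent vectors $v_s,v_u,v_0$ such that $P$ has arbitrarily small open neighbourhoods $U$ for which $W^s_U(P)$, $W^u_U(P)$, $W^0_U(P)$ are one-dimensional embedded $C^1$ manifolds containing $P$, with tangent vectors $v_s,v_u,v_0$ at $P$. At $P_1$, $v_s$ is an eigenvector for $-\frac{\Gamma}{4\pi}$, $v_u$ and $v_0$ lie in the kernel of the derivative, and $P_1$ is a boundary point of $W^u_U(P_1)$ and an interior point of the other two manifolds. At $P_2$, $v_u$ is an eigenvector for $\frac{\Gamma}{4\pi}$, $v_s$ and $v_0$ lie in the kernel of the derivative, and $P_2$ is a boundary point of $W^s_U(P_2)$ and an interior point of the other two manifolds. -/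

import Mathlib

open Set Filter Topology

noncomputable section

namespace McGehee

/-! ### Local invariant sets of a vector field -/

section Dynamics

variable {E : Type*} [NormedAddCommGroup E] [NormedSpace ℝ E]

/-- On the time set `T`, the curve `γ` solves `γ' = X γ` and stays in `S`. -/
def IsSolution (X : E → E) (S : Set E) (T : Set ℝ) (γ : ℝ → E) : Prop :=
  ∀ t ∈ T, γ t ∈ S ∧ HasDerivWithinAt γ (X (γ t)) T t

/-- Local stable manifold of `P` in `U`: the points of the phase space `M` whose forward orbit
exists for all times, stays in `U` and converges to `P`. -/
def stableSet (X : E → E) (M : Set E) (P : E) (U : Set E) : Set E :=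
  {p | ∃ γ : ℝ → E, γ 0 = p ∧ IsSolution X (M ∩ U) (Ici 0) γ ∧ Tendsto γ atTop (𝓝 P)}

/-- Local unstable manifold of `P` in `U`: the points of the phase space `M` whose backward orbit
exists for all times, stays in `U` and converges to `P`. -/
def unstableSet (X : E → E) (M : Set E) (P : E) (U : Set E) : Set E :=
  {p | ∃ γ : ℝ → E, γ 0 = p ∧ IsSolution X (M ∩ U) (Iic 0) γ ∧ Tendsto γ atBot (𝓝 P)}

/-- Local neutral (centre) set in `U`: the points of the phase space `M` whose complete orbit
exists for all positive and negative times and stays in `U`. -/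
def centreSet (X : E → E) (M : Set E) (U : Set E) : Set E :=
  {p | ∃ γ : ℝ → E, γ 0 = p ∧ IsSolution X (M ∩ U) univ γ}

/-- `S` is an embedded `C¹` arc, regularly parametrised by the interval `I`, that passes through
`P` at parameter `0` with velocity `v`. -/
def IsArc (I : Set ℝ) (S : Set E) (P v : E) : Prop :=
  ∃ c : ℝ → E, ContDiffOn ℝ 1 c I ∧ (∀ t ∈ I, derivWithin c I t ≠ 0) ∧
    IsEmbedding (fun t : I => c t) ∧ c '' I = S ∧ c 0 = P ∧ derivWithin c I 0 = v

/-- `S` is a one-dimensional embedded `C¹` manifold with `P` in its interior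
and tangent vector `v` at `P`. -/
def IsCurveThrough (S : Set E) (P v : E) : Prop :=
  ∃ δ : ℝ, 0 < δ ∧ IsArc (Ioo (-δ) δ) S P v

/-- `S` is a one-dimensional embedded `C¹` manifold with boundary point `P`
and tangent vector `v` at `P`. -/
def IsCurveFrom (S : Set E) (P v : E) : Prop :=
  ∃ δ : ℝ, 0 < δ ∧ IsArc (Ico 0 δ) S P v

/-- `P` is a degenerate saddle of `X` on `M`: an equilibrium whose linearisation is singular
and which has nontrivial stable and nontrivial unstable manifolds. -/
def IsDegenerateSaddle (X : E → E) (M : Set E) (P : E) : Prop :=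
  P ∈ M ∧ X P = 0 ∧ (∃ J : E →L[ℝ] E, HasFDerivWithinAt X J M P ∧ J.det = 0) ∧
    ∀ V ∈ 𝓝 P, (∃ p ∈ stableSet X M P V, p ≠ P) ∧ (∃ p ∈ unstableSet X M P V, p ≠ P)

end Dynamics

/-! ### The functions of the stereographic plane -/

def aXY (R x y : ℝ) : ℝ := ((4 * R ^ 2 + x ^ 2 + y ^ 2) / (4 * R * √(x ^ 2 + y ^ 2))) ^ 2

def lXY (R x y : ℝ) : ℝ := 8 * R ^ 2 / (4 * R ^ 2 + x ^ 2 + y ^ 2) ^ 2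

def bXY (R x y : ℝ) : ℝ :=
  2 * R ^ 2 * (x ^ 2 + (y - 2 * R) ^ 2) / (4 * R ^ 2 + x ^ 2 + y ^ 2)

/-! ### McGehee coordinates -/

def phi1 (r : ℝ) : ℝ := r * Real.exp (-1 / r ^ 2)

def xCoord (r α : ℝ) : ℝ := phi1 r * Real.cos α

def yCoord (R r α : ℝ) : ℝ := phi1 r * Real.sin α + 2 * R

def a (R r α : ℝ) : ℝ := aXY R (xCoord r α) (yCoord R r α)

def l (R r α : ℝ) : ℝ := lXY R (xCoord r α) (yCoord R r α)

def b (R r α : ℝ) : ℝ := bXY R (xCoord r α) (yCoord R r α)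

/-- The partial derivative of a function of `(x, y)` in `x`, evaluated at `(r, α)`. -/
def dX (f : ℝ → ℝ → ℝ) (R r α : ℝ) : ℝ := deriv (fun x => f x (yCoord R r α)) (xCoord r α)

/-- The partial derivative of a function of `(x, y)` in `y`, evaluated at `(r, α)`. -/
def dY (f : ℝ → ℝ → ℝ) (R r α : ℝ) : ℝ := deriv (fun y => f (xCoord r α) y) (yCoord R r α)

/-- The rescaled kinetic energy on the energy level `h`,
extended to `r = 0` by its limit `2 Γ R² / π`. -/
def energy (R Γ h r α : ℝ) : ℝ :=
  if r = 0 then 2 * Γ * R ^ 2 / Real.pi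
  else r ^ 2 / l R r α * (h - Γ / (8 * Real.pi) * Real.log (b R r α))

def zx (R Γ h r α ψ : ℝ) : ℝ := √(energy R Γ h r α / a R r α) * Real.cos ψ

def zy (R Γ h r α ψ : ℝ) : ℝ := √(energy R Γ h r α) * Real.sin ψ

/-- The bracket `⟨z, s(α)⟩_a`. -/
def zs (R Γ h r α ψ : ℝ) : ℝ :=
  a R r α * zx R Γ h r α ψ * Real.cos α + zy R Γ h r α ψ * Real.sin α

/-- `dr/dτ` -/
def rTau (R Γ h r α ψ : ℝ) : ℝ := 2 * r ^ 3 / (2 + r ^ 2) * l R r α * zs R Γ h r α ψ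

/-- `dα/dτ` -/
def alphaTau (R Γ h r α ψ : ℝ) : ℝ :=
  l R r α * (zy R Γ h r α ψ * Real.cos α - a R r α * zx R Γ h r α ψ * Real.sin α)

/-- `dz_x/dτ` -/
def A1 (R Γ h r α ψ : ℝ) : ℝ :=
  -(r * Real.exp (-1 / r ^ 2)) *
      (dX (fun x y => aXY R x y * lXY R x y) R r α * zx R Γ h r α ψ ^ 2
        + dX (lXY R) R r α * zy R Γ h r α ψ ^ 2)
    - Γ / (8 * Real.pi) * r ^ 3 * Real.exp (-1 / r ^ 2) * (dX (bXY R) R r α / b R r α)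
    + 2 * (r ^ 2 / (r ^ 2 + 2)) * l R r α * zs R Γ h r α ψ * zx R Γ h r α ψ

/-- `dz_y/dτ` -/
def A2 (R Γ h r α ψ : ℝ) : ℝ :=
  -(r * Real.exp (-1 / r ^ 2)) *
      (dY (fun x y => aXY R x y * lXY R x y) R r α * zx R Γ h r α ψ ^ 2
        + dY (lXY R) R r α * zy R Γ h r α ψ ^ 2)
    - Γ / (8 * Real.pi) * r ^ 3 * Real.exp (-1 / r ^ 2) * (dY (bXY R) R r α / b R r α)
    + 2 * (r ^ 2 / (r ^ 2 + 2)) * l R r α * zs R Γ h r α ψ * zy R Γ h r α ψ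

/-- The derivative `d/dτ` of a function of `(r, α)` along the flow. -/
def dTau (f : ℝ → ℝ → ℝ) (R Γ h r α ψ : ℝ) : ℝ :=
  deriv (fun ρ => f ρ α) r * rTau R Γ h r α ψ + deriv (fun β => f r β) α * alphaTau R Γ h r α ψ

/-- The right-hand side of the equation for `ψ`, extended to `r = 0` by its limit `0`. -/
def B (R Γ h r α ψ : ℝ) : ℝ :=
  if r = 0 then 0
  else
    -(√(a R r α) * Real.sin ψ * A1 R Γ h r α ψ)
      + √(a R r α) * Real.sin ψ * Real.cos ψ *
          dTau (fun ρ β => √(energy R Γ h ρ β / a R ρ β)) R Γ h r α ψ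
      + A2 R Γ h r α ψ * Real.cos ψ
      - dTau (fun ρ β => √(energy R Γ h ρ β)) R Γ h r α ψ * Real.sin ψ * Real.cos ψ

/-- The regularised vector field in the coordinates `p = (r, α, ψ)`, with time `σ`. -/
def field (R Γ h : ℝ) (p : Fin 3 → ℝ) : Fin 3 → ℝ :=
  ![2 * p 0 ^ 3 * energy R Γ h (p 0) (p 1) / (2 + p 0 ^ 2) * l R (p 0) (p 1) *
      (√(a R (p 0) (p 1)) * Real.cos (p 2) * Real.cos (p 1) + Real.sin (p 2) * Real.sin (p 1)),
    energy R Γ h (p 0) (p 1) * l R (p 0) (p 1) *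
      (Real.sin (p 2) * Real.cos (p 1) - √(a R (p 0) (p 1)) * Real.cos (p 2) * Real.sin (p 1)),
    B R Γ h (p 0) (p 1) (p 2)]

/-- The phase space: `r ≥ 0`, positive kinetic energy, and the origin of the plane, where the
metric is singular, is left out. -/
def phaseSpace (R Γ h : ℝ) : Set (Fin 3 → ℝ) :=
  {p | 0 ≤ p 0 ∧ 0 < energy R Γ h (p 0) (p 1) ∧
    ¬(xCoord (p 0) (p 1) = 0 ∧ yCoord R (p 0) (p 1) = 0)}

end McGehee

end

/-! Write c = Γ/(4π) and θ = ψ - α. The obstacle is the behaviour in r: the equations contain the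
flat function φ₁(r) and the function r² log r, which is C¹ but not C² at 0. The remedy is to treat φ
= φ₁(r), r and w = r² log r as independent variables. Since log b contains 2 log φ₁(r) = 2 log r -
2/r², the product of the energy and l is c plus terms that vanish with r and w (`energy_mul_l`), and
cancellations in `B` (`B_eq`) leave a field that is smooth in (φ, r, w, α, ψ) near the base point.

Near P₁ the field has the form r' = r³ρ with ρ close to c. On r = 0 it reads θ' = -c sin θ, ψ' = 0.
Both φ₁ and r² log r have derivative 0 at 0, so the linearisation is v ↦ (0, c(v₂ - v₁), 0).

An orbit that tends to P₁ forwards must lie in r = 0, because r never decreases; there ψ is constant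
and θ decays, so the stable set is a segment. A complete orbit that stays near P₁ also lies in r =
0, as otherwise r would outgrow the neighbourhood; and since θ expands backwards in time, it is an
equilibrium with θ = 0.

For the unstable set take r as the independent variable. Then Y = (θ, ψ) solves dY/dr = r⁻³ G(r, Y),
and for φ = 0 the field G is (-m₁ tan θ, m₂ r² tan θ) with m₁ near 1. The damping of θ dominates the
coupling of order r², and the dependence on φ contributes only O(r⁷). Hence r⁻³G satisfies a
one-sided Lipschitz bound that is uniform down to r = 0 (`StiffField.singularField`), although its
Lipschitz constant blows up. So solutions started at (0, α) at ever smaller r converge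
(`SingularField.exists_solution`), the limit is C¹ up to r = 0 with zero derivative
(`StiffField.exists_solution`), and every orbit that emanates from P₁ with r > 0 lies on its graph
(`SaddleModel.unstableSet_eq`).

Finally ψ ↦ ψ + π changes the sign of the field and preserves the phase space, so P₂ is P₁ with time
reversed. -/

noncomputable section

namespace McGehee

/-! ### A singular initial value problem -/

/-- Grönwall's inequality for `u' ≤ L u + C r ^ 8`. -/
theorem gronwall_pow {u u' : ℝ → ℝ} {a b L C : ℝ} (ha : 0 ≤ a) (hab : a ≤ b) (hb : b ≤ 1)
    (hL : 0 ≤ L) (hC : 0 ≤ C) (hu : ∀ r ∈ Icc a b, HasDerivWithinAt u (u' r) (Icc a b) r)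
    (hu' : ∀ r ∈ Ioo a b, u' r ≤ L * u r + C * r ^ 8) (hua : 0 ≤ u a) :
    u b ≤ Real.exp L * (u a + C * b ^ 9) := by
  -- Integrating factor together with a primitive of the source term: (r ^ 9)' = 9 r ^ 8 more than
  -- covers r ^ 8. The exponent 8 is the square of the r ^ 4 in `SingularField.centre`.
  set w : ℝ → ℝ := fun r => u r * Real.exp (-L * (r - a)) - C * r ^ 9 with hw
  have hexp : ∀ r, HasDerivAt (fun r => Real.exp (-L * (r - a)))
      (Real.exp (-L * (r - a)) * (-L)) r := fun r => by
    have := (((hasDerivAt_id r).sub_const a).const_mul (-L)).exp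
    simpa using this
  have hpow : ∀ r : ℝ, HasDerivAt (fun r : ℝ => C * r ^ 9) (C * (9 * r ^ 8)) r := fun r => by
    have := (hasDerivAt_pow 9 r).const_mul C
    simpa using this
  have hd : ∀ r ∈ Icc a b, HasDerivWithinAt w
      (u' r * Real.exp (-L * (r - a)) + u r * (Real.exp (-L * (r - a)) * (-L))
        - C * (9 * r ^ 8)) (Icc a b) r := fun r hr =>
    ((hu r hr).mul (hexp r).hasDerivWithinAt).sub (hpow r).hasDerivWithinAt
  have hanti : AntitoneOn w (Icc a b) := by
    refine antitoneOn_of_hasDerivWithinAt_nonpos (convex_Icc a b)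
      (fun r hr => (hd r hr).continuousWithinAt)
      (fun r hr => (hd r (interior_subset hr)).mono interior_subset) fun r hr => ?_
    rw [interior_Icc] at hr
    have h1 := hu' r hr
    have h2 : Real.exp (-L * (r - a)) ≤ 1 := by
      rw [Real.exp_le_one_iff]; nlinarith [hr.1]
    have h3 := Real.exp_pos (-L * (r - a))
    have h4 : 0 ≤ C * r ^ 8 := by positivity
    nlinarith [mul_le_mul_of_nonneg_right h1 h3.le, mul_le_mul_of_nonneg_left h2 h4]
  have h := hanti (left_mem_Icc.2 hab) (right_mem_Icc.2 hab) hab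
  simp only [hw, sub_self, mul_zero, Real.exp_zero, mul_one] at h
  have h0 : 0 ≤ C * a ^ 9 := by positivity
  have h1 : u b * Real.exp (-L * (b - a)) ≤ u a + C * b ^ 9 := by linarith
  have h2 : u b = Real.exp (L * (b - a)) * (u b * Real.exp (-L * (b - a))) := by
    rw [mul_left_comm, ← Real.exp_add]; ring_nf; simp
  rw [h2]
  have h3 : Real.exp (L * (b - a)) ≤ Real.exp L :=
    Real.exp_le_exp.2 (by nlinarith)
  have h4 : 0 ≤ C * b ^ 9 := by have := ha.trans hab; positivity
  calc _ ≤ Real.exp (L * (b - a)) * (u a + C * b ^ 9) := by gcongr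
    _ ≤ _ := by gcongr

/-- The square of the Euclidean norm on `ℝ × ℝ`. -/
def sqNorm (v : ℝ × ℝ) : ℝ := v.1 ^ 2 + v.2 ^ 2

theorem sqNorm_nonneg (v : ℝ × ℝ) : 0 ≤ sqNorm v := by unfold sqNorm; positivity

theorem sq_norm_le_sqNorm (v : ℝ × ℝ) : ‖v‖ ^ 2 ≤ sqNorm v := by
  rw [Prod.norm_def, sqNorm, Real.norm_eq_abs, Real.norm_eq_abs]
  rcases max_cases |v.1| |v.2| with ⟨h, -⟩ | ⟨h, -⟩ <;> rw [h, sq_abs] <;>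
    nlinarith [sq_nonneg v.1, sq_nonneg v.2]

theorem sqNorm_le_sq_norm (v : ℝ × ℝ) : sqNorm v ≤ 2 * ‖v‖ ^ 2 := by
  have h1 := norm_fst_le v
  have h2 := norm_snd_le v
  rw [Real.norm_eq_abs] at h1 h2
  have h3 := pow_le_pow_left₀ (abs_nonneg _) h1 2
  have h4 := pow_le_pow_left₀ (abs_nonneg _) h2 2
  rw [sq_abs] at h3 h4
  unfold sqNorm
  linarith

/-- The Euclidean inner product on `ℝ × ℝ`. -/
def dotProd (v w : ℝ × ℝ) : ℝ := v.1 * w.1 + v.2 * w.2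

theorem HasDerivWithinAt.sqNorm {Y : ℝ → ℝ × ℝ} {Y' : ℝ × ℝ} {s : Set ℝ} {r : ℝ}
    (h : HasDerivWithinAt Y Y' s r) :
    HasDerivWithinAt (fun r => sqNorm (Y r)) (2 * dotProd (Y r) Y') s r := by
  have h1 : HasDerivWithinAt (fun r => (Y r).1) Y'.1 s r := h.fst
  have h2 : HasDerivWithinAt (fun r => (Y r).2) Y'.2 s r := h.snd
  have := (h1.pow 2).add (h2.pow 2)
  refine (this.congr_deriv ?_)
  simp [dotProd]; ring

/-- A vector field `F r Y` on the plane, singular at `r = 0`, satisfying a one-sided Lipschitz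
condition uniformly in `r`. -/
structure SingularField (F : ℝ → ℝ × ℝ → ℝ × ℝ) (Y₀ : ℝ × ℝ) (ε K L C : ℝ) : Prop where
  pos : 0 < ε
  le_one : ε ≤ 1
  K_nonneg : 0 ≤ K
  L_nonneg : 0 ≤ L
  C_nonneg : 0 ≤ C
  lipschitz : ∀ r ∈ Ioc 0 ε, ∀ Y Z, ‖F r Y - F r Z‖ ≤ K / r ^ 3 * ‖Y - Z‖
  bound : ∀ r ∈ Ioc 0 ε, ∀ Y, ‖F r Y‖ ≤ K / r ^ 3
  continuousOn : ∀ Y, ContinuousOn (fun r => F r Y) (Ioc 0 ε)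
  one_sided : ∀ r ∈ Ioc 0 ε, ∀ Y Z, dotProd (Y - Z) (F r Y - F r Z) ≤ L * sqNorm (Y - Z)
  centre : ∀ r ∈ Ioc 0 ε, ‖F r Y₀‖ ≤ C * r ^ 4

/-! ### Solving the singular problem by starting ever closer to r = 0. -/

namespace SingularField

variable {F : ℝ → ℝ × ℝ → ℝ × ℝ} {Y₀ : ℝ × ℝ} {ε K L C : ℝ}

/-- Away from r = 0 the field is bounded and Lipschitz, uniformly in Y, so Picard–Lindelöf covers
all of [ρ, ε] at once: the radius of the ball of admissible values is the bound K / ρ³ times the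
length of the interval. -/
theorem exists_solution_Icc (hF : SingularField F Y₀ ε K L C) {ρ : ℝ} (hρ : ρ ∈ Ioc 0 ε) :
    ∃ Y : ℝ → ℝ × ℝ, Y ρ = Y₀ ∧
      ∀ r ∈ Icc ρ ε, HasDerivWithinAt Y (F r (Y r)) (Icc ρ ε) r := by
  have hρ0 := hρ.1
  have hK := hF.K_nonneg
  have hmem : ∀ r ∈ Icc ρ ε, r ∈ Ioc 0 ε := fun r hr => ⟨hρ0.trans_le hr.1, hr.2⟩
  have hle : ∀ r ∈ Icc ρ ε, K / r ^ 3 ≤ K / ρ ^ 3 := fun r hr => by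
    have := hr.1; gcongr
  have hKρ : 0 ≤ K / ρ ^ 3 := by positivity
  have hερ : 0 ≤ ε - ρ := sub_nonneg.2 hρ.2
  have hpl : IsPicardLindelof F (⟨ρ, left_mem_Icc.2 hρ.2⟩ : Icc ρ ε) Y₀
      ⟨K / ρ ^ 3 * (ε - ρ), by positivity⟩ 0 ⟨K / ρ ^ 3, hKρ⟩ ⟨K / ρ ^ 3, hKρ⟩ := by
    refine ⟨fun r hr => ?_, fun Y _ => (hF.continuousOn Y).mono hmem, fun r hr Y _ => ?_, ?_⟩
    · refine (LipschitzWith.of_dist_le_mul fun Y Z => ?_).lipschitzOnWith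
      rw [dist_eq_norm, dist_eq_norm]
      exact (hF.lipschitz r (hmem r hr) Y Z).trans
        (mul_le_mul_of_nonneg_right (hle r hr) (norm_nonneg _))
    · exact (hF.bound r (hmem r hr) Y).trans (hle r hr)
    · simp only [sub_self, max_eq_left hερ, NNReal.coe_zero, sub_zero]; exact le_rfl
  exact hpl.exists_eq_forall_mem_Icc_hasDerivWithinAt₀

/-- Only the one-sided bound enters the derivative of the squared distance. Hence the factor exp (2
L) does not depend on ρ, whereas the Lipschitz constant K / r³ would give a useless one. -/
theorem sqNorm_sub_le (hF : SingularField F Y₀ ε K L C) {Y Z : ℝ → ℝ × ℝ} {ρ r : ℝ} (hρ : 0 < ρ)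
    (hρr : ρ ≤ r) (hr : r ≤ ε) (hY : ∀ s ∈ Icc ρ r, HasDerivWithinAt Y (F s (Y s)) (Icc ρ r) s)
    (hZ : ∀ s ∈ Icc ρ r, HasDerivWithinAt Z (F s (Z s)) (Icc ρ r) s) :
    sqNorm (Y r - Z r) ≤ Real.exp (2 * L) * sqNorm (Y ρ - Z ρ) := by
  have h := gronwall_pow (C := 0) (L := 2 * L) hρ.le hρr (hr.trans hF.le_one)
    (by linarith [hF.L_nonneg]) le_rfl
    (fun s hs => HasDerivWithinAt.sqNorm ((hY s hs).sub (hZ s hs))) (fun s hs => ?_)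
    (sqNorm_nonneg _)
  · simpa using h
  · have := hF.one_sided s ⟨hρ.trans hs.1, hs.2.le.trans hr⟩ (Y s) (Z s)
    simp only [Pi.sub_apply]
    linarith

/-- Split F Y = (F Y - F Y₀) + F Y₀. The first part is controlled by the one-sided bound, the second
by 2⟨u, v⟩ ≤ |u|² + |v|² with |F Y₀|² ≤ 2 C² r⁸. -/
theorem sqNorm_sub_centre_le (hF : SingularField F Y₀ ε K L C) {Y : ℝ → ℝ × ℝ} {ρ r : ℝ}
    (hρ : 0 < ρ) (hρr : ρ ≤ r) (hr : r ≤ ε)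
    (hY : ∀ s ∈ Icc ρ r, HasDerivWithinAt Y (F s (Y s)) (Icc ρ r) s) (h0 : Y ρ = Y₀) :
    sqNorm (Y r - Y₀) ≤ Real.exp (2 * L + 1) * (2 * C ^ 2 * r ^ 9) := by
  have h := gronwall_pow (C := 2 * C ^ 2) (L := 2 * L + 1) hρ.le hρr (hr.trans hF.le_one)
    (by linarith [hF.L_nonneg]) (by positivity)
    (fun s hs => HasDerivWithinAt.sqNorm ((hY s hs).sub (hasDerivWithinAt_const s _ Y₀)))
    (fun s hs => ?_) (sqNorm_nonneg _)
  · simpa [h0, sqNorm] using h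
  · have hs' : s ∈ Ioc 0 ε := ⟨hρ.trans hs.1, hs.2.le.trans hr⟩
    have h1 := hF.one_sided s hs' (Y s) Y₀
    have h2 := hF.centre s hs'
    have h3 := sqNorm_le_sq_norm (F s Y₀)
    have h4 : ‖F s Y₀‖ ^ 2 ≤ C ^ 2 * s ^ 8 := by
      calc _ ≤ (C * s ^ 4) ^ 2 := by gcongr
        _ = _ := by ring
    simp only [Pi.sub_apply, sub_zero]
    simp only [dotProd, sqNorm, Prod.fst_sub, Prod.snd_sub] at h1 h3 ⊢
    nlinarith [sq_nonneg ((Y s).1 - Y₀.1 - (F s Y₀).1), sq_nonneg ((Y s).2 - Y₀.2 - (F s Y₀).2)]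

theorem exists_solution (hF : SingularField F Y₀ ε K L C) :
    ∃ (Y : ℝ → ℝ × ℝ) (D : ℝ), 0 ≤ D ∧
      (∀ r ∈ Ioo 0 ε, HasDerivAt Y (F r (Y r)) r) ∧
      ∀ r ∈ Ioo 0 ε, ‖Y r - Y₀‖ ≤ D * r ^ 4 := by
  have hε := hF.pos
  have hε1 := hF.le_one
  choose! Z hZ0 hZ using fun ρ (hρ : ρ ∈ Ioc 0 ε) => hF.exists_solution_Icc hρ
  have hZr : ∀ ρ ∈ Ioc 0 ε, ∀ σ, ρ ≤ σ → ∀ r ≤ ε, ∀ s ∈ Icc σ r,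
      HasDerivWithinAt (Z ρ) (F s (Z ρ s)) (Icc σ r) s := fun ρ hρ σ hσ r hr s hs =>
    (hZ ρ hρ s ⟨hσ.trans hs.1, hs.2.trans hr⟩).mono (Icc_subset_Icc hσ hr)
  -- D² is the constant obtained by chaining `sqNorm_sub_centre_le` and `sqNorm_sub_le`. Half a
  -- power of r is given away in r⁹ ≤ r⁸.
  set D := √(Real.exp (2 * L) * (Real.exp (2 * L + 1) * (2 * C ^ 2))) with hD
  have key : ∀ {x : ℝ × ℝ} {r : ℝ}, 0 ≤ r → r ≤ 1 →
      sqNorm x ≤ Real.exp (2 * L) * (Real.exp (2 * L + 1) * (2 * C ^ 2 * r ^ 9)) →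
      ‖x‖ ≤ D * r ^ 4 := by
    intro x r hr0 hr1 hx
    refine abs_le_of_sq_le_sq' ?_ (by positivity) |>.2
    rw [mul_pow, hD, Real.sq_sqrt (by positivity)]
    have h9 : r ^ 9 ≤ (r ^ 4) ^ 2 := by
      rw [← pow_mul]; exact pow_le_pow_of_le_one hr0 hr1 (by norm_num)
    calc _ ≤ _ := (sq_norm_le_sqNorm x).trans hx
      _ = Real.exp (2 * L) * (Real.exp (2 * L + 1) * (2 * C ^ 2)) * r ^ 9 := by ring
      _ ≤ _ := by gcongr
  have hcent : ∀ ρ ∈ Ioc 0 ε, ∀ r ∈ Icc ρ ε, ‖Z ρ r - Y₀‖ ≤ D * r ^ 4 := by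
    intro ρ hρ r hr
    refine key (hρ.1.le.trans hr.1) (hr.2.trans hε1) ?_
    refine (hF.sqNorm_sub_centre_le hρ.1 hr.1 hr.2 (hZr ρ hρ ρ le_rfl r hr.2)
      (hZ0 ρ hρ)).trans ?_
    have : 0 ≤ r := hρ.1.le.trans hr.1
    exact le_mul_of_one_le_left (by positivity) (Real.one_le_exp (by linarith [hF.L_nonneg]))
  -- At r = σ the solution started at ρ is still O(σ⁴)-close to Y₀, which is the value of the
  -- solution started at σ; the uniform stability estimate carries this closeness to every later r.
  have hcauchy : ∀ ρ ∈ Ioc 0 ε, ∀ σ ∈ Icc ρ ε, ∀ r ∈ Icc σ ε,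
      ‖Z ρ r - Z σ r‖ ≤ D * σ ^ 4 := by
    intro ρ hρ σ hσ r hr
    have hσ0 := hρ.1.trans_le hσ.1
    refine key hσ0.le (hσ.2.trans hε1) ?_
    refine (hF.sqNorm_sub_le hσ0 hr.1 hr.2 (hZr ρ hρ σ hσ.1 r hr.2)
      (hZr σ ⟨hσ0, hσ.2⟩ σ le_rfl r hr.2)).trans ?_
    rw [hZ0 σ ⟨hσ0, hσ.2⟩]
    gcongr
    exact hF.sqNorm_sub_centre_le hρ.1 hσ.1 hσ.2 (hZr ρ hρ ρ le_rfl σ hσ.2) (hZ0 ρ hρ)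
  set ρ : ℕ → ℝ := fun n => ε / (n + 1) with hρdef
  have hρpos : ∀ n, ρ n ∈ Ioc 0 ε := fun n => by
    refine ⟨by positivity, div_le_self hε.le ?_⟩
    have : (0 : ℝ) ≤ n := n.cast_nonneg
    linarith
  have hρanti : Antitone ρ := fun m n hmn => by
    simp only [hρdef]; gcongr
  have hρlim : Tendsto ρ atTop (𝓝 0) := by
    have := (tendsto_one_div_add_atTop_nhds_zero_nat (𝕜 := ℝ)).const_mul ε
    simpa [hρdef, div_eq_mul_inv] using this
  have hDlim : Tendsto (fun n => D * ρ n ^ 4) atTop (𝓝 0) := by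
    simpa using (hρlim.pow 4).const_mul D
  have hev : ∀ r, 0 < r → ∃ N, ∀ n ≥ N, ρ n ≤ r := fun r hr =>
    eventually_atTop.1 ((hρlim.eventually_lt_const hr).mono fun _ h => h.le)
  have hlim : ∀ r ∈ Ioc 0 ε, ∃ y, Tendsto (fun n => Z (ρ n) r) atTop (𝓝 y) := by
    intro r hr
    obtain ⟨N, hN⟩ := hev r hr.1
    refine cauchySeq_tendsto_of_complete (Metric.cauchySeq_iff'.2 fun e he => ?_)
    obtain ⟨M, hM⟩ := eventually_atTop.1 (hDlim.eventually_lt_const he)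
    refine ⟨max M N, fun n hn => ?_⟩
    rw [dist_eq_norm]
    exact (hcauchy _ (hρpos n) _ ⟨hρanti hn, (hρpos _).2⟩ r
      ⟨hN _ (le_max_right _ _), hr.2⟩).trans_lt (hM _ (le_max_left _ _))
  choose! Y hY using hlim
  have hYZ : ∀ n, ∀ r ∈ Icc (ρ n) ε, ‖Z (ρ n) r - Y r‖ ≤ D * ρ n ^ 4 := by
    intro n r hr
    have hr' : r ∈ Ioc 0 ε := ⟨(hρpos n).1.trans_le hr.1, hr.2⟩
    refine le_of_tendsto ((tendsto_const_nhds.sub (hY r hr')).norm) ?_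
    filter_upwards [eventually_ge_atTop n] with m hm
    rw [norm_sub_rev]
    exact hcauchy _ (hρpos m) _ ⟨hρanti hm, (hρpos n).2⟩ r hr
  refine ⟨Y, D, Real.sqrt_nonneg _, fun r hr => ?_, fun r hr => ?_⟩
  · have hr2 : 0 < r / 2 := half_pos hr.1
    obtain ⟨N, hN⟩ := hev (r / 2) hr2
    -- On (r / 2, ε) the Lipschitz constant is at most K / (r / 2)³, so uniform convergence of the
    -- solutions gives uniform convergence of their derivatives.
    refine hasDerivAt_of_tendstoUniformlyOn (l := atTop) (f := fun n => Z (ρ n))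
      (f' := fun n s => F s (Z (ρ n) s)) (g' := fun s => F s (Y s))
      (isOpen_Ioo (a := r / 2) (b := ε)) ?_ ?_ (fun s hs => hY s ⟨hr2.trans hs.1, hs.2.le⟩)
      ⟨half_lt_self hr.1, hr.2⟩
    · have hlim' : Tendsto (fun n => K / (r / 2) ^ 3 * (D * ρ n ^ 4)) atTop (𝓝 0) := by
        simpa using hDlim.const_mul (K / (r / 2) ^ 3)
      refine Metric.tendstoUniformlyOn_iff.2 fun e he => ?_
      filter_upwards [hlim'.eventually_lt_const he, eventually_ge_atTop N] with n hn hnN s hs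
      have hs0 : 0 < s := hr2.trans hs.1
      rw [dist_comm, dist_eq_norm]
      refine lt_of_le_of_lt ?_ hn
      refine (hF.lipschitz s ⟨hs0, hs.2.le⟩ _ _).trans ?_
      have hK := hF.K_nonneg
      have h1 := hs.1.le
      have h2 := hYZ n s ⟨(hN n hnN).trans h1, hs.2.le⟩
      gcongr
    · filter_upwards [eventually_ge_atTop N] with n hnN s hs
      exact (hZ _ (hρpos n) s ⟨(hN n hnN).trans hs.1.le, hs.2.le⟩).hasDerivAt
        (Icc_mem_nhds ((hN n hnN).trans_lt hs.1) hs.2)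
  · refine le_of_tendsto (((hY r ⟨hr.1, hr.2.le⟩).sub_const Y₀).norm) ?_
    obtain ⟨N, hN⟩ := hev r hr.1
    filter_upwards [eventually_ge_atTop N] with n hn
    exact hcent _ (hρpos n) r ⟨hN n hn, hr.2.le⟩

end SingularField

/-- The nearest point of `[c - η, c + η]`. -/
def clamp (c η x : ℝ) : ℝ := max (c - η) (min (c + η) x)

theorem abs_clamp_sub_le {c η : ℝ} (hη : 0 ≤ η) (x : ℝ) : |clamp c η x - c| ≤ η := by
  unfold clamp; rw [abs_le]; grind

theorem clamp_eq_self {c η x : ℝ} (hx : |x - c| ≤ η) : clamp c η x = x := by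
  rw [abs_le] at hx; unfold clamp; grind

theorem clamp_sub_nonneg {c η x y : ℝ} (h : x ≤ y) : 0 ≤ clamp c η y - clamp c η x := by
  unfold clamp; grind

theorem clamp_sub_le {c η x y : ℝ} (h : x ≤ y) : clamp c η y - clamp c η x ≤ y - x := by
  unfold clamp; grind

theorem abs_clamp_sub_clamp_le (c η x y : ℝ) : |clamp c η y - clamp c η x| ≤ |y - x| := by
  rcases le_total x y with h | h
  · rw [abs_of_nonneg (clamp_sub_nonneg h), abs_of_nonneg (sub_nonneg.2 h)]
    exact clamp_sub_le h
  · rw [abs_sub_comm, abs_sub_comm y, abs_of_nonneg (clamp_sub_nonneg h),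
      abs_of_nonneg (sub_nonneg.2 h)]
    exact clamp_sub_le h

/-- The nearest point of the square of half-width `η` centred at `Y₀`. -/
def clampBox (Y₀ : ℝ × ℝ) (η : ℝ) (Y : ℝ × ℝ) : ℝ × ℝ := (clamp Y₀.1 η Y.1, clamp Y₀.2 η Y.2)

theorem norm_clampBox_sub_le {Y₀ : ℝ × ℝ} {η : ℝ} (hη : 0 ≤ η) (Y : ℝ × ℝ) :
    ‖clampBox Y₀ η Y - Y₀‖ ≤ η := by
  rw [Prod.norm_def]
  exact max_le (abs_clamp_sub_le hη _) (abs_clamp_sub_le hη _)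

theorem norm_clampBox_sub_clampBox_le (Y₀ : ℝ × ℝ) (η : ℝ) (Y Z : ℝ × ℝ) :
    ‖clampBox Y₀ η Y - clampBox Y₀ η Z‖ ≤ ‖Y - Z‖ := by
  rw [Prod.norm_def, Prod.norm_def]
  exact max_le_max (abs_clamp_sub_clamp_le _ _ _ _) (abs_clamp_sub_clamp_le _ _ _ _)

theorem clampBox_eq_self {Y₀ Y : ℝ × ℝ} {η : ℝ} (h : ‖Y - Y₀‖ ≤ η) : clampBox Y₀ η Y = Y :=
  Prod.ext (clamp_eq_self ((norm_fst_le _).trans h)) (clamp_eq_self ((norm_snd_le _).trans h))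

/-- Local estimates on a field `G`, attracting in the first component, under which `r⁻³ G r Y` is
a singular field near `Y₀`. -/
structure StiffField (G : ℝ → ℝ × ℝ → ℝ × ℝ) (Y₀ : ℝ × ℝ) (ε η K : ℝ) : Prop where
  pos : 0 < ε
  le_one : ε ≤ 1
  η_pos : 0 < η
  K_nonneg : 0 ≤ K
  lipschitz : ∀ r ∈ Ioc 0 ε, ∀ Y Z, ‖Y - Y₀‖ ≤ η → ‖Z - Y₀‖ ≤ η →
    ‖G r Y - G r Z‖ ≤ K * ‖Y - Z‖
  bound : ∀ r ∈ Ioc 0 ε, ∀ Y, ‖Y - Y₀‖ ≤ η → ‖G r Y‖ ≤ K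
  continuousOn : ∀ Y, ‖Y - Y₀‖ ≤ η → ContinuousOn (fun r => G r Y) (Ioc 0 ε)
  fst_le : ∀ r ∈ Ioc 0 ε, ∀ Y Z, ‖Y - Y₀‖ ≤ η → ‖Z - Y₀‖ ≤ η → Z.1 ≤ Y.1 →
    (G r Y).1 - (G r Z).1 ≤ -(1 / 2) * (Y.1 - Z.1) + K * r ^ 3 * ‖Y - Z‖
  snd_le : ∀ r ∈ Ioc 0 ε, ∀ Y Z, ‖Y - Y₀‖ ≤ η → ‖Z - Y₀‖ ≤ η →
    |(G r Y).2 - (G r Z).2| ≤ K * r ^ 2 * |Y.1 - Z.1| + K * r ^ 3 * ‖Y - Z‖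
  centre : ∀ r ∈ Ioc 0 ε, ‖G r Y₀‖ ≤ K * r ^ 7

/-! ### From local estimates on G to a C¹ solution of the singular problem. -/

namespace StiffField

variable {G : ℝ → ℝ × ℝ → ℝ × ℝ} {Y₀ : ℝ × ℝ} {ε η K : ℝ}

/-- The damping absorbs the coupling. With d the difference of the clamped first components,
monotonicity of the clamp gives (Y.1 - Z.1) d ≥ d², so the damping contributes -d² / 2. The coupling
K r² d |Y.2 - Z.2| is split by Young's inequality into d² / 2 and a term of order r⁴; all other
terms are of order r³ already. -/
theorem one_sided_clamp (hG : StiffField G Y₀ ε η K) {r : ℝ} (hr : r ∈ Ioc 0 ε) {Y Z : ℝ × ℝ}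
    (hYZ : Z.1 ≤ Y.1) :
    dotProd (Y - Z) (G r (clampBox Y₀ η Y) - G r (clampBox Y₀ η Z)) ≤
      r ^ 3 * ((K ^ 2 + 2 * K) * sqNorm (Y - Z)) := by
  have hK := hG.K_nonneg
  have hr0 := hr.1
  have hr1 := hr.2.trans hG.le_one
  have hη := hG.η_pos.le
  have h1 := hG.fst_le r hr _ _ (norm_clampBox_sub_le hη Y) (norm_clampBox_sub_le hη Z)
    (sub_nonneg.1 (clamp_sub_nonneg hYZ))
  have h2 := hG.snd_le r hr _ _ (norm_clampBox_sub_le hη Y) (norm_clampBox_sub_le hη Z)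
  have h3 : ‖clampBox Y₀ η Y - clampBox Y₀ η Z‖ ≤ ‖Y - Z‖ := norm_clampBox_sub_clampBox_le _ _ _ _
  set A := G r (clampBox Y₀ η Y) with hA
  set B := G r (clampBox Y₀ η Z) with hB
  set m := ‖Y - Z‖ with hm
  set d := (clampBox Y₀ η Y).1 - (clampBox Y₀ η Z).1 with hd
  have hd0 : 0 ≤ d := clamp_sub_nonneg hYZ
  have hd1 : d ≤ Y.1 - Z.1 := clamp_sub_le hYZ
  have hm0 : 0 ≤ m := norm_nonneg _
  have hm1 : |Y.1 - Z.1| ≤ m := norm_fst_le (Y - Z)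
  have hm2 : |Y.2 - Z.2| ≤ m := norm_snd_le (Y - Z)
  rw [abs_of_nonneg hd0] at h2
  rw [abs_of_nonneg (hd0.trans hd1)] at hm1
  have hr3 : 0 ≤ K * r ^ 3 := by positivity
  have e1 : (Y.1 - Z.1) * (A.1 - B.1) ≤ -(1 / 2) * d ^ 2 + K * r ^ 3 * m ^ 2 := by
    have := mul_le_mul_of_nonneg_left (h1.trans (add_le_add_right
      (mul_le_mul_of_nonneg_left h3 hr3) _)) (hd0.trans hd1)
    have a1 : d * d ≤ (Y.1 - Z.1) * d := mul_le_mul_of_nonneg_right hd1 hd0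
    have a2 : (Y.1 - Z.1) * (K * r ^ 3 * m) ≤ m * (K * r ^ 3 * m) := by gcongr
    nlinarith
  have e2 : (Y.2 - Z.2) * (A.2 - B.2) ≤ |Y.2 - Z.2| * (K * r ^ 2 * d) + K * r ^ 3 * m ^ 2 := by
    calc _ ≤ |(Y.2 - Z.2) * (A.2 - B.2)| := le_abs_self _
      _ = |Y.2 - Z.2| * |A.2 - B.2| := abs_mul _ _
      _ ≤ |Y.2 - Z.2| * (K * r ^ 2 * d + K * r ^ 3 * m) := by
        gcongr; exact h2.trans (by gcongr)
      _ ≤ |Y.2 - Z.2| * (K * r ^ 2 * d) + m * (K * r ^ 3 * m) := by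
        rw [mul_add]; gcongr
      _ = _ := by ring
  have e3 : |Y.2 - Z.2| * (K * r ^ 2 * d) ≤ 1 / 2 * d ^ 2 + 1 / 2 * K ^ 2 * r ^ 4 * m ^ 2 := by
    have : |Y.2 - Z.2| * (K * r ^ 2 * d) ≤ m * (K * r ^ 2 * d) := by gcongr
    nlinarith [sq_nonneg (d - K * r ^ 2 * m)]
  have e4 : r ^ 4 ≤ r ^ 3 := pow_le_pow_of_le_one hr0.le hr1 (by norm_num)
  have e5 : m ^ 2 ≤ sqNorm (Y - Z) := sq_norm_le_sqNorm _
  have e6 : 1 / 2 * K ^ 2 * r ^ 4 * m ^ 2 ≤ K ^ 2 * r ^ 3 * m ^ 2 := by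
    gcongr; nlinarith [sq_nonneg K]
  calc _ ≤ K ^ 2 * r ^ 3 * m ^ 2 + 2 * (K * r ^ 3 * m ^ 2) := by
        simp only [dotProd, Prod.fst_sub, Prod.snd_sub]; linarith
    _ = r ^ 3 * ((K ^ 2 + 2 * K) * m ^ 2) := by ring
    _ ≤ _ := by gcongr

/-- Clamping makes the local estimates global. Division by r³ turns the bound of `one_sided_clamp`
into one free of r, and the r⁷ at the centre into r⁴. -/
theorem singularField (hG : StiffField G Y₀ ε η K) :
    SingularField (fun r Y => (r ^ 3)⁻¹ • G r (clampBox Y₀ η Y)) Y₀ ε K (K ^ 2 + 2 * K) K where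
  pos := hG.pos
  le_one := hG.le_one
  K_nonneg := hG.K_nonneg
  L_nonneg := by have := hG.K_nonneg; positivity
  C_nonneg := hG.K_nonneg
  lipschitz r hr Y Z := by
    have hr0 := hr.1
    have hK := hG.K_nonneg
    rw [← smul_sub, norm_smul, norm_inv, Real.norm_of_nonneg (by positivity), div_mul_eq_mul_div,
      ← div_eq_inv_mul]
    gcongr
    exact (hG.lipschitz r hr _ _ (norm_clampBox_sub_le hG.η_pos.le _)
      (norm_clampBox_sub_le hG.η_pos.le _)).trans
      (mul_le_mul_of_nonneg_left (norm_clampBox_sub_clampBox_le _ _ _ _) hK)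
  bound r hr Y := by
    have hr0 := hr.1
    rw [norm_smul, norm_inv, Real.norm_of_nonneg (by positivity), ← div_eq_inv_mul]
    gcongr
    exact hG.bound r hr _ (norm_clampBox_sub_le hG.η_pos.le _)
  continuousOn Y := by
    refine ContinuousOn.smul (ContinuousOn.inv₀ (f := fun r : ℝ => r ^ 3) (by fun_prop)
      fun r hr => ?_)
      (hG.continuousOn _ (norm_clampBox_sub_le hG.η_pos.le _))
    have := hr.1
    positivity
  one_sided r hr Y Z := by
    have hr0 := hr.1
    have hr3 : 0 < r ^ 3 := by positivity
    have key : ∀ A : ℝ × ℝ, ∀ B, dotProd A B ≤ r ^ 3 * ((K ^ 2 + 2 * K) * sqNorm A) →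
        dotProd A ((r ^ 3)⁻¹ • B) ≤ (K ^ 2 + 2 * K) * sqNorm A := fun A B h => by
      have : dotProd A ((r ^ 3)⁻¹ • B) = (r ^ 3)⁻¹ * dotProd A B := by
        simp [dotProd]; ring
      rw [this]
      exact (inv_mul_le_iff₀ hr3).2 h
    rw [← smul_sub]
    rcases le_total Z.1 Y.1 with h | h
    · exact key _ _ (hG.one_sided_clamp hr h)
    · have := key _ _ (hG.one_sided_clamp hr h)
      have e1 : sqNorm (Z - Y) = sqNorm (Y - Z) := by simp [sqNorm]; ring
      rw [e1] at this
      refine le_of_eq_of_le ?_ this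
      simp [dotProd]; ring
  centre r hr := by
    have hr0 := hr.1
    rw [clampBox_eq_self (by simpa using hG.η_pos.le), norm_smul, norm_inv,
      Real.norm_of_nonneg (by positivity), inv_mul_le_iff₀ (by positivity)]
    refine (hG.centre r hr).trans_eq (by ring)

theorem one_sided (hG : StiffField G Y₀ ε η K) {r : ℝ} (hr : r ∈ Ioc 0 ε) {Y Z : ℝ × ℝ}
    (hY : ‖Y - Y₀‖ ≤ η) (hZ : ‖Z - Y₀‖ ≤ η) :
    dotProd (Y - Z) ((r ^ 3)⁻¹ • G r Y - (r ^ 3)⁻¹ • G r Z) ≤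
      (K ^ 2 + 2 * K) * sqNorm (Y - Z) := by
  have := hG.singularField.one_sided r hr Y Z
  rwa [clampBox_eq_self hY, clampBox_eq_self hZ] at this

/-- The solution of the singular initial value problem, continued by a constant to `r ≤ 0`. -/
theorem exists_solution (hG : StiffField G Y₀ ε η K) :
    ∃ (Y : ℝ → ℝ × ℝ) (δ D : ℝ), 0 < δ ∧ δ ≤ ε ∧ 0 ≤ D ∧ (∀ r ≤ 0, Y r = Y₀) ∧
      (∀ r ∈ Ioo 0 δ, HasDerivAt Y ((r ^ 3)⁻¹ • G r (Y r)) r) ∧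
      (∀ r ∈ Ioo 0 δ, ‖Y r - Y₀‖ ≤ η) ∧ (∀ r ∈ Ico 0 δ, ‖Y r - Y₀‖ ≤ D * r ^ 4) ∧
      HasDerivAt Y 0 0 ∧ ContDiffOn ℝ 1 Y (Iio δ) := by
  obtain ⟨Z, D, hD, hZ, hZD⟩ := hG.singularField.exists_solution
  have hε := hG.pos
  have hη := hG.η_pos
  have hK := hG.K_nonneg
  -- For r < δ one has D r⁴ ≤ D r ≤ η, so the solution stays in the box where the clamp is the
  -- identity and it solves the original equation.
  set δ := min ε (η / (D + 1)) with hδdef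
  have hδ : 0 < δ := lt_min hε (by positivity)
  have hδε : δ ≤ ε := min_le_left _ _
  have hDη : ∀ r ∈ Ioo 0 δ, D * r ^ 4 ≤ η := fun r hr => by
    have hr0 := hr.1
    have h1 : r ^ 4 ≤ r :=
      pow_le_of_le_one hr.1.le (hr.2.le.trans (hδε.trans hG.le_one)) (by norm_num)
    have h2 : r ≤ η / (D + 1) := hr.2.le.trans (min_le_right _ _)
    rw [le_div_iff₀ (by positivity)] at h2
    nlinarith
  -- The constant continuation to r ≤ 0 allows continuous differentiability to be checked with
  -- two-sided derivatives on an open half-line.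
  set Y : ℝ → ℝ × ℝ := fun r => if r ≤ 0 then Y₀ else Z r with hYdef
  have hY0 : ∀ r ≤ 0, Y r = Y₀ := fun r hr => if_pos hr
  have hYZ : ∀ r, 0 < r → Y r = Z r := fun r hr => if_neg hr.not_ge
  have hYD : ∀ r ∈ Ico 0 δ, ‖Y r - Y₀‖ ≤ D * r ^ 4 := by
    intro r hr
    rcases hr.1.eq_or_lt with rfl | h
    · simp [hY0 0 le_rfl]
    · rw [hYZ r h]; exact hZD r ⟨h, hr.2.trans_le hδε⟩
  have hYη : ∀ r ∈ Ioo 0 δ, ‖Y r - Y₀‖ ≤ η := fun r hr =>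
    (hYD r (Ioo_subset_Ico_self hr)).trans (hDη r hr)
  have hder : ∀ r ∈ Ioo 0 δ, HasDerivAt Y ((r ^ 3)⁻¹ • G r (Y r)) r := by
    intro r hr
    have h1 := hZ r ⟨hr.1, hr.2.trans_le hδε⟩
    rw [← hYZ r hr.1, clampBox_eq_self (hYη r hr)] at h1
    refine h1.congr_of_eventuallyEq ?_
    filter_upwards [lt_mem_nhds hr.1] with s hs using hYZ s hs
  -- ‖G r (Y r)‖ ≤ K D r⁴ + K r⁷, so the derivative of Y is O(r) after division by r³. This is what
  -- makes it continuous at 0 with value 0.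
  set M := K + K * D with hM
  have hsmall : ∀ r ∈ Ioo 0 δ, ‖(r ^ 3)⁻¹ • G r (Y r)‖ ≤ M * r := by
    intro r hr
    have hr0 := hr.1
    have hr' : r ∈ Ioc 0 ε := ⟨hr0, hr.2.le.trans hδε⟩
    have hr1 : r ≤ 1 := hr'.2.trans hG.le_one
    rw [norm_smul, norm_inv, Real.norm_of_nonneg (by positivity), inv_mul_le_iff₀ (by positivity)]
    have h1 := hG.lipschitz r hr' _ Y₀ (hYη r hr) (by simpa using hη.le)
    have h2 := hG.centre r hr'
    have h3 : ‖G r (Y r)‖ ≤ ‖G r (Y r) - G r Y₀‖ + ‖G r Y₀‖ := by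
      simpa using norm_add_le (G r (Y r) - G r Y₀) (G r Y₀)
    have h4 := mul_le_mul_of_nonneg_left (hYD r (Ioo_subset_Ico_self hr)) hK
    have h5 : r ^ 7 ≤ r ^ 4 := pow_le_pow_of_le_one hr0.le hr1 (by norm_num)
    have h6 := mul_le_mul_of_nonneg_left h5 hK
    calc _ ≤ K * (D * r ^ 4) + K * r ^ 4 := by linarith
      _ = _ := by rw [hM]; ring
  set Y' : ℝ → ℝ × ℝ := fun r => if r ≤ 0 then 0 else (r ^ 3)⁻¹ • G r (Y r) with hY'def
  have hY'bound : ∀ r ∈ Iio δ, ‖Y' r‖ ≤ M * |r| := by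
    intro r hr
    have hM0 : 0 ≤ M := by positivity
    by_cases h : r ≤ 0
    · rw [hY'def]; simp only [h, if_true, norm_zero]; positivity
    · rw [hY'def]; simp only [h, if_false]
      push Not at h
      rw [abs_of_pos h]
      exact hsmall r ⟨h, hr⟩
  have hzero : HasDerivAt Y 0 0 := by
    rw [hasDerivAt_iff_isLittleO]
    have hO : (fun r => Y r - Y 0 - (r - 0) • (0 : ℝ × ℝ)) =O[𝓝 0] fun r : ℝ => r ^ 4 := by
      refine Asymptotics.IsBigO.of_bound D ?_
      filter_upwards [gt_mem_nhds hδ] with r hr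
      rw [hY0 0 le_rfl, smul_zero, sub_zero, Real.norm_of_nonneg (by positivity)]
      rcases le_or_gt r 0 with h | h
      · rw [hY0 r h, sub_self, norm_zero]; positivity
      · exact hYD r ⟨h.le, hr⟩
    refine hO.trans_isLittleO ?_
    simpa using Asymptotics.isLittleO_pow_id (𝕜 := ℝ) (n := 4) (by norm_num)
  have hderiv : ∀ r ∈ Iio δ, HasDerivAt Y (Y' r) r := by
    intro r hr
    rcases lt_trichotomy r 0 with h | h | h
    · have : Y' r = 0 := if_pos h.le
      rw [this]
      refine (hasDerivAt_const r Y₀).congr_of_eventuallyEq ?_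
      filter_upwards [gt_mem_nhds h] with s hs using hY0 s hs.le
    · subst h
      have : Y' 0 = 0 := if_pos le_rfl
      rw [this]; exact hzero
    · have : Y' r = (r ^ 3)⁻¹ • G r (Y r) := if_neg h.not_ge
      rw [this]; exact hder r ⟨h, hr⟩
  have hcontY : ContinuousOn Y (Iio δ) := fun r hr => (hderiv r hr).continuousAt.continuousWithinAt
  have hcont : ContinuousOn Y' (Iio δ) := by
    intro r hr
    refine ContinuousAt.continuousWithinAt ?_
    rcases lt_trichotomy r 0 with h | h | h
    · refine (continuousAt_const (y := (0 : ℝ × ℝ))).congr ?_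
      filter_upwards [gt_mem_nhds h] with s hs
      exact (if_pos hs.le).symm
    · subst h
      have h0 : Y' 0 = 0 := if_pos le_rfl
      rw [ContinuousAt, h0]
      refine squeeze_zero_norm' (a := fun r => M * |r|) ?_ ?_
      · filter_upwards [gt_mem_nhds hδ] with s hs using hY'bound s hs
      · have : Tendsto (fun r : ℝ => M * |r|) (𝓝 0) (𝓝 (M * |0|)) := by
          exact (continuous_const.mul continuous_abs).tendsto 0
        simpa using this
    · have hr' : r ∈ Ioo 0 δ := ⟨h, hr⟩
      -- Joint continuity is not assumed; it follows from continuity in r for fixed Y and a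
      -- Lipschitz constant in Y that is uniform in r.
      have hcG : ContinuousAt (fun s => G s (Y s)) r := by
        have hnhds : Ioc 0 ε ∈ 𝓝 r := Ioc_mem_nhds h (hr'.2.trans_le hδε)
        have h1 := (hG.continuousOn _ (hYη r hr')).continuousAt hnhds
        have h2 : ContinuousAt Y r := (hderiv r hr).continuousAt
        rw [ContinuousAt, tendsto_iff_norm_sub_tendsto_zero] at h1 h2 ⊢
        refine squeeze_zero' (Eventually.of_forall fun _ => norm_nonneg _) ?_
          (by simpa using (h2.const_mul K).add h1)
        filter_upwards [Ioo_mem_nhds h hr'.2] with s hs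
        refine (norm_sub_le_norm_sub_add_norm_sub _ (G s (Y r)) _).trans ?_
        gcongr
        exact hG.lipschitz s ⟨hs.1, hs.2.le.trans hδε⟩ _ _ (hYη s hs) (hYη r hr')
      refine ContinuousAt.congr (f := fun s => (s ^ 3)⁻¹ • G s (Y s)) ?_ ?_
      · exact (ContinuousAt.inv₀ (f := fun s : ℝ => s ^ 3) (by fun_prop) (by positivity)).smul hcG
      · filter_upwards [lt_mem_nhds h] with s hs
        exact (if_neg hs.not_ge).symm
  refine ⟨Y, δ, D, hδ, hδε, hD, hY0, hder, hYη, hYD, hzero, ?_⟩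
  rw [show (1 : WithTop ℕ∞) = 0 + 1 from rfl, contDiffOn_succ_iff_deriv_of_isOpen isOpen_Iio]
  refine ⟨fun r hr => (hderiv r hr).differentiableAt.differentiableWithinAt, by simp, ?_⟩
  rw [contDiffOn_zero]
  exact hcont.congr fun r hr => (hderiv r hr).deriv

end StiffField

/-! ### Smooth functions of the flat variable -/

/-- A mixed second difference of a `C²` function is bounded by the product of the increments. -/
theorem exists_mixed_difference_le {E F : Type*} [NormedAddCommGroup E] [NormedSpace ℝ E]
    [NormedAddCommGroup F] [NormedSpace ℝ F] {Z : Type*} [NormedAddCommGroup Z] [NormedSpace ℝ Z]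
    {G : ℝ × Z × E → F} {z₀ : Z} {y₀ : E} (hG : ContDiffAt ℝ 2 G (0, z₀, y₀)) :
    ∃ K ρ : ℝ, 0 ≤ K ∧ 0 < ρ ∧ ∀ φ z y₁ y₂, |φ| < ρ → ‖z - z₀‖ < ρ → ‖y₁ - y₀‖ < ρ →
      ‖y₂ - y₀‖ < ρ →
      ‖G (φ, z, y₁) - G (φ, z, y₂) - (G (0, z, y₁) - G (0, z, y₂))‖ ≤ K * ‖y₁ - y₂‖ * |φ| := by
  have h1 : ∀ᶠ x in 𝓝 ((0, z₀, y₀) : ℝ × Z × E), DifferentiableAt ℝ G x := by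
    filter_upwards [(hG.of_le (by norm_num : (1 : WithTop ℕ∞) ≤ 2)).eventually (by simp)] with x hx
    exact hx.differentiableAt (by simp)
  obtain ⟨K, t, ht, hK⟩ := (hG.fderiv_right (m := 1) (by norm_num)).exists_lipschitzOnWith
  obtain ⟨ρ, hρ, hball⟩ := Metric.mem_nhds_iff.1 (inter_mem ht h1)
  refine ⟨K, ρ, K.2, hρ, fun φ z y₁ y₂ hφ hz hy₁ hy₂ => ?_⟩
  have hmem : ∀ s : ℝ, |s| ≤ |φ| → ∀ y, ‖y - y₀‖ < ρ → (s, z, y) ∈ Metric.ball (0, z₀, y₀) ρ := by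
    intro s hs y hy
    rw [mem_ball_iff_norm, Prod.norm_def, Prod.norm_def]
    simpa using ⟨hs.trans_lt hφ, hz, hy⟩
  -- The derivative in s of G(s, z, y₁) - G(s, z, y₂) is a difference of two values of `fderiv ℝ G`,
  -- which is locally Lipschitz because G is C². The mean value inequality on [0, φ] then yields the
  -- product bound.
  have hder : ∀ s ∈ uIcc 0 φ, HasDerivWithinAt (fun s => G (s, z, y₁) - G (s, z, y₂))
      (fderiv ℝ G (s, z, y₁) (1, 0, 0) - fderiv ℝ G (s, z, y₂) (1, 0, 0)) (uIcc 0 φ) s := by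
    intro s hs
    have hs' : |s| ≤ |φ| := by simpa using abs_sub_left_of_mem_uIcc hs
    have key : ∀ y, ‖y - y₀‖ < ρ → HasDerivAt (fun s => G (s, z, y))
        (fderiv ℝ G (s, z, y) (1, 0, 0)) s := fun y hy => by
      have hd : DifferentiableAt ℝ G (s, z, y) := (hball (hmem s hs' y hy)).2
      exact hd.hasFDerivAt.comp_hasDerivAt s
        ((hasDerivAt_id s).prodMk (hasDerivAt_const s (z, y)))
    exact ((key y₁ hy₁).sub (key y₂ hy₂)).hasDerivWithinAt
  have := (convex_uIcc 0 φ).norm_image_sub_le_of_norm_hasDerivWithin_le (C := K * ‖y₁ - y₂‖) hder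
    (fun s hs => ?_) left_mem_uIcc right_mem_uIcc
  · simpa using this
  · have hs' : |s| ≤ |φ| := by simpa using abs_sub_left_of_mem_uIcc hs
    have h2 := hK.dist_le_mul _ (hball (hmem s hs' y₁ hy₁)).1 _ (hball (hmem s hs' y₂ hy₂)).1
    rw [dist_eq_norm, dist_eq_norm] at h2
    have e1 : ‖((s, z, y₁) : ℝ × Z × E) - (s, z, y₂)‖ = ‖y₁ - y₂‖ := by
      simp [Prod.norm_def]
    have e2 : ‖((1, 0, 0) : ℝ × Z × E)‖ ≤ 1 := by simp [Prod.norm_def]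
    rw [e1] at h2
    rw [← sub_apply]
    calc _ ≤ _ := ContinuousLinearMap.le_opNorm _ _
      _ ≤ _ * 1 := by gcongr
      _ ≤ _ := by rw [mul_one]; exact h2

/-- Strict differentiability of the tangent at 0, where its derivative is 1. The constant 1/4 is
small enough for the damping: combined with m₁ ≥ 3/4 it leaves the rate 9/16 ≥ 1/2 demanded by
`StiffField`. -/
theorem exists_tan_sub_tan_near :
    ∃ ρ : ℝ, 0 < ρ ∧ ∀ x y, |x| < ρ → |y| < ρ →
      |Real.tan x - Real.tan y - (x - y)| ≤ 1 / 4 * |x - y| := by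
  have h : HasStrictDerivAt Real.tan 1 0 := by
    simpa using Real.hasStrictDerivAt_tan (x := 0) (by simp)
  have h1 := h.hasStrictFDerivAt.isLittleO.def (show (0 : ℝ) < 1 / 4 by norm_num)
  rw [Metric.eventually_nhds_iff] at h1
  obtain ⟨ρ, hρ, hb⟩ := h1
  refine ⟨ρ, hρ, fun x y hx hy => ?_⟩
  have := hb (y := (x, y)) (by simpa [Prod.dist_eq, Real.dist_eq] using ⟨hx, hy⟩)
  simpa using this

/-! ### The flat function `φ₁` -/

/-- At r = 0 the exponent is -1 / 0 = 0, so the exponential is 1 and the factor r alone makes the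
value vanish. -/
theorem phi1_zero : phi1 0 = 0 := by simp [phi1]

theorem phi1_pos {r : ℝ} (hr : 0 < r) : 0 < phi1 r := by unfold phi1; positivity

theorem phi1_nonneg {r : ℝ} (hr : 0 ≤ r) : 0 ≤ phi1 r := by unfold phi1; positivity

/-- From x³ / 3! ≤ exp x at x = 1 / r². Any power is available; the seventh leaves r⁴ after division
by r³, which is enough for a C¹ solution. -/
theorem abs_phi1_le (r : ℝ) : |phi1 r| ≤ 6 * |r| ^ 7 := by
  rcases eq_or_ne r 0 with rfl | hr
  · simp [phi1]
  · have hr' : 0 < |r| := abs_pos.2 hr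
    have h := Real.pow_div_factorial_le_exp (1 / r ^ 2) (by positivity) 3
    have h2 : Real.exp (-1 / r ^ 2) ≤ 6 * |r| ^ 6 := by
      rw [neg_div, Real.exp_neg]
      refine inv_le_of_inv_le₀ (by positivity) (le_of_eq_of_le ?_ h)
      simp [Nat.factorial]
      field_simp
      exact (Even.pow_abs (by decide) r).symm
    rw [phi1, abs_mul, abs_of_pos (Real.exp_pos _)]
    calc _ ≤ |r| * (6 * |r| ^ 6) := by gcongr
      _ = _ := by ring

theorem hasDerivAt_phi1_zero : HasDerivAt phi1 0 0 := by
  rw [hasDerivAt_iff_isLittleO]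
  have hO : (fun r => phi1 r - phi1 0 - (r - 0) • (0 : ℝ)) =O[𝓝 0] fun r : ℝ => r ^ 7 := by
    refine Asymptotics.IsBigO.of_bound 6 (Eventually.of_forall fun r => ?_)
    simpa [phi1_zero] using abs_phi1_le r
  refine hO.trans_isLittleO ?_
  simpa using Asymptotics.isLittleO_pow_id (𝕜 := ℝ) (n := 7) (by norm_num)

/-- The derivative is written so that the radial velocity factor 2 r³ / (2 + r²) cancels its
singular part and leaves 2 φ₁(r). -/
theorem hasDerivAt_phi1 {r : ℝ} (hr : r ≠ 0) :
    HasDerivAt phi1 (phi1 r * (r ^ 2 + 2) / r ^ 3) r := by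
  have h1 : HasDerivAt (fun r : ℝ => -1 / r ^ 2) (2 / r ^ 3) r := by
    have := ((hasDerivAt_pow 2 r).inv (by positivity)).neg
    refine (this.congr_of_eventuallyEq ?_).congr_deriv ?_
    · exact Eventually.of_forall fun s => by simp [div_eq_mul_inv]
    · field_simp
      norm_num
      ring
  refine ((hasDerivAt_id r).mul h1.exp).congr_deriv ?_
  simp only [phi1, id]
  field_simp

theorem continuous_phi1 : Continuous phi1 := by
  rw [continuous_iff_continuousAt]
  intro r
  rcases eq_or_ne r 0 with rfl | hr
  · exact hasDerivAt_phi1_zero.continuousAt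
  · exact (hasDerivAt_phi1 hr).continuousAt

/-- r² log r is r times r log r, and the latter tends to 0. As `Real.log` depends only on |r|, the
statement holds from both sides. -/
theorem hasDerivAt_sq_mul_log_zero : HasDerivAt (fun r : ℝ => r ^ 2 * Real.log r) 0 0 := by
  rw [hasDerivAt_iff_isLittleO]
  have h : Tendsto (fun r : ℝ => r * Real.log r) (𝓝 0) (𝓝 0) := by
    simpa using Real.continuous_mul_log.tendsto 0
  have := ((Asymptotics.isLittleO_one_iff ℝ).2 h).mul_isBigO
    (Asymptotics.isBigO_refl (fun r : ℝ => r) (𝓝 0))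
  refine (this.congr (fun r => ?_) fun r => ?_)
  · simp; ring
  · simp

theorem continuous_sq_mul_log : Continuous fun r : ℝ => r ^ 2 * Real.log r := by
  have := continuous_id.mul Real.continuous_mul_log
  refine this.congr fun r => ?_
  simp; ring

/-- The flat variable `φ₁(r)` together with `r` and `r² log r`. -/
def radial (r : ℝ) : ℝ × ℝ × ℝ := (phi1 r, r, r ^ 2 * Real.log r)

theorem continuous_radial : Continuous radial :=
  continuous_phi1.prodMk (continuous_id.prodMk continuous_sq_mul_log)

theorem radial_zero : radial 0 = 0 := by simp [radial, phi1_zero]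

theorem StiffField.mono {G : ℝ → ℝ × ℝ → ℝ × ℝ} {Y₀ : ℝ × ℝ} {ε η K ε' η' : ℝ}
    (hG : StiffField G Y₀ ε η K) (hε' : 0 < ε') (hε : ε' ≤ ε) (hη' : 0 < η') (hη : η' ≤ η) :
    StiffField G Y₀ ε' η' K :=
  have hs : ∀ {r}, r ∈ Ioc 0 ε' → r ∈ Ioc 0 ε := fun hr => ⟨hr.1, hr.2.trans hε⟩
  { pos := hε'
    le_one := hε.trans hG.le_one
    η_pos := hη'
    K_nonneg := hG.K_nonneg
    lipschitz := fun r hr Y Z hY hZ => hG.lipschitz r (hs hr) Y Z (hY.trans hη) (hZ.trans hη)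
    bound := fun r hr Y hY => hG.bound r (hs hr) Y (hY.trans hη)
    continuousOn := fun Y hY => (hG.continuousOn Y (hY.trans hη)).mono fun _ h => hs h
    fst_le := fun r hr Y Z hY hZ => hG.fst_le r (hs hr) Y Z (hY.trans hη) (hZ.trans hη)
    snd_le := fun r hr Y Z hY hZ => hG.snd_le r (hs hr) Y Z (hY.trans hη) (hZ.trans hη)
    centre := fun r hr => hG.centre r (hs hr) }

/-- At φ = 0 the estimates reduce to those for the tangent. Passing from 0 to φ₁(r) changes
differences in Y by at most K₂ ‖Y - Z‖ φ₁(r), by the mixed difference estimate, and φ₁(r) ≤ 6 r³.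
The functions m₁ and m₂ need only be continuous, since z is the same for both points compared. -/
theorem exists_stiffField {G : ℝ × (ℝ × ℝ) × (ℝ × ℝ) → ℝ × ℝ} {ψ₀ : ℝ} {m₁ m₂ : ℝ × ℝ → ℝ}
    (hG : ContDiffAt ℝ 2 G (0, 0, (0, ψ₀))) (hm₁ : ContinuousAt m₁ 0) (hm₂ : ContinuousAt m₂ 0)
    (hm₁0 : m₁ 0 = 1)
    (hG0 : ∀ z Y, G (0, z, Y) = (-(m₁ z * Real.tan Y.1), m₂ z * z.1 ^ 2 * Real.tan Y.1)) :
    ∃ ε η K : ℝ, StiffField (fun r Y => G ((radial r).1, (radial r).2, Y)) (0, ψ₀) ε η K := by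
  obtain ⟨K₂, ρ₂, hK₂, hρ₂, hmix⟩ := exists_mixed_difference_le hG
  obtain ⟨K₁, t, ht, hlip⟩ :=
    (hG.of_le (by norm_num : (1 : WithTop ℕ∞) ≤ 2)).exists_lipschitzOnWith
  obtain ⟨ρ₁, hρ₁, hball⟩ := Metric.mem_nhds_iff.1 ht
  obtain ⟨ρ₃, hρ₃, htan⟩ := exists_tan_sub_tan_near
  set M := |m₂ 0| + 1 with hM
  have hm : ∀ᶠ z in 𝓝 (0 : ℝ × ℝ), 3 / 4 ≤ m₁ z ∧ |m₂ z| ≤ M := by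
    refine (hm₁.eventually (lt_mem_nhds (by rw [hm₁0]; norm_num : (3 / 4 : ℝ) < m₁ 0))).and
      (hm₂.abs.eventually (gt_mem_nhds (by rw [hM]; linarith : |m₂ 0| < M))) |>.mono
      fun z hz => ⟨hz.1.le, hz.2.le⟩
  obtain ⟨ρ₄, hρ₄, hmz⟩ := Metric.eventually_nhds_iff.1 hm
  set ρ := min (min ρ₁ ρ₂) (min ρ₃ ρ₄) with hρdef
  have hρ : 0 < ρ := lt_min (lt_min hρ₁ hρ₂) (lt_min hρ₃ hρ₄)
  have l1 : ρ ≤ ρ₁ := (min_le_left _ _).trans (min_le_left _ _)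
  have l2 : ρ ≤ ρ₂ := (min_le_left _ _).trans (min_le_right _ _)
  have l3 : ρ ≤ ρ₃ := (min_le_right _ _).trans (min_le_left _ _)
  have l4 : ρ ≤ ρ₄ := (min_le_right _ _).trans (min_le_right _ _)
  have hrad : ∀ᶠ r in 𝓝 (0 : ℝ), ‖radial r‖ < ρ := by
    have := continuous_radial.norm.tendsto 0
    rw [radial_zero, norm_zero] at this
    exact this.eventually_lt_const hρ
  obtain ⟨ε₀, hε₀, hrε⟩ := Metric.eventually_nhds_iff.1 hrad
  set ε := min 1 (ε₀ / 2) with hε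
  have hεpos : 0 < ε := lt_min one_pos (half_pos hε₀)
  have hε1 : ε ≤ 1 := min_le_left _ _
  have hr1 : ∀ r ∈ Ioc 0 ε, |(radial r).1| < ρ ∧ ‖(radial r).2‖ < ρ := by
    intro r hr
    have h : ‖radial r‖ < ρ := hrε (by
      rw [dist_zero_right, Real.norm_of_nonneg hr.1.le]
      linarith [hr.2, min_le_right 1 (ε₀ / 2)])
    exact ⟨(norm_fst_le _).trans_lt h, (norm_snd_le _).trans_lt h⟩
  have hmemG : ∀ φ z Y, |φ| < ρ → ‖z‖ < ρ → ‖Y - (0, ψ₀)‖ < ρ → (φ, z, Y) ∈ t := by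
    intro φ z Y hφ hz hY
    refine hball ?_
    rw [mem_ball_iff_norm, Prod.norm_def, Prod.norm_def]
    simpa using ⟨hφ.trans_le l1, hz.trans_le l1, hY.trans_le l1⟩
  have hphi : ∀ r ∈ Ioc 0 ε, |(radial r).1| ≤ 6 * r ^ 7 := fun r hr => by
    have := abs_phi1_le r
    rwa [abs_of_pos hr.1] at this
  have hphi3 : ∀ r ∈ Ioc 0 ε, |(radial r).1| ≤ 6 * r ^ 3 := fun r hr =>
    (hphi r hr).trans (by
      gcongr 6 * ?_
      exact pow_le_pow_of_le_one hr.1.le (hr.2.trans hε1) (by norm_num))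
  have hη : ∀ {Y : ℝ × ℝ}, ‖Y - (0, ψ₀)‖ ≤ ρ / 2 → ‖Y - (0, ψ₀)‖ < ρ := fun h => by linarith
  have hGz : ∀ z, G (0, z, (0, ψ₀)) = 0 := fun z => by rw [hG0]; simp
  have htan' : ∀ Y : ℝ × ℝ, ‖Y - (0, ψ₀)‖ ≤ ρ / 2 → |Y.1| < ρ₃ := fun Y h => by
    have : ‖(Y - (0, ψ₀)).1‖ ≤ _ := norm_fst_le _
    simp only [Prod.fst_sub, sub_zero, Real.norm_eq_abs] at this
    linarith
  -- Each summand serves one estimate: K₁ the Lipschitz bound, K₁ (ρ + ρ + ρ) boundedness, 6 K₁ the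
  -- centre, 6 K₂ the mixed differences, and 2 M the coupling, with 2 a bound for the slope of the
  -- tangent.
  set K := K₁ + 6 * K₁ + K₁ * (ρ + ρ + ρ) + 6 * K₂ + 2 * M with hK
  have hM0 : 0 ≤ M := by positivity
  have hK₁ : (0 : ℝ) ≤ K₁ := K₁.2
  have hpos : 0 ≤ K₁ * (ρ + ρ + ρ) := by positivity
  refine ⟨ε, ρ / 2, K, ?_⟩
  refine
    { pos := hεpos
      le_one := hε1
      η_pos := half_pos hρ
      K_nonneg := by positivity
      lipschitz := fun r hr Y Z hY hZ => ?_
      bound := fun r hr Y hY => ?_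
      continuousOn := fun Y hY r hr => ?_
      fst_le := fun r hr Y Z hY hZ hYZ => ?_
      snd_le := fun r hr Y Z hY hZ => ?_
      centre := fun r hr => ?_ }
  · have h := hlip.dist_le_mul _ (hmemG _ _ Y (hr1 r hr).1 (hr1 r hr).2 (hη hY)) _
      (hmemG _ _ Z (hr1 r hr).1 (hr1 r hr).2 (hη hZ))
    have e : dist ((radial r).1, (radial r).2, Y) ((radial r).1, (radial r).2, Z) = ‖Y - Z‖ := by
      simp [dist_eq_norm]
    rw [e, dist_eq_norm] at h
    refine h.trans (mul_le_mul_of_nonneg_right ?_ (norm_nonneg _))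
    rw [hK]; linarith
  · have h := hlip.dist_le_mul _ (hmemG _ _ Y (hr1 r hr).1 (hr1 r hr).2 (hη hY)) _
      (hmemG 0 0 (0, ψ₀) (by simpa) (by simpa) (by simpa))
    rw [hGz, dist_zero_right, dist_eq_norm] at h
    have e : ‖((radial r).1, (radial r).2, Y) - ((0, 0, (0, ψ₀)) : ℝ × (ℝ × ℝ) × (ℝ × ℝ))‖ ≤
        ρ + ρ + ρ := by
      have h1 := hr1 r hr
      have h2 := hη hY
      rw [Prod.norm_def, Prod.norm_def]
      simp only [Prod.fst_sub, Prod.snd_sub, sub_zero, max_le_iff, Real.norm_eq_abs]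
      exact ⟨by linarith, by linarith, by linarith⟩
    refine h.trans ?_
    have := mul_le_mul_of_nonneg_left e hK₁
    rw [hK]; linarith
  · have hmem := hmemG _ _ Y (hr1 r hr).1 (hr1 r hr).2 (hη hY)
    have hb : ((radial r).1, (radial r).2, Y) ∈ Metric.ball (0, 0, (0, ψ₀)) ρ₁ := by
      rw [mem_ball_iff_norm, Prod.norm_def, Prod.norm_def]
      simpa using ⟨(hr1 r hr).1.trans_le l1, (hr1 r hr).2.trans_le l1, (hη hY).trans_le l1⟩
    have hc : ContinuousAt G ((radial r).1, (radial r).2, Y) :=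
      hlip.continuousOn.continuousAt (mem_of_superset (Metric.isOpen_ball.mem_nhds hb) hball)
    refine ContinuousAt.continuousWithinAt ?_
    have hrc := continuous_radial.continuousAt (x := r)
    exact hc.comp (f := fun r => ((radial r).1, (radial r).2, Y))
      (hrc.fst.prodMk (hrc.snd.prodMk continuousAt_const))
  · have h1 := hmix (radial r).1 (radial r).2 Y Z ((hr1 r hr).1.trans_le l2)
      (by simpa using (hr1 r hr).2.trans_le l2) ((hη hY).trans_le l2) ((hη hZ).trans_le l2)
    have h2 := (le_abs_self _).trans ((norm_fst_le _).trans h1)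
    simp only [Prod.fst_sub, hG0] at h2
    have h3 := (abs_le.1 (htan Y.1 Z.1 (htan' Y hY) (htan' Z hZ))).1
    rw [abs_of_nonneg (sub_nonneg.2 hYZ)] at h3
    have h4 := (hmz (y := (radial r).2) (by simpa using (hr1 r hr).2.trans_le l4)).1
    have h5 : 3 / 4 * (Real.tan Y.1 - Real.tan Z.1) ≤
        m₁ (radial r).2 * (Real.tan Y.1 - Real.tan Z.1) :=
      mul_le_mul_of_nonneg_right h4 (by linarith)
    have h6 : K₂ * ‖Y - Z‖ * |(radial r).1| ≤ K * r ^ 3 * ‖Y - Z‖ := by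
      have := hr.1
      calc _ ≤ K₂ * ‖Y - Z‖ * (6 * r ^ 3) := by gcongr; exact hphi3 r hr
        _ = (6 * K₂) * r ^ 3 * ‖Y - Z‖ := by ring
        _ ≤ _ := by gcongr; rw [hK]; linarith
    linarith
  · have h1 := hmix (radial r).1 (radial r).2 Y Z ((hr1 r hr).1.trans_le l2)
      (by simpa using (hr1 r hr).2.trans_le l2) ((hη hY).trans_le l2) ((hη hZ).trans_le l2)
    have h2 : |_| ≤ _ := (norm_snd_le _).trans h1
    simp only [Prod.snd_sub, hG0] at h2
    have h3 := htan Y.1 Z.1 (htan' Y hY) (htan' Z hZ)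
    have h3' : |Real.tan Y.1 - Real.tan Z.1| ≤ 2 * |Y.1 - Z.1| := by
      have := abs_sub_abs_le_abs_sub (Real.tan Y.1 - Real.tan Z.1) (Y.1 - Z.1)
      linarith [abs_nonneg (Y.1 - Z.1)]
    have h4 := (hmz (y := (radial r).2) (by simpa using (hr1 r hr).2.trans_le l4)).2
    have hr0 := hr.1
    have h5 : |m₂ (radial r).2 * (radial r).2.1 ^ 2 * Real.tan Y.1 -
        m₂ (radial r).2 * (radial r).2.1 ^ 2 * Real.tan Z.1| ≤ K * r ^ 2 * |Y.1 - Z.1| := by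
      rw [← mul_sub, abs_mul, abs_mul]
      have e : |(radial r).2.1 ^ 2| = r ^ 2 := abs_of_nonneg (by positivity)
      rw [e]
      calc _ ≤ M * r ^ 2 * (2 * |Y.1 - Z.1|) := by gcongr
        _ = (2 * M) * r ^ 2 * |Y.1 - Z.1| := by ring
        _ ≤ _ := by gcongr; rw [hK]; linarith
    have h6 : K₂ * ‖Y - Z‖ * |(radial r).1| ≤ K * r ^ 3 * ‖Y - Z‖ := by
      calc _ ≤ K₂ * ‖Y - Z‖ * (6 * r ^ 3) := by gcongr; exact hphi3 r hr
        _ = (6 * K₂) * r ^ 3 * ‖Y - Z‖ := by ring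
        _ ≤ _ := by gcongr; rw [hK]; linarith
    have h7 := abs_sub_abs_le_abs_sub
      ((G ((radial r).1, (radial r).2, Y)).2 - (G ((radial r).1, (radial r).2, Z)).2)
      (m₂ (radial r).2 * (radial r).2.1 ^ 2 * Real.tan Y.1 -
        m₂ (radial r).2 * (radial r).2.1 ^ 2 * Real.tan Z.1)
    linarith
  · have h := hlip.dist_le_mul _ (hmemG _ _ (0, ψ₀) (hr1 r hr).1 (hr1 r hr).2 (by simpa)) _
      (hmemG 0 (radial r).2 (0, ψ₀) (by simpa) (hr1 r hr).2 (by simpa))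
    have e : dist ((radial r).1, (radial r).2, ((0, ψ₀) : ℝ × ℝ)) (0, (radial r).2, (0, ψ₀)) =
        |(radial r).1| := by simp [Prod.dist_eq]
    rw [hGz, dist_zero_right, e] at h
    have hr0 := hr.1
    calc _ ≤ K₁ * |(radial r).1| := h
      _ ≤ K₁ * (6 * r ^ 7) := by gcongr; exact hphi r hr
      _ = (6 * K₁) * r ^ 7 := by ring
      _ ≤ _ := by gcongr; rw [hK]; linarith

/-! ### The vector field as a smooth function of `φ₁(r)`, `r`, `r² log r`, `α` and `ψ` -/

/-- `4 R² + x² + y²` -/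
def smD (R φ α : ℝ) : ℝ := 8 * R ^ 2 + φ ^ 2 + 4 * R * φ * Real.sin α

/-- `x² + y²` -/
def smQ (R φ α : ℝ) : ℝ := 4 * R ^ 2 + φ ^ 2 + 4 * R * φ * Real.sin α

/-- The square root of `a`. -/
def smA (R φ α : ℝ) : ℝ := smD R φ α / (4 * R * √(smQ R φ α))

/-- The derivative of the square root of `a` with respect to `x² + y²`. -/
def smA' (R φ α : ℝ) : ℝ := (smQ R φ α - 4 * R ^ 2) / (8 * R * smQ R φ α * √(smQ R φ α))

/-- The product of the energy and `l`. -/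
def smK (R Γ h φ r w α : ℝ) : ℝ :=
  Γ / (4 * Real.pi) + r ^ 2 * (h - Γ / (8 * Real.pi) * Real.log (2 * R ^ 2 / smD R φ α))
    - Γ / (4 * Real.pi) * w

/-- `smS` and `smT` are the radial and angular components of the velocity divided by the square root
of the energy; at φ = 0 they are cos (ψ - α) and sin (ψ - α). -/
def smS (R φ α ψ : ℝ) : ℝ :=
  smA R φ α * Real.cos ψ * Real.cos α + Real.sin ψ * Real.sin α

def smT (R φ α ψ : ℝ) : ℝ :=
  Real.sin ψ * Real.cos α - smA R φ α * Real.cos ψ * Real.sin α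

/-- What is left of `B` after its cancellations. Every term carries a factor φ or r², so it vanishes
on the collision manifold; no derivative of the energy and no negative power of r remains. -/
def smB (R Γ h φ r w α ψ : ℝ) : ℝ :=
  -(smA R φ α * Real.sin ψ *
      (φ * smK R Γ h φ r w α * (φ * Real.cos α) *
          (2 * Real.cos ψ ^ 2 / smQ R φ α + 4 * Real.sin ψ ^ 2 / smD R φ α)
        - Γ / (4 * Real.pi) * r ^ 2 * (Real.cos α - φ * (φ * Real.cos α) / smD R φ α)))
    + Real.cos ψ *
      (φ * smK R Γ h φ r w α * (φ * Real.sin α + 2 * R) *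
          (2 * Real.cos ψ ^ 2 / smQ R φ α + 4 * Real.sin ψ ^ 2 / smD R φ α)
        - Γ / (4 * Real.pi) * r ^ 2 * (Real.sin α - φ * (φ * Real.sin α + 2 * R) / smD R φ α))
    - Real.sin ψ * Real.cos ψ * smK R Γ h φ r w α * smA' R φ α * φ *
        (4 * (φ + 2 * R * Real.sin α) * smS R φ α ψ + 4 * R * Real.cos α * smT R φ α ψ)
      / smA R φ α

/-! ### The geometric quantities in terms of φ and α. -/

section

variable {R Γ h r α ψ : ℝ}

theorem smD_pos (hR : 0 < R) (φ α : ℝ) : 0 < smD R φ α := by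
  have := Real.neg_one_le_sin α
  have := Real.sin_le_one α
  unfold smD
  nlinarith [sq_nonneg (φ + 2 * R * Real.sin α), sq_nonneg (Real.cos α), Real.sin_sq_add_cos_sq α,
    mul_pos hR hR, mul_nonneg (mul_pos hR hR).le (sq_nonneg (Real.cos α))]

/-- smQ = (2R - φ)² + 4Rφ(1 + sin α): the bound φ < 2R keeps the point away from the origin of the
plane. -/
theorem smQ_pos {φ : ℝ} (hφ : 0 ≤ φ) (hφR : φ < 2 * R) (α : ℝ) : 0 < smQ R φ α := by
  have h1 := Real.neg_one_le_sin α
  have hR : 0 < R := by linarith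
  have h2 : 0 ≤ R * φ * (1 + Real.sin α) := by
    have : 0 ≤ 1 + Real.sin α := by linarith
    positivity
  have h3 : 0 < (2 * R - φ) ^ 2 := by
    have : 0 < 2 * R - φ := by linarith
    positivity
  unfold smQ
  nlinarith

theorem smA_pos (hR : 0 < R) {φ : ℝ} (hφ : 0 ≤ φ) (hφR : φ < 2 * R) (α : ℝ) : 0 < smA R φ α := by
  have h1 := Real.sqrt_pos.2 (smQ_pos hφ hφR α)
  have h2 := smD_pos hR φ α
  unfold smA
  positivity

theorem xCoord_sq_add_yCoord_sq (R r α : ℝ) :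
    xCoord r α ^ 2 + yCoord R r α ^ 2 = smQ R (phi1 r) α := by
  unfold xCoord yCoord smQ
  linear_combination (phi1 r ^ 2) * Real.sin_sq_add_cos_sq α

theorem add_xCoord_sq_add_yCoord_sq (R r α : ℝ) :
    4 * R ^ 2 + xCoord r α ^ 2 + yCoord R r α ^ 2 = smD R (phi1 r) α := by
  rw [add_assoc, xCoord_sq_add_yCoord_sq]; unfold smQ smD; ring

theorem a_eq (R r α : ℝ) : a R r α = smA R (phi1 r) α ^ 2 := by
  rw [a, aXY, add_xCoord_sq_add_yCoord_sq, xCoord_sq_add_yCoord_sq, smA]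

theorem sqrt_a (hR : 0 < R) (r α : ℝ) : √(a R r α) = smA R (phi1 r) α := by
  rw [a_eq, Real.sqrt_sq]
  have := (smD_pos hR (phi1 r) α).le
  unfold smA
  positivity

theorem l_eq (R r α : ℝ) : l R r α = 8 * R ^ 2 / smD R (phi1 r) α ^ 2 := by
  rw [l, lXY, add_xCoord_sq_add_yCoord_sq]

theorem l_pos (hR : 0 < R) (r α : ℝ) : 0 < l R r α := by
  rw [l_eq]
  have := smD_pos hR (phi1 r) α
  positivity

theorem b_eq (R r α : ℝ) : b R r α = 2 * R ^ 2 * phi1 r ^ 2 / smD R (phi1 r) α := by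
  rw [b, bXY, add_xCoord_sq_add_yCoord_sq]
  congr 2
  unfold xCoord yCoord
  linear_combination (phi1 r ^ 2) * Real.sin_sq_add_cos_sq α

theorem log_phi1 (hr : 0 < r) : Real.log (phi1 r) = Real.log r - 1 / r ^ 2 := by
  rw [phi1, Real.log_mul hr.ne' (Real.exp_pos _).ne', Real.log_exp]; ring

/-- log b = log (2R² / D) + 2 log r - 2 / r². Multiplied by r², the last term becomes the constant Γ
/ (4π), and log r survives only as r² log r. This constant is the rate that governs the whole local
picture. -/
theorem energy_mul_l (hR : 0 < R) (hr : 0 ≤ r) :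
    energy R Γ h r α * l R r α = smK R Γ h (phi1 r) r (r ^ 2 * Real.log r) α := by
  have hl := (l_pos hR r α).ne'
  have hπ := Real.pi_ne_zero
  rcases hr.eq_or_lt with rfl | hr
  · rw [l_eq]
    simp only [energy, smK, phi1_zero, smD]
    simp
    field_simp
    ring
  · have hD := smD_pos hR (phi1 r) α
    have hφ := phi1_pos hr
    have hb : Real.log (b R r α) =
        Real.log (2 * R ^ 2 / smD R (phi1 r) α) + 2 * (Real.log r - 1 / r ^ 2) := by
      rw [b_eq, mul_div_right_comm, Real.log_mul (by positivity) (by positivity), Real.log_pow,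
        log_phi1 hr]
      norm_num
    rw [energy, if_neg hr.ne', hb, smK]
    field_simp
    ring

theorem zx_eq (hR : 0 < R) (r α ψ : ℝ) :
    zx R Γ h r α ψ = √(energy R Γ h r α) / smA R (phi1 r) α * Real.cos ψ := by
  rw [zx, Real.sqrt_div' _ (by rw [a_eq]; positivity), sqrt_a hR]

theorem zs_eq (hR : 0 < R) (hr : 0 ≤ r) (hφR : phi1 r < 2 * R) :
    zs R Γ h r α ψ = √(energy R Γ h r α) * smS R (phi1 r) α ψ := by
  have hA := smA_pos hR (phi1_nonneg hr) hφR α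
  rw [zs, zx_eq hR, zy, a_eq, smS]
  field_simp

theorem rTau_eq (hR : 0 < R) (hr : 0 ≤ r) (hφR : phi1 r < 2 * R) :
    rTau R Γ h r α ψ = 2 * r ^ 3 / (2 + r ^ 2) * l R r α *
      (√(energy R Γ h r α) * smS R (phi1 r) α ψ) := by
  rw [rTau, zs_eq hR hr hφR]

theorem alphaTau_eq (hR : 0 < R) (hr : 0 ≤ r) (hφR : phi1 r < 2 * R) :
    alphaTau R Γ h r α ψ = l R r α * (√(energy R Γ h r α) * smT R (phi1 r) α ψ) := by
  have hA := smA_pos hR (phi1_nonneg hr) hφR α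
  rw [alphaTau, zx_eq hR, zy, a_eq, smT]
  field_simp

/-- The factor (4R² + x² + y²)² cancels. At the origin both sides are 0 by division by zero, so the
identity is unconditional and may be used under `deriv`. -/
theorem aXY_mul_lXY (hR : 0 < R) (x y : ℝ) : aXY R x y * lXY R x y = (2 * (x ^ 2 + y ^ 2))⁻¹ := by
  have hD : 0 < 4 * R ^ 2 + x ^ 2 + y ^ 2 := by positivity
  rw [aXY, lXY, div_pow, mul_pow, Real.sq_sqrt (by positivity)]
  field_simp
  norm_num

theorem dX_aXY_mul_lXY (hR : 0 < R) (hr : 0 ≤ r) (hφR : phi1 r < 2 * R) :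
    dX (fun x y => aXY R x y * lXY R x y) R r α = -xCoord r α / smQ R (phi1 r) α ^ 2 := by
  have hq := smQ_pos (phi1_nonneg hr) hφR α
  simp only [dX, aXY_mul_lXY hR]
  rw [← xCoord_sq_add_yCoord_sq] at hq ⊢
  have h1 := ((((hasDerivAt_pow 2 (xCoord r α)).add_const (yCoord R r α ^ 2)).const_mul 2).inv
    (by positivity)).deriv
  refine Eq.trans h1 ?_
  field_simp
  norm_num

theorem dY_aXY_mul_lXY (hR : 0 < R) (hr : 0 ≤ r) (hφR : phi1 r < 2 * R) :
    dY (fun x y => aXY R x y * lXY R x y) R r α = -yCoord R r α / smQ R (phi1 r) α ^ 2 := by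
  have hq := smQ_pos (phi1_nonneg hr) hφR α
  simp only [dY, aXY_mul_lXY hR]
  rw [← xCoord_sq_add_yCoord_sq] at hq ⊢
  have h1 := ((((hasDerivAt_pow 2 (yCoord R r α)).const_add (xCoord r α ^ 2)).const_mul 2).inv
    (by positivity)).deriv
  refine Eq.trans h1 ?_
  field_simp
  norm_num

theorem dX_lXY (hR : 0 < R) (r α : ℝ) :
    dX (lXY R) R r α = -(32 * R ^ 2 * xCoord r α) / smD R (phi1 r) α ^ 3 := by
  have hD := smD_pos hR (phi1 r) α
  rw [← add_xCoord_sq_add_yCoord_sq] at hD ⊢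
  have h1 := ((hasDerivAt_const (xCoord r α) (8 * R ^ 2)).div
    ((((hasDerivAt_pow 2 (xCoord r α)).const_add (4 * R ^ 2)).add_const
      (yCoord R r α ^ 2)).pow 2) (pow_pos hD 2).ne').deriv
  refine Eq.trans h1 ?_
  simp
  field_simp
  ring

theorem dY_lXY (hR : 0 < R) (r α : ℝ) :
    dY (lXY R) R r α = -(32 * R ^ 2 * yCoord R r α) / smD R (phi1 r) α ^ 3 := by
  have hD := smD_pos hR (phi1 r) α
  rw [← add_xCoord_sq_add_yCoord_sq] at hD ⊢
  have h1 := ((hasDerivAt_const (yCoord R r α) (8 * R ^ 2)).div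
    (((hasDerivAt_pow 2 (yCoord R r α)).const_add (4 * R ^ 2 + xCoord r α ^ 2)).pow 2)
    (pow_pos hD 2).ne').deriv
  refine Eq.trans h1 ?_
  simp
  field_simp
  ring

/-- b vanishes quadratically in φ, so its logarithmic derivative has a simple pole in φ, which the
factor φ₁(r) removes. -/
theorem dX_bXY_div (hR : 0 < R) (hr : 0 < r) :
    phi1 r * (dX (bXY R) R r α / b R r α) =
      2 * (Real.cos α - phi1 r * xCoord r α / smD R (phi1 r) α) := by
  have hD := smD_pos hR (phi1 r) α
  have hφ := phi1_pos hr
  have hd : dX (bXY R) R r α = 2 * R ^ 2 * (2 * xCoord r α * smD R (phi1 r) α -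
      phi1 r ^ 2 * (2 * xCoord r α)) / smD R (phi1 r) α ^ 2 := by
    have hN : xCoord r α ^ 2 + (yCoord R r α - 2 * R) ^ 2 = phi1 r ^ 2 := by
      unfold xCoord yCoord
      linear_combination (phi1 r ^ 2) * Real.sin_sq_add_cos_sq α
    rw [← hN]
    rw [← add_xCoord_sq_add_yCoord_sq] at hD ⊢
    have h1 := ((((hasDerivAt_pow 2 (xCoord r α)).add_const
      ((yCoord R r α - 2 * R) ^ 2)).const_mul (2 * R ^ 2)).div
      (((hasDerivAt_pow 2 (xCoord r α)).const_add (4 * R ^ 2)).add_const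
      (yCoord R r α ^ 2)) hD.ne').deriv
    refine Eq.trans h1 ?_
    simp
    ring
  rw [hd, b_eq]
  unfold xCoord
  field_simp

theorem dY_bXY_div (hR : 0 < R) (hr : 0 < r) :
    phi1 r * (dY (bXY R) R r α / b R r α) =
      2 * (Real.sin α - phi1 r * yCoord R r α / smD R (phi1 r) α) := by
  have hD := smD_pos hR (phi1 r) α
  have hφ := phi1_pos hr
  have hd : dY (bXY R) R r α = 2 * R ^ 2 * (2 * (yCoord R r α - 2 * R) * smD R (phi1 r) α -
      phi1 r ^ 2 * (2 * yCoord R r α)) / smD R (phi1 r) α ^ 2 := by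
    have hN : xCoord r α ^ 2 + (yCoord R r α - 2 * R) ^ 2 = phi1 r ^ 2 := by
      unfold xCoord yCoord
      linear_combination (phi1 r ^ 2) * Real.sin_sq_add_cos_sq α
    rw [← hN]
    rw [← add_xCoord_sq_add_yCoord_sq] at hD ⊢
    have h1 := ((((((hasDerivAt_id (yCoord R r α)).sub_const (2 * R)).pow 2).const_add
      (xCoord r α ^ 2)).const_mul (2 * R ^ 2)).div
      ((hasDerivAt_pow 2 (yCoord R r α)).const_add (4 * R ^ 2 + xCoord r α ^ 2)) hD.ne').deriv
    refine Eq.trans h1 ?_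
    simp
    ring
  rw [hd, b_eq]
  unfold yCoord
  field_simp
  ring

end

/-! ### Cancellations in the equation for ψ. -/

section

variable {R Γ h r α ψ : ℝ}

theorem energy_eq (hR : 0 < R) (hr : 0 ≤ r) :
    energy R Γ h r α = smK R Γ h (phi1 r) r (r ^ 2 * Real.log r) α *
      smD R (phi1 r) α ^ 2 / (8 * R ^ 2) := by
  have hD := smD_pos hR (phi1 r) α
  rw [← energy_mul_l hR hr, l_eq]
  field_simp

/-- Since a l and l depend only on x² + y², their gradients are multiples of (x, y); hence one
identity serves both coordinates, with x standing for either. -/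
theorem kinetic_term (hR : 0 < R) (hr : 0 ≤ r) (hφR : phi1 r < 2 * R)
    (hE : 0 ≤ energy R Γ h r α) (x : ℝ) :
    -x / smQ R (phi1 r) α ^ 2 * (√(energy R Γ h r α) / smA R (phi1 r) α * Real.cos ψ) ^ 2
      + -(32 * R ^ 2 * x) / smD R (phi1 r) α ^ 3 * (√(energy R Γ h r α) * Real.sin ψ) ^ 2 =
    -(smK R Γ h (phi1 r) r (r ^ 2 * Real.log r) α * x *
      (2 * Real.cos ψ ^ 2 / smQ R (phi1 r) α + 4 * Real.sin ψ ^ 2 / smD R (phi1 r) α)) := by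
  have hφ := phi1_nonneg hr
  have hD := smD_pos hR (phi1 r) α
  have hq := smQ_pos hφ hφR α
  have hA2 : smA R (phi1 r) α ^ 2 = smD R (phi1 r) α ^ 2 / (16 * R ^ 2 * smQ R (phi1 r) α) := by
    rw [smA, div_pow, mul_pow, Real.sq_sqrt hq.le]; ring
  rw [mul_pow, mul_pow, div_pow, Real.sq_sqrt hE, energy_eq hR hr, hA2]
  field_simp
  ring

theorem A1_eq (hR : 0 < R) (hr : 0 < r) (hφR : phi1 r < 2 * R) (hE : 0 ≤ energy R Γ h r α) :
    A1 R Γ h r α ψ =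
      (phi1 r * smK R Γ h (phi1 r) r (r ^ 2 * Real.log r) α * xCoord r α *
          (2 * Real.cos ψ ^ 2 / smQ R (phi1 r) α + 4 * Real.sin ψ ^ 2 / smD R (phi1 r) α)
        - Γ / (4 * Real.pi) * r ^ 2 *
          (Real.cos α - phi1 r * xCoord r α / smD R (phi1 r) α))
      + 2 * (r ^ 2 / (r ^ 2 + 2)) * smK R Γ h (phi1 r) r (r ^ 2 * Real.log r) α *
        smS R (phi1 r) α ψ * Real.cos ψ / smA R (phi1 r) α := by
  have hb := dX_bXY_div (α := α) hR hr
  have hk := energy_mul_l (Γ := Γ) (h := h) (α := α) hR hr.le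
  have he := Real.sq_sqrt hE
  rw [A1, dX_aXY_mul_lXY hR hr.le hφR, dX_lXY hR, zx_eq hR, zs_eq hR hr.le hφR, zy,
    kinetic_term hR hr.le hφR hE]
  have h3 : Γ / (8 * Real.pi) * r ^ 3 * Real.exp (-1 / r ^ 2) * (dX (bXY R) R r α / b R r α) =
      Γ / (4 * Real.pi) * r ^ 2 * (Real.cos α - phi1 r * xCoord r α / smD R (phi1 r) α) := by
    rw [phi1] at hb ⊢
    linear_combination (Γ / (8 * Real.pi) * r ^ 2) * hb
  rw [h3, ← hk, ← he, Real.sqrt_sq (Real.sqrt_nonneg _), phi1]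
  ring

theorem A2_eq (hR : 0 < R) (hr : 0 < r) (hφR : phi1 r < 2 * R) (hE : 0 ≤ energy R Γ h r α) :
    A2 R Γ h r α ψ =
      (phi1 r * smK R Γ h (phi1 r) r (r ^ 2 * Real.log r) α * yCoord R r α *
          (2 * Real.cos ψ ^ 2 / smQ R (phi1 r) α + 4 * Real.sin ψ ^ 2 / smD R (phi1 r) α)
        - Γ / (4 * Real.pi) * r ^ 2 *
          (Real.sin α - phi1 r * yCoord R r α / smD R (phi1 r) α))
      + 2 * (r ^ 2 / (r ^ 2 + 2)) * smK R Γ h (phi1 r) r (r ^ 2 * Real.log r) α *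
        smS R (phi1 r) α ψ * Real.sin ψ := by
  have hb := dY_bXY_div (α := α) hR hr
  have hk := energy_mul_l (Γ := Γ) (h := h) (α := α) hR hr.le
  have he := Real.sq_sqrt hE
  rw [A2, dY_aXY_mul_lXY hR hr.le hφR, dY_lXY hR, zx_eq hR, zs_eq hR hr.le hφR, zy,
    kinetic_term hR hr.le hφR hE]
  have h3 : Γ / (8 * Real.pi) * r ^ 3 * Real.exp (-1 / r ^ 2) * (dY (bXY R) R r α / b R r α) =
      Γ / (4 * Real.pi) * r ^ 2 * (Real.sin α - phi1 r * yCoord R r α / smD R (phi1 r) α) := by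
    rw [phi1] at hb ⊢
    linear_combination (Γ / (8 * Real.pi) * r ^ 2) * hb
  rw [h3, ← hk, ← he, Real.sqrt_sq (Real.sqrt_nonneg _), phi1]
  ring

theorem hasDerivAt_smA {q : ℝ → ℝ} {q' t : ℝ} (hR : 0 < R) (hq : HasDerivAt q q' t)
    (hqt : 0 < q t) :
    HasDerivAt (fun s => (4 * R ^ 2 + q s) / (4 * R * √(q s)))
      ((q t - 4 * R ^ 2) / (8 * R * q t * √(q t)) * q') t := by
  have h1 := Real.sqrt_pos.2 hqt
  have h2 := Real.sq_sqrt hqt.le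
  refine ((hq.const_add (4 * R ^ 2)).div ((hq.sqrt hqt.ne').const_mul (4 * R))
    (by positivity)).congr_deriv ?_
  set s := √(q t)
  rw [← h2]
  field_simp
  ring

theorem smA_eq (R φ α : ℝ) :
    smA R φ α = (4 * R ^ 2 + smQ R φ α) / (4 * R * √(smQ R φ α)) := by
  rw [smA, smQ, smD]; ring_nf

theorem hasDerivAt_smA_phi1 (hR : 0 < R) (hr : 0 < r) (hφR : phi1 r < 2 * R) :
    HasDerivAt (fun ρ => smA R (phi1 ρ) α) (smA' R (phi1 r) α *
      ((2 * phi1 r + 4 * R * Real.sin α) * (phi1 r * (r ^ 2 + 2) / r ^ 3))) r := by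
  have hφ := hasDerivAt_phi1 hr.ne'
  have hq : HasDerivAt (fun ρ => smQ R (phi1 ρ) α)
      ((2 * phi1 r + 4 * R * Real.sin α) * (phi1 r * (r ^ 2 + 2) / r ^ 3)) r := by
    refine (((hφ.pow 2).const_add (4 * R ^ 2)).add
      ((hφ.const_mul (4 * R)).mul_const (Real.sin α))).congr_deriv ?_
    simp; ring
  simp only [smA_eq]
  exact hasDerivAt_smA hR hq (smQ_pos (phi1_nonneg hr.le) hφR α)

theorem hasDerivAt_smA_angle (hR : 0 < R) (hr : 0 ≤ r) (hφR : phi1 r < 2 * R) :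
    HasDerivAt (fun β => smA R (phi1 r) β) (smA' R (phi1 r) α *
      (4 * R * phi1 r * Real.cos α)) α := by
  have hq : HasDerivAt (fun β => smQ R (phi1 r) β) (4 * R * phi1 r * Real.cos α) α :=
    ((Real.hasDerivAt_sin α).const_mul (4 * R * phi1 r)).const_add (4 * R ^ 2 + phi1 r ^ 2)
  simp only [smA_eq]
  exact hasDerivAt_smA hR hq (smQ_pos (phi1_nonneg hr) hφR α)

theorem differentiableAt_energy (hR : 0 < R) (hr : 0 < r) :
    DifferentiableAt ℝ (fun ρ => energy R Γ h ρ α) r := by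
  have hφ : DifferentiableAt ℝ phi1 r := (hasDerivAt_phi1 hr.ne').differentiableAt
  have hD : DifferentiableAt ℝ (fun ρ => smD R (phi1 ρ) α) r := by unfold smD; fun_prop
  have hD0 := smD_pos hR (phi1 r) α
  have hφ0 := phi1_pos hr
  have hl : DifferentiableAt ℝ (fun ρ => l R ρ α) r := by
    simp only [l_eq]
    exact (differentiableAt_const _).div (hD.pow 2) (pow_pos hD0 2).ne'
  have hb : DifferentiableAt ℝ (fun ρ => b R ρ α) r := by
    simp only [b_eq]
    exact ((hφ.pow 2).const_mul _).div hD hD0.ne'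
  have hb0 : b R r α ≠ 0 := by rw [b_eq]; positivity
  have : DifferentiableAt ℝ
      (fun ρ => ρ ^ 2 / l R ρ α * (h - Γ / (8 * Real.pi) * Real.log (b R ρ α))) r :=
    (((differentiableAt_id.pow 2).div hl (l_pos hR r α).ne')).mul
      (((hb.log hb0).const_mul _).const_sub h)
  refine this.congr_of_eventuallyEq ?_
  filter_upwards [lt_mem_nhds hr] with ρ hρ
  rw [energy, if_neg hρ.ne']

theorem differentiableAt_energy_angle (hR : 0 < R) (hr : 0 < r) :
    DifferentiableAt ℝ (fun β => energy R Γ h r β) α := by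
  have hD : DifferentiableAt ℝ (fun β => smD R (phi1 r) β) α := by
    have := Real.differentiableAt_sin (x := α)
    unfold smD; fun_prop
  have hD0 := smD_pos hR (phi1 r) α
  have hφ0 := phi1_pos hr
  have hl : DifferentiableAt ℝ (fun β => l R r β) α := by
    simp only [l_eq]
    exact (differentiableAt_const _).div (hD.pow 2) (pow_pos hD0 2).ne'
  have hb : DifferentiableAt ℝ (fun β => b R r β) α := by
    simp only [b_eq]
    exact (differentiableAt_const _).div hD hD0.ne'
  have hb0 : b R r α ≠ 0 := by rw [b_eq]; positivity
  simp only [energy, if_neg hr.ne']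
  exact ((differentiableAt_const _).div hl (l_pos hR r α).ne').mul
    (((hb.log hb0).const_mul _).const_sub h)

/-- Three cancellations. The r² / (r² + 2) terms of `A1` and `A2` drop out of -√a sin ψ A₁ + cos ψ
A₂. With E the energy, √a d(√E / √a) - d√E = -√E d√a / √a, so derivatives of the energy disappear.
In d√a / dτ the factor r⁻³ of φ₁' meets the r³ of the radial velocity. -/
theorem B_eq (hR : 0 < R) (hr : 0 ≤ r) (hφR : phi1 r < 2 * R) (hE : 0 < energy R Γ h r α) :
    B R Γ h r α ψ = smB R Γ h (phi1 r) r (r ^ 2 * Real.log r) α ψ := by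
  rcases hr.eq_or_lt with rfl | hr
  · simp [B, smB, phi1_zero]
  have hA := smA_pos hR (phi1_nonneg hr.le) hφR α
  have hk := energy_mul_l (Γ := Γ) (h := h) (α := α) hR hr.le
  have he := Real.sq_sqrt hE.le
  have e1 : deriv (fun ρ => √(energy R Γ h ρ α / a R ρ α)) r =
      (deriv (fun ρ => √(energy R Γ h ρ α)) r * smA R (phi1 r) α - √(energy R Γ h r α) *
        (smA' R (phi1 r) α * ((2 * phi1 r + 4 * R * Real.sin α) *
          (phi1 r * (r ^ 2 + 2) / r ^ 3)))) / smA R (phi1 r) α ^ 2 := by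
    have : (fun ρ => √(energy R Γ h ρ α / a R ρ α)) =
        fun ρ => √(energy R Γ h ρ α) / smA R (phi1 ρ) α := funext fun ρ => by
      rw [Real.sqrt_div' _ (by rw [a_eq]; positivity), sqrt_a hR]
    rw [this]
    exact (((differentiableAt_energy hR hr).sqrt hE.ne').hasDerivAt.div
      (hasDerivAt_smA_phi1 hR hr hφR) hA.ne').deriv
  have e2 : deriv (fun β => √(energy R Γ h r β / a R r β)) α =
      (deriv (fun β => √(energy R Γ h r β)) α * smA R (phi1 r) α - √(energy R Γ h r α) *
        (smA' R (phi1 r) α * (4 * R * phi1 r * Real.cos α))) / smA R (phi1 r) α ^ 2 := by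
    have : (fun β => √(energy R Γ h r β / a R r β)) =
        fun β => √(energy R Γ h r β) / smA R (phi1 r) β := funext fun β => by
      rw [Real.sqrt_div' _ (by rw [a_eq]; positivity), sqrt_a hR]
    rw [this]
    exact (((differentiableAt_energy_angle hR hr).sqrt hE.ne').hasDerivAt.div
      (hasDerivAt_smA_angle hR hr.le hφR) hA.ne').deriv
  rw [B, if_neg hr.ne', sqrt_a hR, A1_eq hR hr hφR hE.le, A2_eq hR hr hφR hE.le, dTau, dTau, e1, e2,
    rTau_eq hR hr.le hφR, alphaTau_eq hR hr.le hφR, smB, ← hk]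
  have hx : xCoord r α = phi1 r * Real.cos α := rfl
  have hy : yCoord R r α = phi1 r * Real.sin α + 2 * R := rfl
  rw [hx, hy]
  have hD := smD_pos hR (phi1 r) α
  have hq := smQ_pos (phi1_nonneg hr.le) hφR α
  -- These two derivatives cancel, so only the differentiability used in `e1` and `e2` matters, not
  -- their values.
  generalize deriv (fun ρ => √(energy R Γ h ρ α)) r = er
  generalize deriv (fun β => √(energy R Γ h r β)) α = ea
  rw [← he, Real.sqrt_sq (Real.sqrt_nonneg _)]
  generalize √(energy R Γ h r α) = e
  generalize smA' R (phi1 r) α = A'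
  generalize smS R (phi1 r) α ψ = S
  generalize smT R (phi1 r) α ψ = T
  generalize l R r α = l
  generalize smD R (phi1 r) α = D at *
  generalize smQ R (phi1 r) α = Q at *
  generalize smA R (phi1 r) α = A at *
  generalize phi1 r = φ
  field_simp
  ring

theorem field_eq (hR : 0 < R) {p : Fin 3 → ℝ} (hr : 0 ≤ p 0) (hφR : phi1 (p 0) < 2 * R)
    (hE : 0 < energy R Γ h (p 0) (p 1)) :
    field R Γ h p =
      ![2 * p 0 ^ 3 / (2 + p 0 ^ 2) *
          smK R Γ h (phi1 (p 0)) (p 0) (p 0 ^ 2 * Real.log (p 0)) (p 1) *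
          smS R (phi1 (p 0)) (p 1) (p 2),
        smK R Γ h (phi1 (p 0)) (p 0) (p 0 ^ 2 * Real.log (p 0)) (p 1) *
          smT R (phi1 (p 0)) (p 1) (p 2),
        smB R Γ h (phi1 (p 0)) (p 0) (p 0 ^ 2 * Real.log (p 0)) (p 1) (p 2)] := by
  rw [field, B_eq hR hr hφR hE, sqrt_a hR, ← energy_mul_l hR hr, smS, smT]
  congr 1
  ring

end

/-! ### Arcs -/

/-- A continuous linear functional that recovers the parameter up to a constant forces c' ≠ 0 and
provides a continuous left inverse, so the curve is an immersion and an embedding at once. -/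
theorem isArc_of_linear_section {E : Type*} [NormedAddCommGroup E] [NormedSpace ℝ E] {I : Set ℝ}
    {S : Set E} {P v : E} {c : ℝ → E} (hI : UniqueDiffOn ℝ I) (h0 : (0 : ℝ) ∈ I)
    (hc : ContDiffOn ℝ 1 c I) (g : E →L[ℝ] ℝ) (k : ℝ) (hg : ∀ t, g (c t) = t + k)
    (himg : c '' I = S) (hc0 : c 0 = P) (hv : HasDerivWithinAt c v I 0) : IsArc I S P v := by
  refine ⟨c, hc, fun t ht h => ?_, ?_, himg, hc0, hv.derivWithin (hI 0 h0)⟩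
  · have h1 := ((hc.differentiableOn (by simp)) t ht).hasDerivWithinAt
    rw [h] at h1
    have h2 := g.hasFDerivAt.comp_hasDerivWithinAt t h1
    have h3 : HasDerivWithinAt (fun t => g (c t)) 1 I t := by
      simp only [hg]
      exact (hasDerivWithinAt_id t I).add_const k
    have h4 := (hI t ht).eq_deriv _ h2 h3
    simp at h4
  · refine IsEmbedding.of_comp (g := fun x => g x - k) ?_ (by fun_prop) ?_
    · exact hc.continuousOn.domRestrict
    · have : (fun x => g x - k) ∘ (fun t : I => c t) = Subtype.val := by
        ext t; simp [hg]
      rw [this]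
      exact IsEmbedding.subtypeVal

/-! ### A scalar equation -/

/-- The equation `r' = r³ P(r)` with `P` pinched between positive constants has backward solutions
for all times, and they tend to `0`. -/
theorem exists_backward_solution_cube {P : ℝ → ℝ} {r₀ c₁ c₂ : ℝ} (hr₀ : 0 < r₀) (hc₁ : 0 < c₁)
    (hP : ContinuousOn P (Ioc 0 r₀)) (hP1 : ∀ r ∈ Ioc 0 r₀, c₁ ≤ P r)
    (hP2 : ∀ r ∈ Ioc 0 r₀, P r ≤ c₂) :
    ∃ u : ℝ → ℝ, u 0 = r₀ ∧ (∀ t ≤ 0, u t ∈ Ioc 0 r₀) ∧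
      (∀ t ≤ 0, HasDerivAt u (u t ^ 3 * P (u t)) t) ∧ Tendsto u atBot (𝓝 0) := by
  -- The substitution s = r⁻² turns r' = r³ P into s' = -2 P, whose speed is bounded above and
  -- below. The function g converts s back to r and is frozen at r₀ for s ≤ s₀, so that the speed Q
  -- is defined on the whole line; inverting the travel time T solves the equation.
  set s₀ : ℝ := (r₀ ^ 2)⁻¹ with hs₀
  have hs₀pos : 0 < s₀ := by positivity
  have hr₀s : (√s₀)⁻¹ = r₀ := by rw [hs₀, Real.sqrt_inv, Real.sqrt_sq hr₀.le, inv_inv]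
  have hc₂ : 0 < c₂ := hc₁.trans_le ((hP1 r₀ ⟨hr₀, le_rfl⟩).trans (hP2 r₀ ⟨hr₀, le_rfl⟩))
  set g : ℝ → ℝ := fun s => (√(max s s₀))⁻¹ with hg
  have hmax : ∀ s, 0 < max s s₀ := fun s => hs₀pos.trans_le (le_max_right _ _)
  have hgmem : ∀ s, g s ∈ Ioc 0 r₀ := fun s => by
    have := Real.sqrt_pos.2 (hmax s)
    refine ⟨by positivity, ?_⟩
    rw [← hr₀s]
    have := Real.sqrt_pos.2 hs₀pos
    simp only [hg]
    gcongr
    exact le_max_right _ _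
  have hgcont : Continuous g :=
    ((continuous_id.max continuous_const).sqrt).inv₀ fun s => (Real.sqrt_pos.2 (hmax s)).ne'
  set Q : ℝ → ℝ := fun s => 2 * P (g s) with hQ
  have hQcont : Continuous Q := continuous_const.mul (hP.comp_continuous hgcont hgmem)
  have hQ1 : ∀ s, 0 < Q s := fun s => by have := hP1 _ (hgmem s); simp only [hQ]; linarith
  have hQ2 : ∀ s, Q s ≤ 2 * c₂ := fun s => by have := hP2 _ (hgmem s); simp only [hQ]; linarith
  set T : ℝ → ℝ := fun s => ∫ x in s₀..s, (Q x)⁻¹ with hT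
  have hTd : ∀ s, HasDerivAt T (Q s)⁻¹ s := fun s =>
    ((hQcont.inv₀ fun s => (hQ1 s).ne').integral_hasStrictDerivAt s₀ s).hasDerivAt
  have hT0 : T s₀ = 0 := intervalIntegral.integral_same
  have hmono : StrictMono T := strictMono_of_deriv_pos fun s => by
    rw [(hTd s).deriv]; exact inv_pos.2 (hQ1 s)
  -- T' ≥ 1 / (2 c₂), so T outgrows a linear function in both directions and is onto: the solution
  -- exists for all times.
  have hW : Monotone fun s => T s - (2 * c₂)⁻¹ * s := by
    refine monotone_of_hasDerivAt_nonneg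
      (fun s => (hTd s).sub ((hasDerivAt_id s).const_mul (2 * c₂)⁻¹)) fun s => ?_
    have := inv_anti₀ (hQ1 s) (hQ2 s)
    simp only [Pi.zero_apply, mul_one]
    linarith
  have hsurj : Function.Surjective T := by
    have hlin : ∀ b : ℝ, Tendsto (fun s => (2 * c₂)⁻¹ * s + b) atTop atTop := fun b =>
      tendsto_atTop_add_const_right _ _ (tendsto_id.const_mul_atTop (by positivity))
    have hlin' : ∀ b : ℝ, Tendsto (fun s => (2 * c₂)⁻¹ * s + b) atBot atBot := fun b =>
      tendsto_atBot_add_const_right _ _ (tendsto_id.const_mul_atBot (by positivity))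
    refine Continuous.surjective
      (continuous_iff_continuousAt.2 fun s => (hTd s).continuousAt) ?_ ?_
    · refine tendsto_atTop_mono' _ ?_ (hlin (-((2 * c₂)⁻¹ * s₀)))
      filter_upwards [eventually_ge_atTop s₀] with s hs
      have := hW hs
      simp only [hT0] at this
      linarith
    · refine tendsto_atBot_mono' _ ?_ (hlin' (-((2 * c₂)⁻¹ * s₀)))
      filter_upwards [eventually_le_atBot s₀] with s hs
      have := hW hs
      simp only [hT0] at this
      linarith
  set e := hmono.orderIsoOfSurjective T hsurj with he
  have heT : ∀ t, T (e.symm t) = t := fun t => e.apply_symm_apply t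
  have hed : ∀ t, HasDerivAt e.symm (Q (e.symm t)) t := fun t => by
    have := HasDerivAt.of_local_left_inverse e.symm.continuous.continuousAt (hTd (e.symm t))
      (inv_pos.2 (hQ1 _)).ne' (Eventually.of_forall heT)
    rwa [inv_inv] at this
  have hge : ∀ t ≤ 0, s₀ ≤ e.symm (-t) := fun t ht => by
    rw [← hmono.le_iff_le, hT0, heT]; linarith
  have hgu : ∀ t ≤ 0, g (e.symm (-t)) = (√(e.symm (-t)))⁻¹ := fun t ht => by
    simp only [hg, max_eq_left (hge t ht)]
  refine ⟨fun t => (√(e.symm (-t)))⁻¹, ?_, fun t ht => ?_, fun t ht => ?_, ?_⟩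
  · have : e.symm 0 = s₀ := hmono.injective (by rw [heT, hT0])
    simp only [neg_zero, this, hr₀s]
  · simp only [← hgu t ht]; exact hgmem _
  · have hpos : 0 < e.symm (-t) := hs₀pos.trans_le (hge t ht)
    have hsq := Real.sqrt_pos.2 hpos
    have h1 : HasDerivAt (fun t => e.symm (-t)) (-Q (e.symm (-t))) t := by
      exact ((hed (-t)).comp t (hasDerivAt_neg t)).congr_deriv (by simp)
    refine ((h1.sqrt hpos.ne').inv hsq.ne').congr_deriv ?_
    simp only [hQ, hgu t ht]
    field_simp
  · have h1 : Tendsto (fun t : ℝ => e.symm (-t)) atBot atTop :=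
      e.symm.tendsto_atTop.comp tendsto_neg_atBot_atTop
    exact tendsto_inv_atTop_zero.comp (Real.tendsto_sqrt_atTop.comp h1)

/-! ### Dynamics near a degenerate saddle -/

/-- A neighbourhood of the point `(0, α, α)`. -/
def box (α δ : ℝ) : Set (Fin 3 → ℝ) := {p | |p 0| < δ ∧ |p 2 - p 1| < δ ∧ |p 2 - α| < δ}

theorem isOpen_box (α δ : ℝ) : IsOpen (box α δ) := by
  have h : ∀ i, Continuous fun p : Fin 3 → ℝ => p i := continuous_apply
  exact (isOpen_lt (h 0).abs continuous_const).inter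
    ((isOpen_lt ((h 2).sub (h 1)).abs continuous_const).inter
      (isOpen_lt ((h 2).sub continuous_const).abs continuous_const))

/-- Turns θ' = -c sin θ into (θ²)' ≤ -c θ² for |θ| ≤ 1. -/
theorem sq_le_two_mul_mul_sin {θ : ℝ} (hθ : |θ| ≤ 1) : θ ^ 2 ≤ 2 * (θ * Real.sin θ) := by
  have key : ∀ x : ℝ, 0 < x → x ≤ 1 → x ^ 2 ≤ 2 * (x * Real.sin x) := fun x h0 h1 => by
    have h2 := Real.sin_gt_sub_cube h0
    have h3 : x ^ 3 ≤ x := pow_le_of_le_one h0.le h1 (by norm_num)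
    nlinarith
  rw [abs_le] at hθ
  rcases lt_trichotomy θ 0 with h | h | h
  · simpa using key (-θ) (by linarith) (by linarith)
  · simp [h]
  · exact key θ h hθ.2

theorem box_mono (α : ℝ) {δ δ' : ℝ} (h : δ' ≤ δ) : box α δ' ⊆ box α δ :=
  fun _ hp => ⟨hp.1.trans_le h, hp.2.1.trans_le h, hp.2.2.trans_le h⟩

theorem exists_box_subset (α : ℝ) {V : Set (Fin 3 → ℝ)} (hV : V ∈ 𝓝 ![0, α, α]) :
    ∃ δ > 0, ∀ δ' ≤ δ, box α δ' ⊆ V := by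
  obtain ⟨e, he, hb⟩ := Metric.mem_nhds_iff.1 hV
  refine ⟨e / 2, half_pos he, fun δ' hδ' p hp => hb ?_⟩
  obtain ⟨h0, h1, h2⟩ := hp
  rw [abs_lt] at h0 h1 h2
  rw [mem_ball_iff_norm, pi_norm_lt_iff he]
  intro i
  fin_cases i <;> simp [abs_lt] <;> constructor <;> linarith

/-- The local form of the vector field near the collision manifold: `G` is the right-hand side for
`(ψ - α, ψ)` as functions of `r`, multiplied by `r³`. -/
structure SaddleModel (X : (Fin 3 → ℝ) → (Fin 3 → ℝ)) (M : Set (Fin 3 → ℝ)) (α : ℝ)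
    (ρ : (Fin 3 → ℝ) → ℝ) (G : ℝ → ℝ × ℝ → ℝ × ℝ) (c c₁ c₂ K δ : ℝ) : Prop where
  stiff : StiffField G (0, α) δ δ K
  c_pos : 0 < c
  c₁_pos : 0 < c₁
  mem_iff : ∀ p ∈ box α δ, (p ∈ M ↔ 0 ≤ p 0)
  apply_zero : ∀ p ∈ box α δ, 0 ≤ p 0 → X p 0 = p 0 ^ 3 * ρ p
  le_rho : ∀ p ∈ box α δ, 0 ≤ p 0 → c₁ ≤ ρ p
  rho_le : ∀ p ∈ box α δ, 0 ≤ p 0 → ρ p ≤ c₂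
  rho_cont : ContinuousOn ρ (box α δ)
  collision : ∀ p ∈ box α δ, p 0 = 0 → X p = ![0, c * Real.sin (p 2 - p 1), 0]
  fst : ∀ p ∈ box α δ, 0 < p 0 → X p 2 - X p 1 = ρ p * (G (p 0) (p 2 - p 1, p 2)).1
  snd : ∀ p ∈ box α δ, 0 < p 0 → X p 2 = ρ p * (G (p 0) (p 2 - p 1, p 2)).2

/-! ### Elementary properties of orbits in the box. -/

namespace SaddleModel

variable {X : (Fin 3 → ℝ) → (Fin 3 → ℝ)} {M : Set (Fin 3 → ℝ)} {α : ℝ} {ρ : (Fin 3 → ℝ) → ℝ}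
  {G : ℝ → ℝ × ℝ → ℝ × ℝ} {c c₁ c₂ K δ : ℝ}

theorem mono (hX : SaddleModel X M α ρ G c c₁ c₂ K δ) {δ' : ℝ} (h0 : 0 < δ') (h : δ' ≤ δ) :
    SaddleModel X M α ρ G c c₁ c₂ K δ' :=
  have hs := box_mono α h
  { stiff := hX.stiff.mono h0 h h0 h
    c_pos := hX.c_pos
    c₁_pos := hX.c₁_pos
    mem_iff := fun p hp => hX.mem_iff p (hs hp)
    apply_zero := fun p hp => hX.apply_zero p (hs hp)
    le_rho := fun p hp => hX.le_rho p (hs hp)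
    rho_le := fun p hp => hX.rho_le p (hs hp)
    rho_cont := hX.rho_cont.mono hs
    collision := fun p hp => hX.collision p (hs hp)
    fst := fun p hp => hX.fst p (hs hp)
    snd := fun p hp => hX.snd p (hs hp) }

section

variable {T : Set ℝ} {γ : ℝ → Fin 3 → ℝ}

theorem nonneg (hX : SaddleModel X M α ρ G c c₁ c₂ K δ) (hγ : IsSolution X (M ∩ box α δ) T γ)
    {t : ℝ} (ht : t ∈ T) : 0 ≤ γ t 0 :=
  (hX.mem_iff _ (hγ t ht).1.2).1 (hγ t ht).1.1

theorem hasDeriv_coord (hγ : IsSolution X (M ∩ box α δ) T γ) {t : ℝ} (ht : t ∈ T) (i : Fin 3) :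
    HasDerivWithinAt (fun t => γ t i) (X (γ t) i) T t :=
  hasDerivWithinAt_pi.1 (hγ t ht).2 i

theorem hasDeriv_radius (hX : SaddleModel X M α ρ G c c₁ c₂ K δ)
    (hγ : IsSolution X (M ∩ box α δ) T γ) {t : ℝ} (ht : t ∈ T) :
    HasDerivWithinAt (fun t => γ t 0) (γ t 0 ^ 3 * ρ (γ t)) T t := by
  rw [← hX.apply_zero _ (hγ t ht).1.2 (hX.nonneg hγ ht)]
  exact hasDeriv_coord hγ ht 0

theorem rho_pos (hX : SaddleModel X M α ρ G c c₁ c₂ K δ)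
    (hγ : IsSolution X (M ∩ box α δ) T γ) {t : ℝ} (ht : t ∈ T) : 0 < ρ (γ t) :=
  hX.c₁_pos.trans_le (hX.le_rho _ (hγ t ht).1.2 (hX.nonneg hγ ht))

theorem monotoneOn_radius (hX : SaddleModel X M α ρ G c c₁ c₂ K δ)
    (hγ : IsSolution X (M ∩ box α δ) T γ) (hT : Convex ℝ T) :
    MonotoneOn (fun t => γ t 0) T := by
  refine monotoneOn_of_hasDerivWithinAt_nonneg hT
    (fun t ht => (hX.hasDeriv_radius hγ ht).continuousWithinAt)
    (fun t ht => (hX.hasDeriv_radius hγ (interior_subset ht)).mono interior_subset) fun t ht => ?_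
  have h1 := hX.nonneg hγ (interior_subset ht)
  have h2 := hX.rho_pos hγ (interior_subset ht)
  positivity

/-- As 0 ≤ r ≤ 1, the equation gives r' ≤ c₂ r, so r exp (-c₂ t) does not increase and an orbit
cannot leave the collision manifold forwards in time. Read backwards, an orbit with r > 0 had r > 0
at all earlier times. -/
theorem radius_eq_zero (hX : SaddleModel X M α ρ G c c₁ c₂ K δ)
    (hγ : IsSolution X (M ∩ box α δ) T γ) (hT : Convex ℝ T) {s t : ℝ} (hs : s ∈ T) (ht : t ∈ T)
    (hst : s ≤ t) (h0 : γ s 0 = 0) : γ t 0 = 0 := by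
  have hd : ∀ t ∈ T, HasDerivWithinAt (fun t => γ t 0 * Real.exp (-c₂ * t))
      (γ t 0 ^ 3 * ρ (γ t) * Real.exp (-c₂ * t) + γ t 0 * (Real.exp (-c₂ * t) * -c₂)) T t := by
    intro t ht
    refine (hX.hasDeriv_radius hγ ht).mul ?_
    simpa using ((hasDerivAt_id t).const_mul (-c₂)).exp.hasDerivWithinAt (s := T)
  have hanti : AntitoneOn (fun t => γ t 0 * Real.exp (-c₂ * t)) T := by
    refine antitoneOn_of_hasDerivWithinAt_nonpos hT (fun t ht => (hd t ht).continuousWithinAt)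
      (fun t ht => (hd t (interior_subset ht)).mono interior_subset) fun t ht => ?_
    have ht' := interior_subset ht
    have hb := (hγ t ht').1.2
    have h1 := hX.nonneg hγ ht'
    have h2 := hX.rho_le _ hb h1
    have h3 := hX.rho_pos hγ ht'
    have h4 : γ t 0 ≤ 1 := (le_abs_self _).trans (hb.1.le.trans hX.stiff.le_one)
    have h5 : γ t 0 ^ 3 ≤ γ t 0 := pow_le_of_le_one h1 h4 (by norm_num)
    have h6 : γ t 0 ^ 3 * ρ (γ t) ≤ γ t 0 * c₂ := by gcongr
    nlinarith [Real.exp_pos (-c₂ * t)]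
  have h := hanti hs ht hst
  simp only [h0, zero_mul] at h
  have h1 := hX.nonneg hγ ht
  have h2 := nonpos_of_mul_nonpos_left h (Real.exp_pos _)
  linarith

theorem psi_eq (hX : SaddleModel X M α ρ G c c₁ c₂ K δ)
    (hγ : IsSolution X (M ∩ box α δ) T γ) (hT : Convex ℝ T) (h0 : ∀ t ∈ T, γ t 0 = 0) {s t : ℝ}
    (hs : s ∈ T) (ht : t ∈ T) : γ s 2 = γ t 2 := by
  have := hT.norm_image_sub_le_of_norm_hasDerivWithin_le (C := 0)
    (fun t ht => hasDeriv_coord hγ ht 2) (fun t ht => ?_) ht hs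
  · simpa [sub_eq_zero] using this
  · rw [hX.collision _ (hγ t ht).1.2 (h0 t ht)]
    simp

/-- Backward orbits on the collision manifold that stay in the box are equilibria. -/
theorem eq_of_radius_eq_zero (hX : SaddleModel X M α ρ G c c₁ c₂ K δ)
    (hγ : IsSolution X (M ∩ box α δ) (Iic 0) γ) (h0 : γ 0 0 = 0) :
    (∀ t ∈ Iic (0 : ℝ), γ t 0 = 0) ∧ γ 0 2 = γ 0 1 := by
  have hz : ∀ t ∈ Iic (0 : ℝ), γ t 0 = 0 := fun t ht =>
    le_antisymm ((hX.monotoneOn_radius hγ (convex_Iic 0) ht self_mem_Iic ht).trans_eq h0)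
      (hX.nonneg hγ ht)
  refine ⟨hz, ?_⟩
  -- The product θ² exp (c t) does not increase while |θ| < δ, so θ(0)² ≤ δ² exp (c t) for all t ≤
  -- 0, and t → -∞ forces θ(0) = 0.
  have hd : ∀ t ∈ Iic (0 : ℝ), HasDerivWithinAt
      (fun t => (γ t 2 - γ t 1) ^ 2 * Real.exp (c * t))
      (2 * (γ t 2 - γ t 1) * -(c * Real.sin (γ t 2 - γ t 1)) * Real.exp (c * t)
        + (γ t 2 - γ t 1) ^ 2 * (Real.exp (c * t) * c)) (Iic 0) t := by
    intro t ht
    have hcol := hX.collision _ (hγ t ht).1.2 (hz t ht)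
    have h1 := hasDeriv_coord hγ ht 1
    have h2 := hasDeriv_coord hγ ht 2
    rw [hcol] at h1 h2
    have h3 := ((h2.sub h1).pow 2).mul
      (by simpa using ((hasDerivAt_id t).const_mul c).exp.hasDerivWithinAt (s := Iic 0) :
        HasDerivWithinAt (fun t => Real.exp (c * t)) (Real.exp (c * t) * c) (Iic 0) t)
    refine h3.congr_deriv ?_
    simp
  have hanti : AntitoneOn (fun t => (γ t 2 - γ t 1) ^ 2 * Real.exp (c * t)) (Iic 0) := by
    refine antitoneOn_of_hasDerivWithinAt_nonpos (convex_Iic 0)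
      (fun t ht => (hd t ht).continuousWithinAt)
      (fun t ht => (hd t (interior_subset ht)).mono interior_subset) fun t ht => ?_
    have hb := (hγ t (interior_subset ht)).1.2.2.1
    set θ := γ t 2 - γ t 1
    have hθ1 : |θ| ≤ 1 := hb.le.trans hX.stiff.le_one
    have key := sq_le_two_mul_mul_sin hθ1
    have := Real.exp_pos (c * t)
    have hc := hX.c_pos
    have : 0 ≤ c * Real.exp (c * t) * (2 * (θ * Real.sin θ) - θ ^ 2) :=
      mul_nonneg (by positivity) (by linarith)
    linarith
  have hbd : ∀ t ∈ Iic (0 : ℝ), (γ 0 2 - γ 0 1) ^ 2 ≤ δ ^ 2 * Real.exp (c * t) := by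
    intro t ht
    have h1 := hanti ht self_mem_Iic ht
    simp only [mul_zero, Real.exp_zero, mul_one] at h1
    refine h1.trans ?_
    have hb := (hγ t ht).1.2.2.1
    gcongr ?_ * _
    exact sq_le_sq' (neg_le_of_abs_le hb.le) (le_of_abs_le hb.le)
  have hlim : Tendsto (fun t => δ ^ 2 * Real.exp (c * t)) atBot (𝓝 0) := by
    have h1 : Tendsto (fun t => c * t) atBot atBot := tendsto_id.const_mul_atBot hX.c_pos
    simpa using (Real.tendsto_exp_atBot.comp h1).const_mul (δ ^ 2)
  have h2 : (γ 0 2 - γ 0 1) ^ 2 ≤ 0 :=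
    ge_of_tendsto hlim ((eventually_le_atBot 0).mono fun t ht => hbd t ht)
  have h3 : γ 0 2 - γ 0 1 = 0 := by nlinarith
  linarith

end

end SaddleModel

theorem mem_box_iff {α δ x y z : ℝ} :
    ![x, y, z] ∈ box α δ ↔ |x| < δ ∧ |z - y| < δ ∧ |z - α| < δ := Iff.rfl

theorem hasDerivWithinAt_vec3 {f g k : ℝ → ℝ} {f' g' k' t : ℝ} {s : Set ℝ}
    (hf : HasDerivWithinAt f f' s t) (hg : HasDerivWithinAt g g' s t)
    (hk : HasDerivWithinAt k k' s t) :
    HasDerivWithinAt (fun t => ![f t, g t, k t]) ![f', g', k'] s t := by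
  rw [hasDerivWithinAt_pi]
  intro i
  fin_cases i
  exacts [hf, hg, hk]

theorem contDiffOn_vec3 {f g k : ℝ → ℝ} {s : Set ℝ} {n : WithTop ℕ∞} (hf : ContDiffOn ℝ n f s)
    (hg : ContDiffOn ℝ n g s) (hk : ContDiffOn ℝ n k s) :
    ContDiffOn ℝ n (fun t => ![f t, g t, k t]) s := by
  rw [contDiffOn_pi]
  intro i
  fin_cases i
  exacts [hf, hg, hk]

/-! ### The stable, centre and unstable sets. -/

namespace SaddleModel

variable {X : (Fin 3 → ℝ) → (Fin 3 → ℝ)} {M : Set (Fin 3 → ℝ)} {α : ℝ} {ρ : (Fin 3 → ℝ) → ℝ}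
  {G : ℝ → ℝ × ℝ → ℝ × ℝ} {c c₁ c₂ K δ : ℝ}

/-- A nonnegative nondecreasing r with limit 0 vanishes identically; then ψ is constant, hence equal
to its limit α. Conversely θ' = -c sin θ has explicit solutions that decrease in absolute value, so
they never leave the box. -/
theorem stableSet_eq (hX : SaddleModel X M α ρ G c c₁ c₂ K δ) :
    stableSet X M ![0, α, α] (box α δ) = (fun t => ![0, α + t, α]) '' Ioo (-δ) δ := by
  have hδ := hX.stiff.pos
  ext p
  constructor
  · rintro ⟨γ, rfl, hγ, hlim⟩
    have hcoord := tendsto_pi_nhds.1 hlim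
    have h0 : γ 0 0 = 0 := by
      refine le_antisymm ?_ (hX.nonneg hγ self_mem_Ici)
      refine ge_of_tendsto (hcoord 0) ((eventually_ge_atTop 0).mono fun t ht => ?_)
      exact hX.monotoneOn_radius hγ (convex_Ici 0) self_mem_Ici ht ht
    have hz : ∀ t ∈ Ici (0 : ℝ), γ t 0 = 0 := fun t ht =>
      hX.radius_eq_zero hγ (convex_Ici 0) self_mem_Ici ht ht h0
    have h2 : γ 0 2 = α := by
      refine tendsto_nhds_unique (tendsto_const_nhds.congr' ?_) (hcoord 2)
      exact (eventually_ge_atTop 0).mono fun t ht =>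
        hX.psi_eq hγ (convex_Ici 0) hz self_mem_Ici ht
    have hb := (hγ 0 self_mem_Ici).1.2.2.1
    rw [h2, abs_lt] at hb
    refine ⟨γ 0 1 - α, ⟨by linarith, by linarith⟩, ?_⟩
    ext i
    fin_cases i <;> simp [h0, h2]
  · rintro ⟨t, ht, rfl⟩
    have htδ : |t| < δ := abs_lt.2 ht
    have hδ1 := hX.stiff.le_one
    have hπ := Real.pi_gt_three
    have hc := hX.c_pos
    -- Half-angle solution: tan (θ / 2) decays like exp (-c s). The sign is due to θ = ψ - α, which
    -- starts at α - (α + t) = -t.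
    set u := Real.tan (-t / 2) with hu
    set θ : ℝ → ℝ := fun s => 2 * Real.arctan (u * Real.exp (-c * s)) with hθ
    have hθ0 : θ 0 = -t := by
      have h1 : -t / 2 ∈ Ioo (-(Real.pi / 2)) (Real.pi / 2) :=
        ⟨by linarith [ht.2], by linarith [ht.1]⟩
      simp only [hθ, mul_zero, Real.exp_zero, mul_one, hu, Real.arctan_tan h1.1 h1.2]
      ring
    have hθd : ∀ s, HasDerivAt θ (-(c * Real.sin (θ s))) s := fun s => by
      have h1 : HasDerivAt (fun s => u * Real.exp (-c * s)) (u * (Real.exp (-c * s) * -c)) s := by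
        simpa using (((hasDerivAt_id s).const_mul (-c)).exp.const_mul u)
      refine (h1.arctan.const_mul 2).congr_deriv ?_
      simp only [hθ, Real.sin_two_mul, Real.sin_arctan, Real.cos_arctan]
      set v := u * Real.exp (-c * s) with hv
      have h2 : 0 < 1 + v ^ 2 := by positivity
      have h3 := Real.mul_self_sqrt h2.le
      rw [show u * (Real.exp (-c * s) * -c) = -c * v by rw [hv]; ring,
        show 2 * (v / √(1 + v ^ 2)) * (1 / √(1 + v ^ 2)) =
          2 * v / (√(1 + v ^ 2) * √(1 + v ^ 2)) by field_simp, h3]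
      field_simp
    have hθδ : ∀ s, 0 ≤ s → |θ s| < δ := fun s hs => by
      refine lt_of_le_of_lt ?_ htδ
      rw [← abs_neg t, ← hθ0]
      have h1 : Real.exp (-c * s) ≤ 1 := Real.exp_le_one_iff.2 (by nlinarith)
      have h2 := Real.exp_pos (-c * s)
      simp only [hθ, mul_zero, Real.exp_zero, mul_one, abs_mul, abs_two]
      gcongr 2 * ?_
      rcases le_total 0 u with h | h
      · rw [abs_of_nonneg (Real.arctan_nonneg.2 (by positivity)),
          abs_of_nonneg (Real.arctan_nonneg.2 h)]
        exact Real.arctan_strictMono.monotone (by nlinarith)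
      · have hneg : ∀ x : ℝ, x ≤ 0 → Real.arctan x ≤ 0 := fun x hx => by
          simpa using Real.arctan_strictMono.monotone hx
        rw [abs_of_nonpos (hneg _ (mul_nonpos_of_nonpos_of_nonneg h h2.le)),
          abs_of_nonpos (hneg _ h)]
        exact neg_le_neg (Real.arctan_strictMono.monotone (by nlinarith))
    have hθlim : Tendsto θ atTop (𝓝 0) := by
      have h1 : Tendsto (fun s => -c * s) atTop atBot :=
        tendsto_id.const_mul_atTop_of_neg (by linarith)
      have h2 := (Real.tendsto_exp_atBot.comp h1).const_mul u
      have h3 := ((Real.continuous_arctan.tendsto _).comp h2).const_mul 2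
      simpa [hθ] using h3
    refine ⟨fun s => ![0, α - θ s, α], by simp [hθ0], fun s hs => ?_, ?_⟩
    · have hbox : ![0, α - θ s, α] ∈ box α δ := by
        rw [mem_box_iff]; simpa [hδ] using hθδ s hs
      refine ⟨⟨(hX.mem_iff _ hbox).2 le_rfl, hbox⟩, ?_⟩
      rw [hX.collision _ hbox rfl]
      refine hasDerivWithinAt_vec3 (hasDerivWithinAt_const _ _ _) ?_ (hasDerivWithinAt_const _ _ _)
      refine ((hθd s).const_sub α).hasDerivWithinAt.congr_deriv ?_
      simp
    · rw [tendsto_pi_nhds]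
      intro i
      fin_cases i
      · exact tendsto_const_nhds
      · simpa using hθlim.const_sub α
      · exact tendsto_const_nhds

theorem apply_equilibrium (hX : SaddleModel X M α ρ G c c₁ c₂ K δ) {β : ℝ} (hβ : |β - α| < δ) :
    ![0, β, β] ∈ M ∩ box α δ ∧ X ![0, β, β] = 0 := by
  have hbox : ![0, β, β] ∈ box α δ := by
    rw [mem_box_iff]; simpa [hX.stiff.pos] using hβ
  refine ⟨⟨(hX.mem_iff _ hbox).2 le_rfl, hbox⟩, ?_⟩
  rw [hX.collision _ hbox rfl]
  ext i
  fin_cases i <;> simp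

theorem isSolution_const (hX : SaddleModel X M α ρ G c c₁ c₂ K δ) {β : ℝ} (hβ : |β - α| < δ)
    (T : Set ℝ) : IsSolution X (M ∩ box α δ) T fun _ => ![0, β, β] := fun t _ => by
  refine ⟨(hX.apply_equilibrium hβ).1, ?_⟩
  rw [(hX.apply_equilibrium hβ).2]
  exact hasDerivWithinAt_const _ _ _

/-- If r(0) > 0 then r grows forwards at least at a fixed rate and leaves the box; so r = 0, and
backward confinement leaves only the line of equilibria. -/
theorem centreSet_eq (hX : SaddleModel X M α ρ G c c₁ c₂ K δ) :
    centreSet X M (box α δ) = (fun t => ![0, α + t, α + t]) '' Ioo (-δ) δ := by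
  ext p
  constructor
  · rintro ⟨γ, rfl, hγ⟩
    have hγ' : ∀ T, IsSolution X (M ∩ box α δ) T γ := fun T t _ =>
      ⟨(hγ t (mem_univ t)).1, (hγ t (mem_univ t)).2.mono (subset_univ T)⟩
    have h0 : γ 0 0 = 0 := by
      refine le_antisymm (not_lt.1 fun hpos => ?_) (hX.nonneg hγ (mem_univ 0))
      have hc₁ := hX.c₁_pos
      -- r' ≥ k for t ≥ 0, so by time δ / k the radius would exceed δ.
      set k := c₁ * γ 0 0 ^ 3 with hk
      have hk0 : 0 < k := by positivity
      have hd : ∀ t ∈ Ici (0 : ℝ), HasDerivWithinAt (fun t => γ t 0 - k * t)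
          (γ t 0 ^ 3 * ρ (γ t) - k) (Ici 0) t := fun t ht =>
        ((hX.hasDeriv_radius (hγ' _) ht).sub
          ((hasDerivWithinAt_id t _).const_mul k)).congr_deriv (by simp)
      have hmono : MonotoneOn (fun t => γ t 0 - k * t) (Ici 0) := by
        refine monotoneOn_of_hasDerivWithinAt_nonneg (convex_Ici 0)
          (fun t ht => (hd t ht).continuousWithinAt)
          (fun t ht => (hd t (interior_subset ht)).mono interior_subset) fun t ht => ?_
        have ht' : t ∈ Ici (0 : ℝ) := interior_subset ht
        have h1 := hX.le_rho _ (hγ t (mem_univ t)).1.2 (hX.nonneg hγ (mem_univ t))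
        have h2 : γ 0 0 ≤ γ t 0 :=
          hX.monotoneOn_radius (hγ' _) (convex_Ici 0) self_mem_Ici ht' ht'
        have h4 : 0 ≤ γ t 0 ^ 3 := pow_nonneg (hX.nonneg hγ (mem_univ t)) 3
        have h3 : γ 0 0 ^ 3 * c₁ ≤ γ t 0 ^ 3 * ρ (γ t) := by gcongr
        rw [hk]; linarith
      have hT : (0 : ℝ) ≤ δ / k := div_nonneg hX.stiff.pos.le hk0.le
      have h1 := hmono self_mem_Ici hT hT
      have h2 := (abs_lt.1 (hγ (δ / k) (mem_univ _)).1.2.1).2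
      have h3 : k * (δ / k) = δ := by field_simp
      simp only [mul_zero, sub_zero, h3] at h1
      linarith
    have h1 := (hX.eq_of_radius_eq_zero (hγ' _) h0).2
    have hb := (hγ 0 (mem_univ 0)).1.2.2.2
    rw [abs_lt] at hb
    refine ⟨γ 0 2 - α, ⟨hb.1, hb.2⟩, ?_⟩
    ext i
    fin_cases i <;> simp [h0, h1]
  · rintro ⟨t, ht, rfl⟩
    exact ⟨_, rfl, hX.isSolution_const (by simpa using abs_lt.2 ht) univ⟩

/-- Backward orbits that start with r > 0 lie on the graph of Y by the one-sided bound, and the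
graph is filled by backward orbits obtained from the scalar equation for r. With r = 0 only the
equilibrium itself tends to the point backwards. -/
theorem unstableSet_eq (hX : SaddleModel X M α ρ G c c₁ c₂ K δ) {Y : ℝ → ℝ × ℝ}
    (hY0 : Y 0 = (0, α)) (hYc : ContinuousAt Y 0)
    (hYd : ∀ r ∈ Ioo 0 δ, HasDerivAt Y ((r ^ 3)⁻¹ • G r (Y r)) r)
    (hYb : ∀ r ∈ Ico 0 δ, ‖Y r - (0, α)‖ < δ) :
    unstableSet X M ![0, α, α] (box α δ) =
      (fun r => ![r, (Y r).2 - (Y r).1, (Y r).2]) '' Ico 0 δ := by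
  have hδ := hX.stiff.pos
  have hα : |α - α| < δ := by simpa using hδ
  ext p
  constructor
  · rintro ⟨γ, rfl, hγ, hlim⟩
    have hcoord := tendsto_pi_nhds.1 hlim
    have hr0 := hX.nonneg hγ self_mem_Iic
    have hrδ := (abs_lt.1 (hγ 0 self_mem_Iic).1.2.1).2
    rcases hr0.eq_or_lt with h0 | hpos
    · obtain ⟨hz, h21⟩ := hX.eq_of_radius_eq_zero hγ h0.symm
      have h2 : γ 0 2 = α := by
        refine tendsto_nhds_unique (tendsto_const_nhds.congr' ?_) (hcoord 2)
        exact (eventually_le_atBot 0).mono fun t ht =>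
          hX.psi_eq hγ (convex_Iic 0) hz self_mem_Iic ht
      refine ⟨0, ⟨le_rfl, hδ⟩, ?_⟩
      ext i
      fin_cases i <;> simp [hY0, ← h0, ← h21, h2]
    · have hrpos : ∀ t ∈ Iic (0 : ℝ), 0 < γ t 0 := fun t ht =>
        lt_of_le_of_ne (hX.nonneg hγ ht) fun h =>
          hpos.ne' (hX.radius_eq_zero hγ (convex_Iic 0) ht self_mem_Iic ht h.symm)
      have hmem : ∀ t ∈ Iic (0 : ℝ), γ t 0 ∈ Ioo 0 δ := fun t ht =>
        ⟨hrpos t ht, (abs_lt.1 (hγ t ht).1.2.1).2⟩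
      set Z : ℝ → ℝ × ℝ := fun t => (γ t 2 - γ t 1, γ t 2) with hZ
      have hZd : ∀ t ∈ Iic (0 : ℝ), HasDerivWithinAt Z (ρ (γ t) • G (γ t 0) (Z t)) (Iic 0) t := by
        intro t ht
        have h1 := hasDeriv_coord hγ ht 1
        have h2 := hasDeriv_coord hγ ht 2
        refine ((h2.sub h1).prodMk h2).congr_deriv ?_
        rw [hX.fst _ (hγ t ht).1.2 (hrpos t ht), hX.snd _ (hγ t ht).1.2 (hrpos t ht)]
        rfl
      have hYr : ∀ t ∈ Iic (0 : ℝ), HasDerivWithinAt (fun t => Y (γ t 0))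
          (ρ (γ t) • G (γ t 0) (Y (γ t 0))) (Iic 0) t := by
        intro t ht
        have hne := (hrpos t ht).ne'
        refine ((hYd _ (hmem t ht)).scomp_hasDerivWithinAt t
          (hX.hasDeriv_radius hγ ht)).congr_deriv ?_
        rw [smul_smul]
        congr 1
        field_simp
      set L := K ^ 2 + 2 * K with hL
      have hexp : ∀ t ∈ Iic (0 : ℝ), HasDerivWithinAt (fun t => Real.exp (-(2 * L) * γ t 0))
          (Real.exp (-(2 * L) * γ t 0) * (-(2 * L) * (γ t 0 ^ 3 * ρ (γ t)))) (Iic 0) t :=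
        fun t ht => ((hX.hasDeriv_radius hγ ht).const_mul (-(2 * L))).exp
      have hWd := fun t (ht : t ∈ Iic (0 : ℝ)) =>
        (HasDerivWithinAt.sqNorm ((hZd t ht).sub (hYr t ht))).mul (hexp t ht)
      -- Both Z and Y along the radius solve the same equation after the time change r' = r³ρ, so
      -- the squared distance grows at a rate of at most 2 L r'. The weight is an exponential in r,
      -- not in t, so it stays bounded as t → -∞, where the distance tends to 0; hence the distance
      -- is 0.
      have hanti : AntitoneOn (fun t => sqNorm (Z t - Y (γ t 0)) *
          Real.exp (-(2 * L) * γ t 0)) (Iic 0) := by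
        refine antitoneOn_of_hasDerivWithinAt_nonpos (convex_Iic 0)
          (fun t ht => (hWd t ht).continuousWithinAt)
          (fun t ht => (hWd t (interior_subset ht)).mono interior_subset) fun t ht => ?_
        have ht' : t ∈ Iic (0 : ℝ) := interior_subset ht
        have hb := (hγ t ht').1.2
        have hr := hmem t ht'
        have h1 := hX.stiff.one_sided ⟨hr.1, hr.2.le⟩ (Y := Z t) (Z := Y (γ t 0))
          (by
            rw [Prod.norm_def]
            simpa [hZ] using ⟨hb.2.1.le, hb.2.2.le⟩)
          (hYb _ ⟨hr.1.le, hr.2⟩).le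
        have h2 := hX.rho_pos hγ ht'
        have hr3 : 0 < γ t 0 ^ 3 := pow_pos hr.1 3
        have hne : γ t 0 ≠ 0 := hr.1.ne'
        have h3 : dotProd (Z t - Y (γ t 0)) (ρ (γ t) • G (γ t 0) (Z t) -
            ρ (γ t) • G (γ t 0) (Y (γ t 0))) = γ t 0 ^ 3 * ρ (γ t) *
            dotProd (Z t - Y (γ t 0)) ((γ t 0 ^ 3)⁻¹ • G (γ t 0) (Z t) -
              (γ t 0 ^ 3)⁻¹ • G (γ t 0) (Y (γ t 0))) := by
          simp only [dotProd, Prod.fst_sub, Prod.snd_sub, Prod.smul_fst, Prod.smul_snd, smul_eq_mul]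
          field_simp
        have h4 := mul_le_mul_of_nonneg_left h1 (mul_pos hr3 h2).le
        rw [← h3] at h4
        have h5 := Real.exp_pos (-(2 * L) * γ t 0)
        simp only [Pi.sub_apply]
        nlinarith [mul_le_mul_of_nonneg_right h4 h5.le]
      have hlimW : Tendsto (fun t => sqNorm (Z t - Y (γ t 0)) * Real.exp (-(2 * L) * γ t 0)) atBot
          (𝓝 0) := by
        have hr : Tendsto (fun t => γ t 0) atBot (𝓝 0) := hcoord 0
        have h1 : Tendsto (fun t => Y (γ t 0)) atBot (𝓝 (0, α)) := by
          have := hYc.tendsto.comp hr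
          rwa [hY0] at this
        have h2 : Tendsto Z atBot (𝓝 (0, α)) := by
          have := ((hcoord 2).sub (hcoord 1)).prodMk_nhds (hcoord 2)
          simpa using this
        have hcont : Continuous sqNorm := by unfold sqNorm; fun_prop
        have h3 := (hcont.tendsto _).comp (h2.sub h1)
        have h4 := (Real.continuous_exp.tendsto _).comp (hr.const_mul (-(2 * L)))
        simpa [sqNorm] using h3.mul h4
      have h0 : sqNorm (Z 0 - Y (γ 0 0)) * Real.exp (-(2 * L) * γ 0 0) ≤ 0 :=
        ge_of_tendsto hlimW ((eventually_le_atBot 0).mono fun t ht => hanti ht self_mem_Iic ht)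
      have h1 := nonpos_of_mul_nonpos_left h0 (Real.exp_pos _)
      have h2 : Z 0 - Y (γ 0 0) = 0 := by
        have := (sq_norm_le_sqNorm _).trans h1
        rw [← norm_eq_zero]
        nlinarith [norm_nonneg (Z 0 - Y (γ 0 0))]
      have h3 : Y (γ 0 0) = Z 0 := (sub_eq_zero.1 h2).symm
      refine ⟨γ 0 0, ⟨hr0, hrδ⟩, ?_⟩
      ext i
      fin_cases i <;> simp [h3, hZ]
  · rintro ⟨r₀, hr₀, rfl⟩
    rcases hr₀.1.eq_or_lt with rfl | hpos
    · refine ⟨fun _ => ![0, α, α], by simp [hY0], hX.isSolution_const hα _, tendsto_const_nhds⟩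
    set q : ℝ → Fin 3 → ℝ := fun r => ![r, (Y r).2 - (Y r).1, (Y r).2] with hq
    have hqbox : ∀ r ∈ Ico 0 δ, q r ∈ box α δ := fun r hr => by
      have h := hYb r hr
      rw [Prod.norm_def, max_lt_iff] at h
      simp only [hq]
      rw [mem_box_iff]
      refine ⟨abs_lt.2 ⟨by linarith [hr.1], hr.2⟩, ?_, h.2⟩
      simpa using h.1
    have hsub : ∀ r ∈ Ioc 0 r₀, r ∈ Ioo 0 δ := fun r hr => ⟨hr.1, hr.2.trans_lt hr₀.2⟩
    have hqbox' : ∀ r ∈ Ioc 0 r₀, q r ∈ box α δ := fun r hr =>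
      hqbox r (Ioo_subset_Ico_self (hsub r hr))
    have hqcont : ContinuousOn q (Ioc 0 r₀) := by
      intro r hr
      have h := (hYd r (hsub r hr)).continuousAt
      refine ContinuousAt.continuousWithinAt (continuousAt_pi.2 fun i => ?_)
      fin_cases i
      exacts [continuousAt_id, h.snd.sub h.fst, h.snd]
    obtain ⟨u, hu0, hu1, hu2, hu3⟩ := exists_backward_solution_cube (P := fun r => ρ (q r)) hpos
      hX.c₁_pos (hX.rho_cont.comp hqcont hqbox')
      (fun r hr => hX.le_rho _ (hqbox' r hr) hr.1.le)
      (fun r hr => hX.rho_le _ (hqbox' r hr) hr.1.le)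
    refine ⟨fun t => q (u t), by simp [hu0, hq], fun t ht => ?_, ?_⟩
    · have hb := hqbox' _ (hu1 t ht)
      have hup : 0 < u t := (hu1 t ht).1
      refine ⟨⟨(hX.mem_iff _ hb).2 hup.le, hb⟩, ?_⟩
      have h0 := hu2 t ht
      have hYu : HasDerivAt (fun t => Y (u t)) (ρ (q (u t)) • G (u t) (Y (u t))) t := by
        refine ((hYd _ (hsub _ (hu1 t ht))).scomp t h0).congr_deriv ?_
        rw [smul_smul]
        congr 1
        field_simp
      have hY1 : HasDerivAt (fun t => (Y (u t)).1) (ρ (q (u t)) * (G (u t) (Y (u t))).1) t :=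
        (hasDerivAt_iff_hasFDerivAt.1 hYu).fst.hasDerivAt.congr_deriv (by simp)
      have hY2 : HasDerivAt (fun t => (Y (u t)).2) (ρ (q (u t)) * (G (u t) (Y (u t))).2) t :=
        (hasDerivAt_iff_hasFDerivAt.1 hYu).snd.hasDerivAt.congr_deriv (by simp)
      have e0 : X (q (u t)) 0 = u t ^ 3 * ρ (q (u t)) := hX.apply_zero _ hb hup.le
      have e1 := hX.fst _ hb hup
      have e2 := hX.snd _ hb hup
      have eY : ((q (u t)) 2 - (q (u t)) 1, (q (u t)) 2) = Y (u t) := by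
        simp [hq]
      have eq0 : q (u t) 0 = u t := rfl
      rw [eY, eq0] at e1 e2
      rw [hasDerivWithinAt_pi]
      intro i
      refine HasDerivAt.hasDerivWithinAt ?_
      fin_cases i
      · exact h0.congr_deriv e0.symm
      · refine (hY2.sub hY1).congr_deriv ?_
        change _ = X (q (u t)) 1
        linarith
      · exact hY2.congr_deriv e2.symm
    · have h1 : Tendsto (fun t => Y (u t)) atBot (𝓝 (0, α)) := by
        have := hYc.tendsto.comp hu3
        rwa [hY0] at this
      have h2 : Tendsto (fun t => (Y (u t)).2) atBot (𝓝 α) := h1.snd_nhds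
      have h3 : Tendsto (fun t => (Y (u t)).1) atBot (𝓝 0) := h1.fst_nhds
      rw [tendsto_pi_nhds]
      intro i
      fin_cases i
      · exact hu3
      · simpa [hq] using h2.sub h3
      · exact h2

theorem exists_arcs (hX : SaddleModel X M α ρ G c c₁ c₂ K δ) {V : Set (Fin 3 → ℝ)}
    (hV : V ∈ 𝓝 ![0, α, α]) :
    ∃ U ⊆ V, IsOpen U ∧ ![0, α, α] ∈ U ∧
      IsCurveThrough (stableSet X M ![0, α, α] U) ![0, α, α] ![0, 1, 0] ∧
      IsCurveFrom (unstableSet X M ![0, α, α] U) ![0, α, α] ![1, 0, 0] ∧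
      IsCurveThrough (centreSet X M U) ![0, α, α] ![0, 1, 1] := by
  obtain ⟨Y, δ₁, D, hδ₁, hδ₁δ, hD, hY0, hYd, -, hYD, hY0d, hYC⟩ := hX.stiff.exists_solution
  obtain ⟨δ₂, hδ₂, hboxV⟩ := exists_box_subset α hV
  -- The condition d (D + 1) ≤ 1 gives D r⁴ ≤ D d² < d, so the graph of Y over all of [0, d) lies in
  -- the box of size d.
  set d := min (min δ₁ δ₂) (D + 1)⁻¹ with hd
  have hd0 : 0 < d := lt_min (lt_min hδ₁ hδ₂) (by positivity)
  have hd1 : d ≤ δ₁ := (min_le_left _ _).trans (min_le_left _ _)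
  have hd2 : d ≤ δ₂ := (min_le_left _ _).trans (min_le_right _ _)
  have hdD : d * (D + 1) ≤ 1 := by
    have : d ≤ (D + 1)⁻¹ := min_le_right _ _
    calc _ ≤ (D + 1)⁻¹ * (D + 1) := by gcongr
      _ = 1 := by field_simp
  have hXd := hX.mono hd0 (hd1.trans hδ₁δ)
  have hdle1 := hXd.stiff.le_one
  have hYb : ∀ r ∈ Ico 0 d, ‖Y r - (0, α)‖ < d := by
    intro r hr
    refine (hYD r ⟨hr.1, hr.2.trans_le hd1⟩).trans_lt ?_
    have h1 : r ^ 4 ≤ d ^ 2 := by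
      calc r ^ 4 ≤ d ^ 4 := pow_le_pow_left₀ hr.1 hr.2.le 4
        _ ≤ d ^ 2 := pow_le_pow_of_le_one hd0.le hdle1 (by norm_num)
    have h2 : D * r ^ 4 ≤ D * d ^ 2 := by gcongr
    nlinarith
  have hI : (0 : ℝ) ∈ Ioo (-d) d := ⟨by linarith, hd0⟩
  have hlin : ∀ k : ℝ, HasDerivWithinAt (fun t => k + t) 1 (Ioo (-d) d) 0 := fun k =>
    (hasDerivWithinAt_id _ _).const_add k
  have hlinC : ∀ k : ℝ, ContDiffOn ℝ 1 (fun t => k + t) (Ioo (-d) d) := fun k => by fun_prop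
  refine ⟨box α d, hboxV d hd2, isOpen_box α d, ?_, ⟨d, hd0, ?_⟩, ⟨d, hd0, ?_⟩, ⟨d, hd0, ?_⟩⟩
  · rw [mem_box_iff]; simp [hd0]
  · exact isArc_of_linear_section (uniqueDiffOn_Ioo _ _) hI
      (contDiffOn_vec3 contDiffOn_const (hlinC α) contDiffOn_const)
      (ContinuousLinearMap.proj (R := ℝ) (φ := fun _ : Fin 3 => ℝ) 1) α
      (fun t => by simp [add_comm]) hXd.stableSet_eq.symm (by simp)
      (hasDerivWithinAt_vec3 (hasDerivWithinAt_const _ _ _) (hlin α) (hasDerivWithinAt_const _ _ _))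
  · have hYC' : ContDiffOn ℝ 1 Y (Ico 0 d) := hYC.mono fun r hr => hr.2.trans_le hd1
    have hY1 : HasDerivWithinAt (fun r => (Y r).1) 0 (Ico 0 d) 0 :=
      (hasDerivAt_iff_hasFDerivAt.1 hY0d).fst.hasDerivAt.hasDerivWithinAt.congr_deriv (by simp)
    have hY2 : HasDerivWithinAt (fun r => (Y r).2) 0 (Ico 0 d) 0 :=
      (hasDerivAt_iff_hasFDerivAt.1 hY0d).snd.hasDerivAt.hasDerivWithinAt.congr_deriv (by simp)
    refine isArc_of_linear_section (uniqueDiffOn_Ico _ _) ⟨le_rfl, hd0⟩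
      (contDiffOn_vec3 contDiffOn_id (hYC'.snd.sub hYC'.fst) hYC'.snd)
      (ContinuousLinearMap.proj (R := ℝ) (φ := fun _ : Fin 3 => ℝ) 0) 0
      (fun t => by simp) (hXd.unstableSet_eq (hY0 0 le_rfl) hY0d.continuousAt
        (fun r hr => hYd r ⟨hr.1, hr.2.trans_le hd1⟩) hYb).symm (by simp [hY0 0 le_rfl]) ?_
    have := hasDerivWithinAt_vec3 (hasDerivWithinAt_id (0 : ℝ) _) (hY2.sub hY1) hY2
    simpa using this
  · exact isArc_of_linear_section (uniqueDiffOn_Ioo _ _) hI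
      (contDiffOn_vec3 contDiffOn_const (hlinC α) (hlinC α))
      (ContinuousLinearMap.proj (R := ℝ) (φ := fun _ : Fin 3 => ℝ) 1) α
      (fun t => by simp [add_comm]) hXd.centreSet_eq.symm (by simp)
      (hasDerivWithinAt_vec3 (hasDerivWithinAt_const _ _ _) (hlin α) (hlin α))

end SaddleModel

/-! ### The local model of the regularised field -/

section

variable (R Γ h : ℝ)

/-- The coordinates `φ₁(r)`, `(r, r² log r)`, `(ψ - α, ψ)`. -/
def chart (p : Fin 3 → ℝ) : ℝ × (ℝ × ℝ) × (ℝ × ℝ) :=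
  ((radial (p 0)).1, (radial (p 0)).2, (p 2 - p 1, p 2))

def chartK (v : ℝ × (ℝ × ℝ) × (ℝ × ℝ)) : ℝ :=
  smK R Γ h v.1 v.2.1.1 v.2.1.2 (v.2.2.2 - v.2.2.1)

def chartT (v : ℝ × (ℝ × ℝ) × (ℝ × ℝ)) : ℝ := smT R v.1 (v.2.2.2 - v.2.2.1) v.2.2.2

def chartB (v : ℝ × (ℝ × ℝ) × (ℝ × ℝ)) : ℝ :=
  smB R Γ h v.1 v.2.1.1 v.2.1.2 (v.2.2.2 - v.2.2.1) v.2.2.2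

/-- The radial velocity divided by `r³`. -/
def chartRho (v : ℝ × (ℝ × ℝ) × (ℝ × ℝ)) : ℝ :=
  2 / (2 + v.2.1.1 ^ 2) * chartK R Γ h v * smS R v.1 (v.2.2.2 - v.2.2.1) v.2.2.2

/-- The derivative of `(ψ - α, ψ)` with respect to `r`, multiplied by `r³`. -/
def chartG (v : ℝ × (ℝ × ℝ) × (ℝ × ℝ)) : ℝ × ℝ :=
  ((chartB R Γ h v - chartK R Γ h v * chartT R v) / chartRho R Γ h v,
    chartB R Γ h v / chartRho R Γ h v)

end

/-! ### The charted field at φ = 0, its smoothness and its linearisation. -/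

section

variable {R Γ h : ℝ}

theorem smD_zero (R α : ℝ) : smD R 0 α = 8 * R ^ 2 := by simp [smD]

theorem smQ_zero (R α : ℝ) : smQ R 0 α = 4 * R ^ 2 := by simp [smQ]

theorem smA_zero (hR : 0 < R) (α : ℝ) : smA R 0 α = 1 := by
  rw [smA, smD_zero, smQ_zero, show 4 * R ^ 2 = (2 * R) ^ 2 by ring, Real.sqrt_sq (by linarith)]
  field_simp
  norm_num

theorem smA'_zero (R α : ℝ) : smA' R 0 α = 0 := by simp [smA', smQ_zero]

theorem smS_zero (hR : 0 < R) (α ψ : ℝ) : smS R 0 α ψ = Real.cos (ψ - α) := by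
  rw [smS, smA_zero hR, Real.cos_sub]; ring

theorem smT_zero (hR : 0 < R) (α ψ : ℝ) : smT R 0 α ψ = Real.sin (ψ - α) := by
  rw [smT, smA_zero hR, Real.sin_sub]; ring

theorem smB_zero (hR : 0 < R) (r w α ψ : ℝ) :
    smB R Γ h 0 r w α ψ = Γ / (4 * Real.pi) * r ^ 2 * Real.sin (ψ - α) := by
  rw [smB, smA_zero hR, smA'_zero, Real.sin_sub]
  simp
  ring

/-- The value of `chartK` at `φ = 0`. -/
def chartK₀ (R Γ h : ℝ) (z : ℝ × ℝ) : ℝ :=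
  Γ / (4 * Real.pi) + z.1 ^ 2 * (h - Γ / (8 * Real.pi) * Real.log (2 * R ^ 2 / (8 * R ^ 2)))
    - Γ / (4 * Real.pi) * z.2

theorem chartK_zero (z Y : ℝ × ℝ) : chartK R Γ h (0, z, Y) = chartK₀ R Γ h z := by
  simp only [chartK, smK, smD_zero, chartK₀]

theorem chartT_zero (hR : 0 < R) (z Y : ℝ × ℝ) : chartT R (0, z, Y) = Real.sin Y.1 := by
  simp only [chartT, smT_zero hR, sub_sub_cancel]

theorem chartB_zero (hR : 0 < R) (z Y : ℝ × ℝ) :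
    chartB R Γ h (0, z, Y) = Γ / (4 * Real.pi) * z.1 ^ 2 * Real.sin Y.1 := by
  simp only [chartB, smB_zero hR, sub_sub_cancel]

theorem chartRho_zero (hR : 0 < R) (z Y : ℝ × ℝ) :
    chartRho R Γ h (0, z, Y) = 2 / (2 + z.1 ^ 2) * chartK₀ R Γ h z * Real.cos Y.1 := by
  simp only [chartRho, chartK_zero, smS_zero hR, sub_sub_cancel]

/-- At φ = 0 the angles enter only through tan θ: the cosine comes from the radial velocity, the
sine from both angular equations. This is the form demanded by `exists_stiffField`, and the first
coefficient equals -1 at z = 0. -/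
theorem chartG_zero (hR : 0 < R) (z Y : ℝ × ℝ) :
    chartG R Γ h (0, z, Y) =
      (-((chartK₀ R Γ h z - Γ / (4 * Real.pi) * z.1 ^ 2) * (2 + z.1 ^ 2) /
          (2 * chartK₀ R Γ h z) * Real.tan Y.1),
        Γ / (4 * Real.pi) * (2 + z.1 ^ 2) / (2 * chartK₀ R Γ h z) * z.1 ^ 2 * Real.tan Y.1) := by
  have h2 : (2 + z.1 ^ 2) ≠ 0 := by positivity
  simp only [chartG, chartB_zero hR, chartT_zero hR, chartK_zero, chartRho_zero hR,
    Real.tan_eq_sin_div_cos, Prod.mk.injEq, div_eq_mul_inv, mul_inv, inv_inv]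
  constructor <;> ring

theorem chartK₀_zero : chartK₀ R Γ h 0 = Γ / (4 * Real.pi) := by simp [chartK₀]

theorem chart_base (α : ℝ) : chart ![0, α, α] = (0, 0, (0, α)) := by
  simp [chart, radial, phi1_zero]

/-- φ, r and w are independent variables here, so the limited smoothness of r² log r plays no part.
-/
theorem contDiffAt_chart (hR : 0 < R) (α : ℝ) :
    ContDiffAt ℝ 2 (chartK R Γ h) (0, 0, (0, α)) ∧ ContDiffAt ℝ 2 (chartT R) (0, 0, (0, α)) ∧
    ContDiffAt ℝ 2 (chartB R Γ h) (0, 0, (0, α)) ∧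
    ContDiffAt ℝ 2 (chartRho R Γ h) (0, 0, (0, α)) := by
  set v₀ : ℝ × (ℝ × ℝ) × (ℝ × ℝ) := (0, 0, (0, α)) with hv₀
  have hφ : ContDiffAt ℝ 2 (fun v : ℝ × (ℝ × ℝ) × (ℝ × ℝ) => v.1) v₀ := by fun_prop
  have hr : ContDiffAt ℝ 2 (fun v : ℝ × (ℝ × ℝ) × (ℝ × ℝ) => v.2.1.1) v₀ := by fun_prop
  have hw : ContDiffAt ℝ 2 (fun v : ℝ × (ℝ × ℝ) × (ℝ × ℝ) => v.2.1.2) v₀ := by fun_prop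
  have hψ : ContDiffAt ℝ 2 (fun v : ℝ × (ℝ × ℝ) × (ℝ × ℝ) => v.2.2.2) v₀ := by fun_prop
  have hα : ContDiffAt ℝ 2 (fun v : ℝ × (ℝ × ℝ) × (ℝ × ℝ) => v.2.2.2 - v.2.2.1) v₀ := by fun_prop
  have hsα := hα.sin
  have hcα := hα.cos
  have hsψ := hψ.sin
  have hcψ := hψ.cos
  have hD : ContDiffAt ℝ 2 (fun v : ℝ × (ℝ × ℝ) × (ℝ × ℝ) => smD R v.1 (v.2.2.2 - v.2.2.1)) v₀ :=
    (contDiffAt_const.add (hφ.pow 2)).add ((contDiffAt_const.mul hφ).mul hsα)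
  have hQ : ContDiffAt ℝ 2 (fun v : ℝ × (ℝ × ℝ) × (ℝ × ℝ) => smQ R v.1 (v.2.2.2 - v.2.2.1)) v₀ :=
    (contDiffAt_const.add (hφ.pow 2)).add ((contDiffAt_const.mul hφ).mul hsα)
  have hD0 : smD R v₀.1 (v₀.2.2.2 - v₀.2.2.1) ≠ 0 := (smD_pos hR _ _).ne'
  have hQ0 : 0 < smQ R v₀.1 (v₀.2.2.2 - v₀.2.2.1) := by
    rw [show v₀.1 = 0 from rfl, smQ_zero]; positivity
  have hsQ := hQ.sqrt hQ0.ne'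
  have hsQ0 := Real.sqrt_pos.2 hQ0
  have hA : ContDiffAt ℝ 2 (fun v : ℝ × (ℝ × ℝ) × (ℝ × ℝ) => smA R v.1 (v.2.2.2 - v.2.2.1)) v₀ :=
    hD.div (contDiffAt_const.mul hsQ) (by positivity)
  have hA0 : smA R v₀.1 (v₀.2.2.2 - v₀.2.2.1) ≠ 0 := by
    rw [show v₀.1 = 0 from rfl, smA_zero hR]; exact one_ne_zero
  have hA' : ContDiffAt ℝ 2 (fun v : ℝ × (ℝ × ℝ) × (ℝ × ℝ) => smA' R v.1 (v.2.2.2 - v.2.2.1))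
      v₀ :=
    (hQ.sub contDiffAt_const).div ((contDiffAt_const.mul hQ).mul hsQ) (by positivity)
  have hlog : ContDiffAt ℝ 2 (fun v : ℝ × (ℝ × ℝ) × (ℝ × ℝ) =>
      Real.log (2 * R ^ 2 / smD R v.1 (v.2.2.2 - v.2.2.1))) v₀ :=
    (contDiffAt_const.div hD hD0).log (div_ne_zero (by positivity) hD0)
  have hK : ContDiffAt ℝ 2 (chartK R Γ h) v₀ :=
    (contDiffAt_const.add ((hr.pow 2).mul (contDiffAt_const.sub (contDiffAt_const.mul hlog)))).sub
      (contDiffAt_const.mul hw)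
  have hS : ContDiffAt ℝ 2 (fun v : ℝ × (ℝ × ℝ) × (ℝ × ℝ) =>
      smS R v.1 (v.2.2.2 - v.2.2.1) v.2.2.2) v₀ :=
    ((hA.mul hcψ).mul hcα).add (hsψ.mul hsα)
  have hT : ContDiffAt ℝ 2 (chartT R) v₀ := (hsψ.mul hcα).sub ((hA.mul hcψ).mul hsα)
  have hw2 : ContDiffAt ℝ 2 (fun v : ℝ × (ℝ × ℝ) × (ℝ × ℝ) =>
      2 * Real.cos v.2.2.2 ^ 2 / smQ R v.1 (v.2.2.2 - v.2.2.1) +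
        4 * Real.sin v.2.2.2 ^ 2 / smD R v.1 (v.2.2.2 - v.2.2.1)) v₀ :=
    ((contDiffAt_const.mul (hcψ.pow 2)).div hQ hQ0.ne').add
      ((contDiffAt_const.mul (hsψ.pow 2)).div hD hD0)
  have hx := hφ.mul hcα
  have hy : ContDiffAt ℝ 2 (fun v : ℝ × (ℝ × ℝ) × (ℝ × ℝ) =>
      v.1 * Real.sin (v.2.2.2 - v.2.2.1) + 2 * R) v₀ := (hφ.mul hsα).add contDiffAt_const
  have hB : ContDiffAt ℝ 2 (chartB R Γ h) v₀ := by
    refine ContDiffAt.sub (ContDiffAt.add (ContDiffAt.neg (ContDiffAt.mul (hA.mul hsψ)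
      (ContDiffAt.sub (((hφ.mul hK).mul hx).mul hw2) ?_)))
      (ContDiffAt.mul hcψ (ContDiffAt.sub (((hφ.mul hK).mul hy).mul hw2) ?_))) ?_
    · exact (contDiffAt_const.mul (hr.pow 2)).mul (hcα.sub ((hφ.mul hx).div hD hD0))
    · exact (contDiffAt_const.mul (hr.pow 2)).mul (hsα.sub ((hφ.mul hy).div hD hD0))
    · refine ContDiffAt.div ?_ hA hA0
      refine ContDiffAt.mul ((((hsψ.mul hcψ).mul hK).mul hA').mul hφ) ?_
      exact ((contDiffAt_const.mul (hφ.add (contDiffAt_const.mul hsα))).mul hS).add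
        ((contDiffAt_const.mul hcα).mul hT)
  refine ⟨hK, hT, hB, ?_⟩
  exact ((contDiffAt_const.div (contDiffAt_const.add (hr.pow 2)) (by positivity)).mul hK).mul hS

theorem chartRho_base (hR : 0 < R) (α : ℝ) :
    chartRho R Γ h (0, 0, (0, α)) = Γ / (4 * Real.pi) := by
  rw [chartRho_zero hR, chartK₀_zero]; simp

theorem field_eq_chart (hR : 0 < R) {p : Fin 3 → ℝ} (hr : 0 ≤ p 0) (hφR : phi1 (p 0) < 2 * R)
    (hK : 0 < chartK R Γ h (chart p)) :
    field R Γ h p = ![p 0 ^ 3 * chartRho R Γ h (chart p),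
      chartK R Γ h (chart p) * chartT R (chart p), chartB R Γ h (chart p)] := by
  have e : p 2 - (p 2 - p 1) = p 1 := by ring
  have hE : 0 < energy R Γ h (p 0) (p 1) := by
    simp only [chartK, chart, radial, e] at hK
    rw [← energy_mul_l hR hr] at hK
    exact pos_of_mul_pos_left hK (l_pos hR _ _).le
  rw [field_eq hR hr hφR hE]
  simp only [chartRho, chartK, chartT, chartB, chart, radial, e]
  congr 1
  ring

theorem mem_phaseSpace (hR : 0 < R) {p : Fin 3 → ℝ} (hr : 0 ≤ p 0) (hφR : phi1 (p 0) < 2 * R)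
    (hK : 0 < chartK R Γ h (chart p)) : p ∈ phaseSpace R Γ h := by
  have e : p 2 - (p 2 - p 1) = p 1 := by ring
  simp only [chartK, chart, radial, e] at hK
  rw [← energy_mul_l hR hr] at hK
  refine ⟨hr, pos_of_mul_pos_left hK (l_pos hR _ _).le, fun ⟨hx, hy⟩ => ?_⟩
  have h1 := smQ_pos (phi1_nonneg hr) hφR (p 1)
  rw [← xCoord_sq_add_yCoord_sq, hx, hy] at h1
  norm_num at h1

theorem continuous_chart : Continuous chart := by
  have h : ∀ i, Continuous fun p : Fin 3 → ℝ => p i := continuous_apply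
  have hrad := continuous_radial.comp (h 0)
  exact hrad.fst.prodMk (hrad.snd.prodMk (((h 2).sub (h 1)).prodMk (h 2)))

theorem exists_saddleModel (hR : 0 < R) (hΓ : 0 < Γ) (α : ℝ) :
    ∃ ρ G c₁ c₂ K δ, SaddleModel (field R Γ h) (phaseSpace R Γ h) α ρ G (Γ / (4 * Real.pi))
      c₁ c₂ K δ := by
  set c := Γ / (4 * Real.pi) with hc
  have hc0 : 0 < c := by positivity
  obtain ⟨hK, hT, hB, hρ⟩ := contDiffAt_chart (h := h) hR α
  have hρ0 : chartRho R Γ h (0, 0, (0, α)) = c := chartRho_base hR α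
  have hG : ContDiffAt ℝ 2 (chartG R Γ h) (0, 0, (0, α)) :=
    ((hB.sub (hK.mul hT)).div hρ (by rw [hρ0]; exact hc0.ne')).prodMk
      (hB.div hρ (by rw [hρ0]; exact hc0.ne'))
  have hk₀ : Continuous (chartK₀ R Γ h) := by unfold chartK₀; fun_prop
  have hk₀0 : 2 * chartK₀ R Γ h 0 ≠ 0 := by rw [chartK₀_zero]; positivity
  obtain ⟨ε, η, K, hstiff⟩ := exists_stiffField
    (m₁ := fun z => (chartK₀ R Γ h z - c * z.1 ^ 2) * (2 + z.1 ^ 2) / (2 * chartK₀ R Γ h z))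
    (m₂ := fun z => c * (2 + z.1 ^ 2) / (2 * chartK₀ R Γ h z)) hG
    (ContinuousAt.div (by fun_prop) (by fun_prop) hk₀0)
    (ContinuousAt.div (by fun_prop) (by fun_prop) hk₀0)
    (by
      rw [div_eq_one_iff_eq hk₀0]
      simp [mul_comm]) (chartG_zero hR)
  have hbase : chart ![0, α, α] = (0, 0, (0, α)) := chart_base α
  -- ρ equals c at the base point, hence is pinched between c / 2 and 2 c nearby. Positivity of
  -- `chartK` is positivity of the energy, and v.1 < 2R excludes the origin, so near the base point
  -- the phase space is just r ≥ 0.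
  have hevv : ∀ᶠ v in 𝓝 ((0, 0, (0, α)) : ℝ × (ℝ × ℝ) × (ℝ × ℝ)),
      c / 2 < chartRho R Γ h v ∧ chartRho R Γ h v < 2 * c ∧ 0 < chartK R Γ h v ∧ v.1 < 2 * R ∧
        ContinuousAt (chartRho R Γ h) v := by
    have h1 := hρ.continuousAt.eventually
      (lt_mem_nhds (show c / 2 < chartRho R Γ h (0, 0, (0, α)) by rw [hρ0]; linarith))
    have h2 := hρ.continuousAt.eventually
      (gt_mem_nhds (show chartRho R Γ h (0, 0, (0, α)) < 2 * c by rw [hρ0]; linarith))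
    have h3 := hK.continuousAt.eventually
      (lt_mem_nhds (show 0 < chartK R Γ h (0, 0, (0, α)) by
        rw [chartK_zero, chartK₀_zero]; exact hc0))
    have h4 : ∀ᶠ v : ℝ × (ℝ × ℝ) × (ℝ × ℝ) in 𝓝 (0, 0, (0, α)), v.1 < 2 * R :=
      continuousAt_fst.eventually (gt_mem_nhds (by simpa using hR))
    have h5 := hρ.eventually (by simp)
    filter_upwards [h1, h2, h3, h4, h5] with v a1 a2 a3 a4 a5
    exact ⟨a1, a2, a3, a4, a5.continuousAt⟩
  rw [← hbase] at hevv
  obtain ⟨δ₁, hδ₁, hbox⟩ := exists_box_subset α (continuous_chart.continuousAt.eventually hevv)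
  set δ := min δ₁ (min ε η) with hδ
  have hδ0 : 0 < δ := lt_min hδ₁ (lt_min hstiff.pos hstiff.η_pos)
  have hb := hbox δ (min_le_left _ _)
  refine ⟨fun p => chartRho R Γ h (chart p),
    fun r Y => chartG R Γ h ((radial r).1, (radial r).2, Y), c / 2, 2 * c, K, δ, ?_⟩
  have hf : ∀ p ∈ box α δ, 0 ≤ p 0 → field R Γ h p = ![p 0 ^ 3 * chartRho R Γ h (chart p),
      chartK R Γ h (chart p) * chartT R (chart p), chartB R Γ h (chart p)] := fun p hp h0 =>
    field_eq_chart hR h0 (hb hp).2.2.2.1 (hb hp).2.2.1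
  have hρpos : ∀ p ∈ box α δ, chartRho R Γ h (chart p) ≠ 0 := fun p hp =>
    ((half_pos hc0).trans (hb hp).1).ne'
  exact
    { stiff := hstiff.mono hδ0 ((min_le_right _ _).trans (min_le_left _ _)) hδ0
        ((min_le_right _ _).trans (min_le_right _ _))
      c_pos := hc0
      c₁_pos := half_pos hc0
      mem_iff := fun p hp =>
        ⟨fun h => h.1, fun h0 => mem_phaseSpace hR h0 (hb hp).2.2.2.1 (hb hp).2.2.1⟩
      apply_zero := fun p hp h0 => by rw [hf p hp h0]; rfl
      le_rho := fun p hp _ => (hb hp).1.le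
      rho_le := fun p hp _ => (hb hp).2.1.le
      rho_cont := fun p hp => ((hb hp).2.2.2.2.comp (f := chart)
        continuous_chart.continuousAt).continuousWithinAt
      collision := fun p hp h0 => by
        have e : chart p = (0, 0, (p 2 - p 1, p 2)) := by simp [chart, h0, radial, phi1_zero]
        rw [hf p hp h0.ge, e, chartK_zero, chartT_zero hR, chartB_zero hR, chartK₀_zero, h0]
        simp [hc]
      fst := fun p hp h0 => by
        rw [hf p hp h0.le]
        exact (mul_div_cancel₀ _ (hρpos p hp)).symm
      snd := fun p hp h0 => by
        rw [hf p hp h0.le]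
        exact (mul_div_cancel₀ _ (hρpos p hp)).symm }

/-- The linear map `v ↦ (0, κ (v₂ - v₁), 0)`. -/
def saddleDeriv (κ : ℝ) : (Fin 3 → ℝ) →L[ℝ] (Fin 3 → ℝ) :=
  ContinuousLinearMap.pi ![0, κ • (ContinuousLinearMap.proj (R := ℝ) (φ := fun _ : Fin 3 => ℝ) 2
    - ContinuousLinearMap.proj (R := ℝ) (φ := fun _ : Fin 3 => ℝ) 1), 0]

theorem saddleDeriv_apply (κ : ℝ) (v : Fin 3 → ℝ) :
    saddleDeriv κ v = ![0, κ * (v 2 - v 1), 0] := by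
  ext i
  fin_cases i <;> simp [saddleDeriv]

/-- The derivative of `chart` on the collision manifold. -/
def chartDeriv : (Fin 3 → ℝ) →L[ℝ] ℝ × (ℝ × ℝ) × (ℝ × ℝ) :=
  (0 : (Fin 3 → ℝ) →L[ℝ] ℝ).prod
    (((ContinuousLinearMap.proj (R := ℝ) (φ := fun _ : Fin 3 => ℝ) 0).prod 0).prod
    ((ContinuousLinearMap.proj (R := ℝ) (φ := fun _ : Fin 3 => ℝ) 2
      - ContinuousLinearMap.proj (R := ℝ) (φ := fun _ : Fin 3 => ℝ) 1).prod
      (ContinuousLinearMap.proj (R := ℝ) (φ := fun _ : Fin 3 => ℝ) 2)))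

/-- Of the three radial functions only r itself has a nonzero derivative at 0. -/
theorem hasFDerivAt_chart (α : ℝ) : HasFDerivAt chart chartDeriv ![0, α, α] := by
  have hp : ∀ i, HasFDerivAt (fun p : Fin 3 → ℝ => p i)
      (ContinuousLinearMap.proj (R := ℝ) (φ := fun _ : Fin 3 => ℝ) i) ![0, α, α] := fun i =>
    (ContinuousLinearMap.proj (R := ℝ) (φ := fun _ : Fin 3 => ℝ) i).hasFDerivAt
  have h1 : HasFDerivAt (fun p : Fin 3 → ℝ => phi1 (p 0)) (0 : (Fin 3 → ℝ) →L[ℝ] ℝ)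
      ![0, α, α] := by
    have := HasDerivAt.comp_hasFDerivAt (h₂ := phi1) (h₂' := 0) ![0, α, α]
      hasDerivAt_phi1_zero (hp 0)
    exact this.congr_fderiv (by simp)
  have h2 : HasFDerivAt (fun p : Fin 3 → ℝ => p 0 ^ 2 * Real.log (p 0))
      (0 : (Fin 3 → ℝ) →L[ℝ] ℝ) ![0, α, α] := by
    have := HasDerivAt.comp_hasFDerivAt (h₂ := fun r : ℝ => r ^ 2 * Real.log r) (h₂' := 0)
      ![0, α, α] hasDerivAt_sq_mul_log_zero (hp 0)
    exact this.congr_fderiv (by simp)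
  exact h1.prodMk (((hp 0).prodMk h2).prodMk (((hp 2).sub (hp 1)).prodMk (hp 2)))

/-- To differentiate a function of `chart` at a point of the collision manifold it is enough to
know it for `φ₁ = 0` and `r² log r = 0`. -/
theorem hasFDerivAt_comp_chart {F : ℝ × (ℝ × ℝ) × (ℝ × ℝ) → ℝ} {α κ : ℝ}
    (hF : DifferentiableAt ℝ F (0, 0, (0, α)))
    (hd : ∀ ρ θ ψ : ℝ, HasDerivAt (fun t : ℝ => F (0, (t * ρ, 0), (t * θ, α + t * ψ))) (κ * θ) 0) :
    HasFDerivAt (fun p => F (chart p))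
      (κ • (ContinuousLinearMap.proj (R := ℝ) (φ := fun _ : Fin 3 => ℝ) 2
        - ContinuousLinearMap.proj (R := ℝ) (φ := fun _ : Fin 3 => ℝ) 1)) ![0, α, α] := by
  have h0 := hF.hasFDerivAt
  rw [← chart_base] at h0
  refine (h0.comp ![0, α, α] (hasFDerivAt_chart α)).congr_fderiv ?_
  ext1 v
  rw [chart_base]
  have hcurve : HasDerivAt (fun t : ℝ => ((0, (t * v 0, 0), (t * (v 2 - v 1), α + t * v 2)) :
      ℝ × (ℝ × ℝ) × (ℝ × ℝ))) (chartDeriv v) 0 := by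
    have hl : ∀ k : ℝ, HasDerivAt (fun t : ℝ => t * k) k 0 := fun k => by
      simpa using (hasDerivAt_id (0 : ℝ)).mul_const k
    exact (hasDerivAt_const _ _).prodMk (((hl _).prodMk (hasDerivAt_const _ _)).prodMk
      ((hl _).prodMk ((hl _).const_add α)))
  have h1 := HasFDerivAt.comp_hasDerivAt_of_eq (0 : ℝ) hF.hasFDerivAt hcurve (by simp; rfl)
  exact h1.unique (hd (v 0) (v 2 - v 1) (v 2))

/-- The charted expression is differentiable in a full neighbourhood and agrees with the field on
the phase space. Only K sin θ contributes to first order: the radial component carries r³, and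
`chartB` at φ = 0 carries r². -/
theorem hasFDerivWithinAt_field (hR : 0 < R) (hΓ : 0 < Γ) (α : ℝ) :
    HasFDerivWithinAt (field R Γ h) (saddleDeriv (Γ / (4 * Real.pi))) (phaseSpace R Γ h)
      ![0, α, α] := by
  set c := Γ / (4 * Real.pi) with hc
  have hc0 : 0 < c := by positivity
  obtain ⟨hK, hT, hB, hρ⟩ := contDiffAt_chart (h := h) hR α
  have hd : ∀ {F : ℝ × (ℝ × ℝ) × (ℝ × ℝ) → ℝ}, ContDiffAt ℝ 2 F (0, 0, (0, α)) →
      DifferentiableAt ℝ F (0, 0, (0, α)) := fun h => h.differentiableAt (by norm_num)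
  have hl : ∀ k : ℝ, HasDerivAt (fun t : ℝ => t * k) k 0 := fun k => by
    simpa using (hasDerivAt_id (0 : ℝ)).mul_const k
  have h0 : HasFDerivAt (fun p : Fin 3 → ℝ => p 0 ^ 3 * chartRho R Γ h (chart p))
      (0 : (Fin 3 → ℝ) →L[ℝ] ℝ) ![0, α, α] := by
    have h1 := (ContinuousLinearMap.proj (R := ℝ) (φ := fun _ : Fin 3 => ℝ) 0).hasFDerivAt
      (x := ![0, α, α])
    have hρ' := hd hρ
    rw [← chart_base] at hρ'
    have h2 := (h1.pow 3).mul (hρ'.hasFDerivAt.comp _ (hasFDerivAt_chart α))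
    refine h2.congr_fderiv ?_
    simp
  have h1 := hasFDerivAt_comp_chart (κ := c) (hd (hK.mul hT)) fun ρ θ ψ => by
    simp only [chartK_zero, chartT_zero hR, chartK₀]
    have a1 := (hl θ).sin
    have a2 : HasDerivAt (fun t : ℝ => Γ / (4 * Real.pi) + (t * ρ) ^ 2 *
        (h - Γ / (8 * Real.pi) * Real.log (2 * R ^ 2 / (8 * R ^ 2))) -
        Γ / (4 * Real.pi) * 0) 0 0 :=
      (((((hl ρ).pow 2).mul_const _).const_add _).sub_const _).congr_deriv (by simp)
    refine (a2.mul a1).congr_deriv ?_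
    simp [hc]
  have h2 := hasFDerivAt_comp_chart (κ := 0) (hd hB) fun ρ θ ψ => by
    simp only [chartB_zero hR]
    refine ((((hl ρ).pow 2).const_mul _).mul (hl θ).sin).congr_deriv ?_
    simp
  rw [zero_smul] at h2
  have hpi : HasFDerivAt (fun p => ![p 0 ^ 3 * chartRho R Γ h (chart p),
      chartK R Γ h (chart p) * chartT R (chart p), chartB R Γ h (chart p)])
      (saddleDeriv c) ![0, α, α] := by
    rw [saddleDeriv, hasFDerivAt_pi']
    intro i
    fin_cases i
    exacts [h0, h1, h2]
  have hev : ∀ᶠ p in 𝓝 ![0, α, α], phi1 (p 0) < 2 * R ∧ 0 < chartK R Γ h (chart p) := by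
    have hφc : Continuous fun p : Fin 3 → ℝ => phi1 (p 0) :=
      continuous_phi1.comp (continuous_apply 0)
    have hKc := hK.continuousAt
    rw [← chart_base] at hKc
    refine (hφc.continuousAt.eventually (gt_mem_nhds ?_)).and
      ((hKc.comp (f := chart) continuous_chart.continuousAt).eventually (lt_mem_nhds ?_))
    · simpa [phi1_zero] using hR
    · simp only [Function.comp, chart_base, chartK_zero, chartK₀_zero]; exact hc0
  refine hpi.hasFDerivWithinAt.congr_of_eventuallyEq ?_ ?_
  · filter_upwards [nhdsWithin_le_nhds hev, self_mem_nhdsWithin] with p hp hpM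
    exact field_eq_chart hR hpM.1 hp.1 hp.2
  · exact field_eq_chart hR le_rfl hev.self_of_nhds.1 hev.self_of_nhds.2

end

/-! ### Reversal of time -/

/-- The reversal hypotheses hold for e if and only if they hold for -e, so each inclusion proved for
a translation also gives the opposite inclusion. -/
theorem reverse_neg {E : Type*} [AddCommGroup E] {X : E → E} {e : E}
    (hX : ∀ p, X (p + e) = -X p) (p : E) : X (p + -e) = -X p := by
  have := hX (p + -e)
  rw [neg_add_cancel_right] at this
  rw [this, neg_neg]

theorem mem_reverse_neg {E : Type*} [AddCommGroup E] {M : Set E} {e : E}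
    (hM : ∀ p, p + e ∈ M ↔ p ∈ M) (p : E) : p + -e ∈ M ↔ p ∈ M := by
  have := hM (p + -e)
  rw [neg_add_cancel_right] at this
  exact this.symm

theorem image_add_image_neg {E : Type*} [AddCommGroup E] (U : Set E) (e : E) :
    (· + -e) '' ((· + e) '' U) = U := by
  rw [image_image]; simp

/-! ### Translations that reverse time exchange stable and unstable sets. -/

section Reversal

variable {E : Type*} [NormedAddCommGroup E] [NormedSpace ℝ E] {X : E → E} {M U : Set E} {P e : E}

theorem IsSolution.reverse {S T : Set ℝ} {γ : ℝ → E} (hX : ∀ p, X (p + e) = -X p)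
    (hM : ∀ p, p + e ∈ M ↔ p ∈ M) (hST : MapsTo Neg.neg S T) (hγ : IsSolution X (M ∩ U) T γ) :
    IsSolution X (M ∩ (· + e) '' U) S fun t => γ (-t) + e := fun t ht => by
  obtain ⟨h1, h2⟩ := hγ (-t) (hST ht)
  refine ⟨⟨(hM _).2 h1.1, mem_image_of_mem _ h1.2⟩, ?_⟩
  have h3 := (h2.scomp t (hasDerivAt_neg t).hasDerivWithinAt hST).add_const e
  rw [hX]
  simpa using h3

theorem add_mem_stableSet (hX : ∀ p, X (p + e) = -X p) (hM : ∀ p, p + e ∈ M ↔ p ∈ M) {p : E}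
    (hp : p ∈ unstableSet X M P U) : p + e ∈ stableSet X M (P + e) ((· + e) '' U) := by
  obtain ⟨γ, rfl, hγ, hlim⟩ := hp
  refine ⟨fun t => γ (-t) + e, by simp, hγ.reverse hX hM fun t ht => ?_, ?_⟩
  · exact neg_nonpos.2 (mem_Ici.1 ht)
  · exact (hlim.comp tendsto_neg_atTop_atBot).add_const e

theorem add_mem_unstableSet (hX : ∀ p, X (p + e) = -X p) (hM : ∀ p, p + e ∈ M ↔ p ∈ M) {p : E}
    (hp : p ∈ stableSet X M P U) : p + e ∈ unstableSet X M (P + e) ((· + e) '' U) := by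
  obtain ⟨γ, rfl, hγ, hlim⟩ := hp
  refine ⟨fun t => γ (-t) + e, by simp, hγ.reverse hX hM fun t ht => ?_, ?_⟩
  · exact neg_nonneg.2 (mem_Iic.1 ht)
  · exact (hlim.comp tendsto_neg_atBot_atTop).add_const e

theorem add_mem_centreSet (hX : ∀ p, X (p + e) = -X p) (hM : ∀ p, p + e ∈ M ↔ p ∈ M) {p : E}
    (hp : p ∈ centreSet X M U) : p + e ∈ centreSet X M ((· + e) '' U) := by
  obtain ⟨γ, rfl, hγ⟩ := hp
  exact ⟨fun t => γ (-t) + e, by simp, hγ.reverse hX hM fun t _ => mem_univ _⟩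

theorem stableSet_add (hX : ∀ p, X (p + e) = -X p) (hM : ∀ p, p + e ∈ M ↔ p ∈ M) :
    stableSet X M (P + e) ((· + e) '' U) = (· + e) '' unstableSet X M P U := by
  refine Subset.antisymm (fun p hp => ⟨p + -e, ?_, by simp⟩)
    (image_subset_iff.2 fun p hp => add_mem_stableSet hX hM hp)
  have := add_mem_unstableSet (reverse_neg hX) (mem_reverse_neg hM) hp
  rwa [image_add_image_neg, add_neg_cancel_right] at this

theorem unstableSet_add (hX : ∀ p, X (p + e) = -X p) (hM : ∀ p, p + e ∈ M ↔ p ∈ M) :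
    unstableSet X M (P + e) ((· + e) '' U) = (· + e) '' stableSet X M P U := by
  refine Subset.antisymm (fun p hp => ⟨p + -e, ?_, by simp⟩)
    (image_subset_iff.2 fun p hp => add_mem_unstableSet hX hM hp)
  have := add_mem_stableSet (reverse_neg hX) (mem_reverse_neg hM) hp
  rwa [image_add_image_neg, add_neg_cancel_right] at this

theorem centreSet_add (hX : ∀ p, X (p + e) = -X p) (hM : ∀ p, p + e ∈ M ↔ p ∈ M) :
    centreSet X M ((· + e) '' U) = (· + e) '' centreSet X M U := by
  refine Subset.antisymm (fun p hp => ⟨p + -e, ?_, by simp⟩)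
    (image_subset_iff.2 fun p hp => add_mem_centreSet hX hM hp)
  have := add_mem_centreSet (reverse_neg hX) (mem_reverse_neg hM) hp
  rwa [image_add_image_neg] at this

theorem IsArc.add_const {I : Set ℝ} {S : Set E} {v : E} (hS : IsArc I S P v) (e : E) :
    IsArc I ((· + e) '' S) (P + e) v := by
  obtain ⟨c, hc, hc', hemb, rfl, rfl, rfl⟩ := hS
  refine ⟨fun t => c t + e, hc.add contDiffOn_const, fun t ht => ?_, ?_, ?_, rfl, ?_⟩
  · rw [derivWithin_add_const]; exact hc' t ht
  · exact (Homeomorph.addRight e).isEmbedding.comp hemb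
  · rw [image_image]
  · rw [derivWithin_add_const]

theorem IsArc.exists_ne {I : Set ℝ} {S : Set E} {v : E} (hS : IsArc I S P v) (h0 : (0 : ℝ) ∈ I)
    {t : ℝ} (ht : t ∈ I) (ht0 : t ≠ 0) : ∃ p ∈ S, p ≠ P := by
  obtain ⟨c, -, -, hemb, rfl, rfl, -⟩ := hS
  exact ⟨c t, mem_image_of_mem c ht, fun h =>
    ht0 (congrArg Subtype.val (hemb.injective (a₁ := ⟨t, ht⟩) (a₂ := ⟨0, h0⟩) h))⟩

theorem IsCurveThrough.exists_ne {S : Set E} {v : E} (hS : IsCurveThrough S P v) :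
    ∃ p ∈ S, p ≠ P := by
  obtain ⟨δ, hδ, hS⟩ := hS
  exact hS.exists_ne ⟨by linarith, hδ⟩ (t := δ / 2) ⟨by linarith, by linarith⟩ (by positivity)

theorem IsCurveFrom.exists_ne {S : Set E} {v : E} (hS : IsCurveFrom S P v) :
    ∃ p ∈ S, p ≠ P := by
  obtain ⟨δ, hδ, hS⟩ := hS
  exact hS.exists_ne ⟨le_rfl, hδ⟩ (t := δ / 2) ⟨by linarith, by linarith⟩ (by positivity)

theorem IsSolution.mono {S S' : Set E} {T : Set ℝ} {γ : ℝ → E} (hγ : IsSolution X S T γ)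
    (h : S ⊆ S') : IsSolution X S' T γ := fun t ht => ⟨h (hγ t ht).1, (hγ t ht).2⟩

theorem stableSet_mono {V : Set E} (h : U ⊆ V) : stableSet X M P U ⊆ stableSet X M P V :=
  fun _ ⟨γ, h0, hγ, hl⟩ => ⟨γ, h0, hγ.mono (inter_subset_inter_right M h), hl⟩

theorem unstableSet_mono {V : Set E} (h : U ⊆ V) : unstableSet X M P U ⊆ unstableSet X M P V :=
  fun _ ⟨γ, h0, hγ, hl⟩ => ⟨γ, h0, hγ.mono (inter_subset_inter_right M h), hl⟩

end Reversal

/-! ### The half-turn ψ ↦ ψ + π, and the matrix of the linearisation. -/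

section

variable {R Γ h : ℝ}

theorem zx_add_pi (r α ψ : ℝ) : zx R Γ h r α (ψ + Real.pi) = -zx R Γ h r α ψ := by
  simp [zx, Real.cos_add_pi]

theorem zy_add_pi (r α ψ : ℝ) : zy R Γ h r α (ψ + Real.pi) = -zy R Γ h r α ψ := by
  simp [zy, Real.sin_add_pi]

theorem zs_add_pi (r α ψ : ℝ) : zs R Γ h r α (ψ + Real.pi) = -zs R Γ h r α ψ := by
  simp only [zs, zx_add_pi, zy_add_pi]; ring

theorem dTau_add_pi (f : ℝ → ℝ → ℝ) (r α ψ : ℝ) :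
    dTau f R Γ h r α (ψ + Real.pi) = -dTau f R Γ h r α ψ := by
  simp only [dTau, rTau, alphaTau, zs_add_pi, zx_add_pi, zy_add_pi]; ring

theorem A1_add_pi (r α ψ : ℝ) : A1 R Γ h r α (ψ + Real.pi) = A1 R Γ h r α ψ := by
  simp only [A1, zs_add_pi, zx_add_pi, zy_add_pi]; ring

theorem A2_add_pi (r α ψ : ℝ) : A2 R Γ h r α (ψ + Real.pi) = A2 R Γ h r α ψ := by
  simp only [A2, zs_add_pi, zx_add_pi, zy_add_pi]; ring

theorem B_add_pi (r α ψ : ℝ) : B R Γ h r α (ψ + Real.pi) = -B R Γ h r α ψ := by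
  by_cases hr : r = 0
  · simp [B, hr]
  · simp only [B, if_neg hr, dTau_add_pi, A1_add_pi, A2_add_pi, Real.sin_add_pi, Real.cos_add_pi]
    ring

/-- The half-turn changes the sign of z. `A1` and `A2` are even in z and derivatives along the flow
are odd; with the trigonometric prefactors every component of the field becomes odd. -/
theorem field_add_pi (p : Fin 3 → ℝ) :
    field R Γ h (p + ![0, 0, Real.pi]) = -field R Γ h p := by
  have e0 : (p + ![0, 0, Real.pi]) 0 = p 0 := by simp
  have e1 : (p + ![0, 0, Real.pi]) 1 = p 1 := by simp
  have e2 : (p + ![0, 0, Real.pi]) 2 = p 2 + Real.pi := by simp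
  ext i
  simp only [field, e0, e1, e2, B_add_pi, Real.sin_add_pi, Real.cos_add_pi]
  fin_cases i <;> simp <;> ring

theorem mem_phaseSpace_add_pi (p : Fin 3 → ℝ) :
    p + ![0, 0, Real.pi] ∈ phaseSpace R Γ h ↔ p ∈ phaseSpace R Γ h := by
  have e0 : (p + ![0, 0, Real.pi]) 0 = p 0 := by simp
  have e1 : (p + ![0, 0, Real.pi]) 1 = p 1 := by simp
  simp only [phaseSpace, mem_ofPred_eq, e0, e1]

theorem add_pi_eq (α : ℝ) : (![0, α, α] : Fin 3 → ℝ) + ![0, 0, Real.pi] = ![0, α, Real.pi + α] := by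
  ext i; fin_cases i <;> simp [add_comm]

/-! ### The linearisation -/

theorem saddleDeriv_eq_toLin' (κ : ℝ) :
    (saddleDeriv κ : (Fin 3 → ℝ) →ₗ[ℝ] (Fin 3 → ℝ)) =
      Matrix.toLin' !![0, 0, 0; 0, -κ, κ; 0, 0, 0] := by
  ext1 i
  ext1
  simp only [LinearMap.comp_apply, ContinuousLinearMap.coe_coe, saddleDeriv_apply]
  ext j
  fin_cases i <;> fin_cases j <;> simp

theorem saddleDeriv_det (κ : ℝ) : (saddleDeriv κ).det = 0 := by
  rw [ContinuousLinearMap.det, saddleDeriv_eq_toLin', LinearMap.det_toLin', Matrix.det_fin_three]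
  simp

open Polynomial in
theorem saddleDeriv_charpoly_roots (κ : ℝ) :
    (LinearMap.charpoly (saddleDeriv κ : (Fin 3 → ℝ) →ₗ[ℝ] (Fin 3 → ℝ))).roots = {0, -κ, 0} := by
  have h : LinearMap.charpoly (saddleDeriv κ : (Fin 3 → ℝ) →ₗ[ℝ] (Fin 3 → ℝ)) =
      (Multiset.map (fun a => X - C a) ({0, -κ, 0} : Multiset ℝ)).prod := by
    rw [saddleDeriv_eq_toLin', Matrix.charpoly_toLin', Matrix.charpoly, Matrix.det_fin_three]
    simp
    ring
  rw [h, roots_multiset_prod_X_sub_C]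

theorem linearIndependent_saddle :
    LinearIndependent ℝ ![![0, 1, 0], ![1, 0, 0], (![0, 1, 1] : Fin 3 → ℝ)] := by
  rw [Fintype.linearIndependent_iff]
  intro g hg
  have h0 := congrFun hg 0
  have h1 := congrFun hg 1
  have h2 := congrFun hg 2
  simp [Fin.sum_univ_three] at h0 h1 h2
  intro i
  fin_cases i
  · simpa [h2] using h1
  · exact h0
  · exact h2

theorem linearIndependent_saddle' :
    LinearIndependent ℝ ![![1, 0, 0], ![0, 1, 0], (![0, 1, 1] : Fin 3 → ℝ)] := by
  rw [Fintype.linearIndependent_iff]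
  intro g hg
  have h0 := congrFun hg 0
  have h1 := congrFun hg 1
  have h2 := congrFun hg 2
  simp [Fin.sum_univ_three] at h0 h1 h2
  intro i
  fin_cases i
  · exact h0
  · simpa [h2] using h1
  · exact h2

theorem hasFDerivWithinAt_field_add_pi (hR : 0 < R) (hΓ : 0 < Γ) (α : ℝ) :
    HasFDerivWithinAt (field R Γ h) (saddleDeriv (-(Γ / (4 * Real.pi)))) (phaseSpace R Γ h)
      ![0, α, Real.pi + α] := by
  set e : Fin 3 → ℝ := ![0, 0, Real.pi] with he
  have h0 := hasFDerivWithinAt_field (h := h) hR hΓ α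
  have hP : (![0, α, Real.pi + α] : Fin 3 → ℝ) - e = ![0, α, α] := by
    rw [← add_pi_eq, add_sub_cancel_right]
  rw [← hP] at h0
  have hmaps : MapsTo (fun p => p - e) (phaseSpace R Γ h) (phaseSpace R Γ h) := fun p hp => by
    simp only [sub_eq_add_neg]
    exact (mem_reverse_neg mem_phaseSpace_add_pi p).2 hp
  have h1 := (h0.comp (![0, α, Real.pi + α] : Fin 3 → ℝ)
    ((hasFDerivWithinAt_id _ _).sub_const e) hmaps).neg
  have hf : -(field R Γ h ∘ fun p => p - e) = field R Γ h := by
    funext p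
    simp only [Pi.neg_apply, Function.comp, sub_eq_add_neg]
    rw [reverse_neg field_add_pi, neg_neg]
  rw [← hf]
  refine h1.congr_fderiv ?_
  ext1 v
  simp [saddleDeriv_apply]

theorem isDegenerateSaddle_of_arcs {X : (Fin 3 → ℝ) → (Fin 3 → ℝ)} {M : Set (Fin 3 → ℝ)}
    {P : Fin 3 → ℝ} {κ : ℝ} (hPM : P ∈ M) (hXP : X P = 0)
    (hJ : HasFDerivWithinAt X (saddleDeriv κ) M P)
    (harcs : ∀ V ∈ 𝓝 P, ∃ U ⊆ V, (∃ p ∈ stableSet X M P U, p ≠ P) ∧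
      ∃ p ∈ unstableSet X M P U, p ≠ P) : IsDegenerateSaddle X M P := by
  refine ⟨hPM, hXP, ⟨_, hJ, saddleDeriv_det κ⟩, fun V hV => ?_⟩
  obtain ⟨U, hUV, ⟨p, hp, hpP⟩, q, hq, hqP⟩ := harcs V hV
  exact ⟨⟨p, stableSet_mono hUV hp, hpP⟩, q, unstableSet_mono hUV hq, hqP⟩

end

end McGehee

end

theorem mainTheorem1 (R Γ h : ℝ) (hR : 0 < R) (hΓ : 0 < Γ) (α : ℝ) :
    (McGehee.IsDegenerateSaddle (McGehee.field R Γ h) (McGehee.phaseSpace R Γ h) ![0, α, α] ∧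
      ∃ J : (Fin 3 → ℝ) →L[ℝ] (Fin 3 → ℝ),
        HasFDerivWithinAt (McGehee.field R Γ h) J (McGehee.phaseSpace R Γ h) ![0, α, α] ∧
        (LinearMap.charpoly (J : (Fin 3 → ℝ) →ₗ[ℝ] (Fin 3 → ℝ))).roots
          = {0, -(Γ / (4 * Real.pi)), 0} ∧
        ∃ vs vu v0 : Fin 3 → ℝ,
          LinearIndependent ℝ ![vs, vu, v0] ∧
          J vs = (-(Γ / (4 * Real.pi))) • vs ∧ J vu = 0 ∧ J v0 = 0 ∧
          ∀ V ∈ 𝓝 (![0, α, α] : Fin 3 → ℝ), ∃ U ⊆ V, IsOpen U ∧ ![0, α, α] ∈ U ∧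
            McGehee.IsCurveThrough
              (McGehee.stableSet (McGehee.field R Γ h) (McGehee.phaseSpace R Γ h) ![0, α, α] U)
              ![0, α, α] vs ∧
            McGehee.IsCurveFrom
              (McGehee.unstableSet (McGehee.field R Γ h) (McGehee.phaseSpace R Γ h) ![0, α, α] U)
              ![0, α, α] vu ∧
            McGehee.IsCurveThrough
              (McGehee.centreSet (McGehee.field R Γ h) (McGehee.phaseSpace R Γ h) U)
              ![0, α, α] v0) ∧
    (McGehee.IsDegenerateSaddle (McGehee.field R Γ h) (McGehee.phaseSpace R Γ h)
        ![0, α, Real.pi + α] ∧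
      ∃ J : (Fin 3 → ℝ) →L[ℝ] (Fin 3 → ℝ),
        HasFDerivWithinAt (McGehee.field R Γ h) J (McGehee.phaseSpace R Γ h)
          ![0, α, Real.pi + α] ∧
        (LinearMap.charpoly (J : (Fin 3 → ℝ) →ₗ[ℝ] (Fin 3 → ℝ))).roots
          = {0, Γ / (4 * Real.pi), 0} ∧
        ∃ vs vu v0 : Fin 3 → ℝ,
          LinearIndependent ℝ ![vs, vu, v0] ∧
          J vu = (Γ / (4 * Real.pi)) • vu ∧ J vs = 0 ∧ J v0 = 0 ∧
          ∀ V ∈ 𝓝 (![0, α, Real.pi + α] : Fin 3 → ℝ),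
            ∃ U ⊆ V, IsOpen U ∧ ![0, α, Real.pi + α] ∈ U ∧
            McGehee.IsCurveFrom
              (McGehee.stableSet (McGehee.field R Γ h) (McGehee.phaseSpace R Γ h)
                ![0, α, Real.pi + α] U)
              ![0, α, Real.pi + α] vs ∧
            McGehee.IsCurveThrough
              (McGehee.unstableSet (McGehee.field R Γ h) (McGehee.phaseSpace R Γ h)
                ![0, α, Real.pi + α] U)
              ![0, α, Real.pi + α] vu ∧
            McGehee.IsCurveThrough
              (McGehee.centreSet (McGehee.field R Γ h) (McGehee.phaseSpace R Γ h) U)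
              ![0, α, Real.pi + α] v0) := by
  obtain ⟨ρ, G, c₁, c₂, K, δ, hX⟩ := McGehee.exists_saddleModel (h := h) hR hΓ α
  have hP := hX.apply_equilibrium (β := α) (by simpa using hX.stiff.pos)
  have hJ := McGehee.hasFDerivWithinAt_field (h := h) hR hΓ α
  have hJ' := McGehee.hasFDerivWithinAt_field_add_pi (h := h) hR hΓ α
  have hrev := McGehee.field_add_pi (R := R) (Γ := Γ) (h := h)
  have hrevM := McGehee.mem_phaseSpace_add_pi (R := R) (Γ := Γ) (h := h)
  have hadd := McGehee.add_pi_eq α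
  have harcs' : ∀ V ∈ 𝓝 (![0, α, Real.pi + α] : Fin 3 → ℝ),
      ∃ U ⊆ V, IsOpen U ∧ ![0, α, Real.pi + α] ∈ U ∧
        McGehee.IsCurveFrom
          (McGehee.stableSet (McGehee.field R Γ h) (McGehee.phaseSpace R Γ h)
            ![0, α, Real.pi + α] U) ![0, α, Real.pi + α] ![1, 0, 0] ∧
        McGehee.IsCurveThrough
          (McGehee.unstableSet (McGehee.field R Γ h) (McGehee.phaseSpace R Γ h)
            ![0, α, Real.pi + α] U) ![0, α, Real.pi + α] ![0, 1, 0] ∧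
        McGehee.IsCurveThrough
          (McGehee.centreSet (McGehee.field R Γ h) (McGehee.phaseSpace R Γ h) U)
          ![0, α, Real.pi + α] ![0, 1, 1] := by
    intro V hV
    rw [← hadd] at hV ⊢
    obtain ⟨U, hUV, hUo, hPU, ⟨d₁, hd₁, h₁⟩, ⟨d₂, hd₂, h₂⟩, d₃, hd₃, h₃⟩ := hX.exists_arcs
      ((continuous_add_const (![0, 0, Real.pi] : Fin 3 → ℝ)).continuousAt.preimage_mem_nhds hV)
    -- Time is reversed, so the boundary arc h₂ of the unstable set at P₁ becomes the stable arc at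
    -- P₂, and h₁ becomes the unstable one.
    refine ⟨(· + ![0, 0, Real.pi]) '' U, image_subset_iff.2 hUV,
      (Homeomorph.addRight (![0, 0, Real.pi] : Fin 3 → ℝ)).isOpenMap U hUo,
      mem_image_of_mem _ hPU, ⟨d₂, hd₂, ?_⟩, ⟨d₁, hd₁, ?_⟩, ⟨d₃, hd₃, ?_⟩⟩
    · rw [McGehee.stableSet_add hrev hrevM]; exact h₂.add_const _
    · rw [McGehee.unstableSet_add hrev hrevM]; exact h₁.add_const _
    · rw [McGehee.centreSet_add hrev hrevM]; exact h₃.add_const _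
  refine ⟨⟨?_, _, hJ, McGehee.saddleDeriv_charpoly_roots _, ![0, 1, 0], ![1, 0, 0], ![0, 1, 1],
    McGehee.linearIndependent_saddle, ?_, ?_, ?_, fun V hV => hX.exists_arcs hV⟩,
    ⟨?_, _, hJ', ?_, ![1, 0, 0], ![0, 1, 0], ![0, 1, 1],
      McGehee.linearIndependent_saddle', ?_, ?_, ?_, harcs'⟩⟩
  · refine McGehee.isDegenerateSaddle_of_arcs hP.1.1 hP.2 hJ fun V hV => ?_
    obtain ⟨U, hUV, -, -, h₁, h₂, -⟩ := hX.exists_arcs hV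
    exact ⟨U, hUV, h₁.exists_ne, h₂.exists_ne⟩
  · rw [McGehee.saddleDeriv_apply]; ext i; fin_cases i <;> simp
  · rw [McGehee.saddleDeriv_apply]; ext i; fin_cases i <;> simp
  · rw [McGehee.saddleDeriv_apply]; ext i; fin_cases i <;> simp
  · refine McGehee.isDegenerateSaddle_of_arcs ?_ ?_ hJ' fun V hV => ?_
    · rw [← hadd, hrevM]; exact hP.1.1
    · rw [← hadd, hrev, hP.2, neg_zero]
    · obtain ⟨U, hUV, -, -, h₁, h₂, -⟩ := harcs' V hV
      exact ⟨U, hUV, h₁.exists_ne, h₂.exists_ne⟩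
  · simpa using McGehee.saddleDeriv_charpoly_roots (-(Γ / (4 * Real.pi)))
  · rw [McGehee.saddleDeriv_apply]; ext i; fin_cases i <;> simp
  · rw [McGehee.saddleDeriv_apply]; ext i; fin_cases i <;> simp
  · rw [McGehee.saddleDeriv_apply]; ext i; fin_cases i <;> simp
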